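/- Let $F=\mathrm{GF}(q)$ with its elements listed in a fixed order $\alpha_0,\dots,\alpha_{q-1}$, and let $\rho(\alpha_i)=i$. Let $\binom{n}{k}_q$ be the Gaussian coefficient, and let $e_0,e_1,\dots$ be the standard unit vectors. For a matrix $C$ let $\Lambda(C)$ be the set of columns that contain the leading (first non-zero) coefficient of a row. **Canonical matrices.** For a $k\times n$ matrix $M$ of rank $k$ in reduced row echelon form define $\tau(M)$ recursively. If $k=0$, $\tau(M)$ is empty. If the last column is zero, delete it, apply $\tau$, and append a zero column. Otherwise let $i$ be the lowest row with a non-zero last entry; scale it so that its last entry is $1$, use it to clear the last column in the other rows, delete row $i$ and the last column, apply $\tau$, append a zero column, and re-insert the (scaled) row $i$ as row $i$. The canonical matrix of a $k$-dimensional subspace $W\subseteq F^n$ is $\tau(M)$, where $M$ is the reduced row echelon form matrix with row space $W$. **Encoding.** For $0\le m<\binom nk_q$ put $\mathcal E_{n,k;q}(m)=[I_k\,|\,0]$ if $k\in\{0,n\}$. Otherwise $\mathcal E_{n,k;q}(m)=[\mathcal E_{n-1,k;q}(m)\,|\,0]$ if $m<\binom{n-1}k_q$. In the remaining case let $m'=m-\binom{n-1}{k}_q+1$,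 $i=\lfloor m'/q^{n-k}\rfloor \bmod \binom{n-1}{k-1}_q$, $j=m'\bmod q^{n-k}$, $C=\mathcal E_{n-1,k-1;q}(i)$, and let $r_0<\dots<r_{n-k-1}$ be the elements of $\{0,\dots,n-2\}\setminus\Lambda(C)$. Then $\mathcal E_{n,k;q}(m)$ is $[C\,|\,0]$ with the additional row $v=e_{n-1}+\sum_{\ell}\alpha_{[j]_\ell}e_{r_\ell}$, inserted so that the leading coefficients move to the right from row to row; here $[j]_\ell$ is the $\ell$-th base-$q$ digit of $j$. **Decoding.** For a canonical $k\times n$ matrix $X$ put $\mathcal D_{n,k;q}(X)=0$ if $k\in\{0,n\}$. Otherwise, if the last column of $X$ is zero, $\mathcal D_{n,k;q}(X)=\mathcal D_{n-1,k;q}(X^-)$, where $X^-$ is $X$ without its last column. In the remaining case let $v$ be the row with a non-zero last entry, $C$ the matrix $X$ without this row and without its last column, $r_0<\dots<r_{n-k-1}$ the elements of $\{0,\dots,n-2\}\setminus\Lambda(C)$, and $$\mathcal D_{n,k;q}(X)=\tbinom{n-1}{k}_q+\Big(\Big(q^{n-k}\,\mathcal D_{n-1,k-1;q}(C)-1+\sum_{\ell}\rho(v_{r_\ell})q^\ell\Big)\bmod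 q^{n-k}\tbinom{n-1}{k-1}_q\Big).$$ **Model.** Programs run on a random access machine with finitely many registers and arrays of words, whose operations (access, addition, truncated subtraction, comparison, assignment, store) cost one step each. All words are smaller than a fixed power of $q+n$ (of $q+m$ for the multiplication of $m$-digit numbers). Integers are stored as arrays of base-$q$ digits, and $\alpha_i$ is stored as the word $i$. A function $M:\mathbb N\to\mathbb N$ is called a multiplication cost for base $q$ if some program multiplies any two $m$-digit base-$q$ numbers in at most $M[m]$ steps, for every $m$. **Theorem.** There are two programs and an absolute constant $K$ such that for every finite field $F=\mathrm{GF}(q)$, every ordering of its elements, all $1\le k\le n$ and every multiplication cost $M$ for base $q$, one has $\mathcal D_{n,k;q}(\mathcal E_{n,k;q}(m))=m$ for all $0\le m<\binom nk_q$, and 1. the first program, given $q,n,k$, the words for $0,1\in F$, and the digits of any $m$ with $0\le m<\binom nk_q$, computes the matrix $\mathcal E_{n,k;q}(m)$ in at most $K\cdot M[nk]\cdot n$ steps; 2. the second program, given $q,n,k$, the words for $0,1\in F$, and the canonical matrix $X$ of any $k$-dimensional subspace of $F^n$, computes the digits of $\mathcal D_{n,k;q}(X)$ in at most $K\cdot M[nk]\cdot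 n$ steps. -/

import Mathlib

namespace GrassGray

/-! ### Gaussian coefficients -/

/-- The `q`-number `[k]_q = 1 + q + ⋯ + q ^ (k - 1)`. -/
def qNumber (q k : ℕ) : ℕ := ∑ i ∈ Finset.range k, q ^ i

/-- `[k]_q ! = [k]_q [k - 1]_q ⋯ [1]_q`. -/
def qFactorial (q k : ℕ) : ℕ := ∏ i ∈ Finset.range k, qNumber q (i + 1)

/-- The Gaussian coefficient of `n` and `k` (it is only used for `k ≤ n`, where the division
is exact). -/
def gauss (q n k : ℕ) : ℕ := qFactorial q n / (qFactorial q k * qFactorial q (n - k))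

/-- The `l`-th base-`q` digit of `j`. -/
def digit (q j l : ℕ) : ℕ := j / q ^ l % q

/-! ### Canonical matrices of subspaces -/

section Matrices

variable {F : Type*} [Field F]

/-- `c` is the position of the leading coefficient of the row of `M` with index `r`. -/
def IsLead {k n : ℕ} (M : Matrix (Fin k) (Fin n) F) (r : Fin k) (c : Fin n) : Prop :=
  M r c ≠ 0 ∧ ∀ c' < c, M r c' = 0

instance [DecidableEq F] {k n : ℕ} (M : Matrix (Fin k) (Fin n) F) (r : Fin k) (c : Fin n) :
    Decidable (IsLead M r c) :=
  inferInstanceAs (Decidable (M r c ≠ 0 ∧ ∀ c' < c, M r c' = 0))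

/-- `M` is a `k × n` matrix of rank `k` in reduced row echelon form. -/
def IsRREF {k n : ℕ} (M : Matrix (Fin k) (Fin n) F) : Prop :=
  ∃ p : Fin k → Fin n, StrictMono p ∧
    ∀ r, (∀ c < p r, M r c = 0) ∧ ∀ r', M r' (p r) = if r' = r then 1 else 0

/-- `[M | 0]`: a zero column is appended on the right. -/
def appendZero {k n : ℕ} (M : Matrix (Fin k) (Fin n) F) : Matrix (Fin k) (Fin (n + 1)) F :=
  fun r => Fin.snoc (α := fun _ => F) (M r) 0

/-- The last column is deleted. -/
def dropLast {k n : ℕ} (M : Matrix (Fin k) (Fin (n + 1)) F) : Matrix (Fin k) (Fin n) F :=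
  fun r c => M r c.castSucc

/-- The row `v` is inserted in such a way that it becomes the row with index `i`. -/
def insertRow {k n : ℕ} (i : Fin (k + 1)) (v : Fin n → F) (M : Matrix (Fin k) (Fin n) F) :
    Matrix (Fin (k + 1)) (Fin n) F :=
  Fin.insertNth (α := fun _ => Fin n → F) i v M

/-- The row with index `i` is deleted. -/
def deleteRow {k n : ℕ} (i : Fin (k + 1)) (M : Matrix (Fin (k + 1)) (Fin n) F) :
    Matrix (Fin k) (Fin n) F :=
  fun r => M (i.succAbove r)

variable [DecidableEq F]

/-- The set `Λ(M)` of the columns of `M` that contain a leading coefficient. -/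
def leadCols {k n : ℕ} (M : Matrix (Fin k) (Fin n) F) : Finset (Fin n) :=
  Finset.univ.filter fun c => ∃ r, IsLead M r c

/-- The elements of `{0, …, n - 1} \ Λ(M)`, in increasing order. -/
def freeCol {k n : ℕ} (M : Matrix (Fin k) (Fin n) F) : Fin (leadCols M)ᶜ.card ↪o Fin n :=
  (leadCols M)ᶜ.orderEmbOfFin rfl

/-- The rows with a non-zero entry in the last column. -/
def lastSupport {k n : ℕ} (M : Matrix (Fin k) (Fin (n + 1)) F) : Finset (Fin k) :=
  Finset.univ.filter fun r => M r (Fin.last n) ≠ 0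

/-- The transformation `τ` from reduced row echelon form to canonical form. -/
def tau : {k n : ℕ} → Matrix (Fin k) (Fin n) F → Matrix (Fin k) (Fin n) F
  | 0, _, M => M
  | _ + 1, 0, M => M
  | _ + 1, _ + 1, M =>
    if h : (lastSupport M).Nonempty then
      let i := (lastSupport M).max' h
      let v := (M i (Fin.last _))⁻¹ • M i
      let M' := fun r => M r - M r (Fin.last _) • v
      insertRow i v (appendZero (tau (dropLast (deleteRow i M'))))
    else appendZero (tau (dropLast M))

/-- `X` is the canonical matrix `τ(M)` of the subspace `W`, where `M` is the reduced row echelon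
form matrix whose rows are a basis of `W`. -/
def IsCanonical {k n : ℕ} (W : Submodule F (Fin n → F)) (X : Matrix (Fin k) (Fin n) F) : Prop :=
  ∃ M : Matrix (Fin k) (Fin n) F, IsRREF M ∧ Submodule.span F (Set.range M) = W ∧ X = tau M

/-! ### The encoding and decoding functions -/

/-- The number of rows of `M` whose leading coefficient is strictly to the left of that of `v`. -/
def rowPosition {k n : ℕ} (M : Matrix (Fin k) (Fin n) F) (v : Fin n → F) : Fin (k + 1) :=
  ⟨(Finset.univ.filter fun r => ∃ c, IsLead M r c ∧ ∀ c' ≤ c, v c' = 0).card,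
    Nat.lt_succ_of_le ((Finset.card_le_univ _).trans_eq (Fintype.card_fin k))⟩

variable [Fintype F]

/-- The vector `e_{n - 1} + ∑ l, α_{[j]_l} e_{r_l}`, where `r_0 < r_1 < ⋯` are the non-leading
columns of `C` (and `C` has `n - 1` columns). -/
def newVector (α : Fin (Fintype.card F) ≃ F) {k n : ℕ} (C : Matrix (Fin k) (Fin n) F) (j : ℕ) :
    Fin (n + 1) → F :=
  Pi.single (Fin.last n) 1 + ∑ l : Fin (leadCols C)ᶜ.card,
    α ⟨digit (Fintype.card F) j l, Nat.mod_lt _ Fintype.card_pos⟩ •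
      Pi.single (freeCol C l).castSucc (1 : F)

/-- The `k × n` matrix `[I_k | 0]`. -/
def simpleMatrix (k n : ℕ) : Matrix (Fin k) (Fin n) F :=
  fun r c => if (r : ℕ) = c then 1 else 0

/-- The encoding function `𝓔_{n,k;q}`, with values in the canonical matrices. -/
def encode (α : Fin (Fintype.card F) ≃ F) : (n k : ℕ) → ℕ → Matrix (Fin k) (Fin n) F
  | n, 0, _ => simpleMatrix 0 n
  | 0, k + 1, _ => simpleMatrix (k + 1) 0
  | n + 1, k + 1, m =>
    let q := Fintype.card F
    if k = n then simpleMatrix (k + 1) (n + 1)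
    else if m < gauss q n (k + 1) then appendZero (encode α n (k + 1) m)
    else
      let i := (m - gauss q n (k + 1) + 1) / q ^ (n - k) % gauss q n k
      let j := (m - gauss q n (k + 1) + 1) % q ^ (n - k)
      let C := encode α n k i
      let v := newVector α C j
      insertRow (rowPosition (appendZero C) v) v (appendZero C)

/-- The decoding function `𝓓_{n,k;q}` on canonical matrices. -/
def decode (α : Fin (Fintype.card F) ≃ F) : {n k : ℕ} → Matrix (Fin k) (Fin n) F → ℕ
  | _, 0, _ => 0
  | 0, _ + 1, _ => 0
  | n + 1, k + 1, X =>
    let q := Fintype.card F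
    if k = n then 0
    else if h : (lastSupport X).Nonempty then
      let i := (lastSupport X).max' h
      let v := X i
      let C := dropLast (deleteRow i X)
      let s := ∑ l : Fin (leadCols C)ᶜ.card, (α.symm (v (freeCol C l).castSucc) : ℕ) * q ^ (l : ℕ)
      gauss q n (k + 1) +
        (((q ^ (n - k) * decode α C : ℤ) - 1 + s) % (q ^ (n - k) * gauss q n k : ℤ)).toNat
    else decode α (dropLast X)

end Matrices

/-! ### The machine model

A random access machine with finitely many registers and finitely many arrays (those that occur
in the program), which hold machine words. The only arithmetic is addition and truncated
subtraction of words. A constant, a register access, an array access, an addition, a subtraction,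
a comparison, an assignment and a store cost one step each. -/

/-- The contents of the registers and of the arrays. -/
structure State where
  reg : ℕ → ℕ
  mem : ℕ → ℕ → ℕ

/-- The register `x` is set to `w`. -/
def State.setReg (s : State) (x w : ℕ) : State := ⟨Function.update s.reg x w, s.mem⟩

/-- The cell with index `i` of the array `a` is set to `w`. -/
def State.setMem (s : State) (a i w : ℕ) : State :=
  ⟨s.reg, Function.update s.mem a (Function.update (s.mem a) i w)⟩

/-- Word expressions. -/
inductive WordExpr where
  | const (c : ℕ)
  | reg (x : ℕ)
  | load (a : ℕ) (e : WordExpr)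
  | add (e₁ e₂ : WordExpr)
  | sub (e₁ e₂ : WordExpr)

namespace WordExpr

/-- The value of an expression (`load a e` is the cell with index `e` of the array `a`). -/
def eval (s : State) : WordExpr → ℕ
  | const c => c
  | reg x => s.reg x
  | load a e => s.mem a (e.eval s)
  | add e₁ e₂ => e₁.eval s + e₂.eval s
  | sub e₁ e₂ => e₁.eval s - e₂.eval s

/-- The number of steps that the evaluation takes. -/
def cost : WordExpr → ℕ
  | const _ => 1
  | reg _ => 1
  | load _ e => e.cost + 1
  | add e₁ e₂ => e₁.cost + e₂.cost + 1
  | sub e₁ e₂ => e₁.cost + e₂.cost + 1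

/-- All the words that occur in the evaluation are smaller than `B`. -/
def Fits (B : ℕ) (s : State) : WordExpr → Prop
  | const c => c < B
  | reg x => s.reg x < B
  | load a e => e.Fits B s ∧ s.mem a (e.eval s) < B
  | add e₁ e₂ => e₁.Fits B s ∧ e₂.Fits B s ∧ e₁.eval s + e₂.eval s < B
  | sub e₁ e₂ => e₁.Fits B s ∧ e₂.Fits B s

end WordExpr

/-- Programs. The tests of `ite` and `loop` are comparisons `e₁ < e₂`. -/
inductive Prog where
  | skip
  | assign (x : ℕ) (e : WordExpr)
  | store (a : ℕ) (i e : WordExpr)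
  | seq (p₁ p₂ : Prog)
  | ite (e₁ e₂ : WordExpr) (p₁ p₂ : Prog)
  | loop (e₁ e₂ : WordExpr) (p : Prog)

/-- `Run B p s t s'`: on a machine with words smaller than `B`, the program `p`, started in the
state `s`, halts after exactly `t` steps in the state `s'`. A program in which a word
overflows has no run. -/
inductive Run (B : ℕ) : Prog → State → ℕ → State → Prop where
  | skip (s : State) : Run B .skip s 1 s
  | assign (s : State) (x : ℕ) (e : WordExpr) (h : e.Fits B s) :
      Run B (.assign x e) s (e.cost + 1) (s.setReg x (e.eval s))
  | store (s : State) (a : ℕ) (i e : WordExpr) (hi : i.Fits B s) (he : e.Fits B s) :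
      Run B (.store a i e) s (i.cost + e.cost + 1) (s.setMem a (i.eval s) (e.eval s))
  | seq {p₁ p₂ : Prog} {s s₁ s₂ : State} {t₁ t₂ : ℕ} (h₁ : Run B p₁ s t₁ s₁)
      (h₂ : Run B p₂ s₁ t₂ s₂) : Run B (.seq p₁ p₂) s (t₁ + t₂) s₂
  | ite_true {e₁ e₂ : WordExpr} {p₁ p₂ : Prog} {s s' : State} {t : ℕ} (h₁ : e₁.Fits B s)
      (h₂ : e₂.Fits B s) (hlt : e₁.eval s < e₂.eval s) (h : Run B p₁ s t s') :
      Run B (.ite e₁ e₂ p₁ p₂) s (e₁.cost + e₂.cost + 1 + t) s'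
  | ite_false {e₁ e₂ : WordExpr} {p₁ p₂ : Prog} {s s' : State} {t : ℕ} (h₁ : e₁.Fits B s)
      (h₂ : e₂.Fits B s) (hge : e₂.eval s ≤ e₁.eval s) (h : Run B p₂ s t s') :
      Run B (.ite e₁ e₂ p₁ p₂) s (e₁.cost + e₂.cost + 1 + t) s'
  | loop_true {e₁ e₂ : WordExpr} {p : Prog} {s s₁ s₂ : State} {t₁ t₂ : ℕ} (h₁ : e₁.Fits B s)
      (h₂ : e₂.Fits B s) (hlt : e₁.eval s < e₂.eval s) (hp : Run B p s t₁ s₁)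
      (h : Run B (.loop e₁ e₂ p) s₁ t₂ s₂) :
      Run B (.loop e₁ e₂ p) s (e₁.cost + e₂.cost + 1 + t₁ + t₂) s₂
  | loop_false {e₁ e₂ : WordExpr} {p : Prog} {s : State} (h₁ : e₁.Fits B s)
      (h₂ : e₂.Fits B s) (hge : e₂.eval s ≤ e₁.eval s) :
      Run B (.loop e₁ e₂ p) s (e₁.cost + e₂.cost + 1) s

/-- The initial state whose registers hold the words of `regs` and whose arrays are those of
`arrays`; everything else is zero. -/
def initial (regs : List ℕ) (arrays : List (ℕ → ℕ)) : State where
  reg x := regs.getD x 0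
  mem a := arrays.getD a 0

/-- Two `m`-digit numbers in base `q` can be multiplied in `M m` steps, for every `m`: some program
on words of `O(log (q + m))` bits takes the digits (least significant first) of the factors in the
arrays `0` and `1`, and halts with the digits of the product in array `2`. -/
def IsMulCost (q : ℕ) (M : ℕ → ℕ) : Prop :=
  ∃ (p : Prog) (c : ℕ), ∀ m a b : ℕ, a < q ^ m → b < q ^ m →
    ∃ t s, Run ((q + m) ^ c) p (initial [q, m] [digit q a, digit q b]) t s ∧
      t ≤ M m ∧ s.mem 2 = digit q (a * b)

section Tasks

variable {F : Type*} [Field F] [DecidableEq F] [Fintype F]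

/-- A matrix over `F` stored row by row in an array; `α_i` is stored as the word `i`. -/
def matrixArray (α : Fin (Fintype.card F) ≃ F) {k n : ℕ} (X : Matrix (Fin k) (Fin n) F) : ℕ → ℕ :=
  fun x => if h : x / n < k ∧ x % n < n then α.symm (X ⟨x / n, h.1⟩ ⟨x % n, h.2⟩) else 0

/-- The words in the registers at the beginning: `q`, `n`, `k` and the words that stand for the
elements `0` and `1` of `F`. -/
def params (α : Fin (Fintype.card F) ≃ F) (n k : ℕ) : List ℕ :=
  [Fintype.card F, n, k, α.symm 0, α.symm 1]

/-- On words smaller than `B`, the program `p` finds `𝓔_{n,k;q}(m)` in at most `T` steps: array `0`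
holds the base-`q` digits of `m`, and the matrix is returned in array `1`. -/
def EncodesWithin (α : Fin (Fintype.card F) ≃ F) (p : Prog) (B n k m T : ℕ) : Prop :=
  ∃ t s, Run B p (initial (params α n k) [digit (Fintype.card F) m]) t s ∧ t ≤ T ∧
    ∀ (r : Fin k) (c : Fin n), s.mem 1 (r * n + c) = α.symm (encode α n k m r c)

/-- On words smaller than `B`, the program `p` finds `𝓓_{n,k;q}(X)` in at most `T` steps: array `0`
holds the matrix `X`, and the base-`q` digits of the result are returned in array `1`. -/
def DecodesWithin (α : Fin (Fintype.card F) ≃ F) (p : Prog) (B : ℕ) {n k : ℕ}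
    (X : Matrix (Fin k) (Fin n) F) (T : ℕ) : Prop :=
  ∃ t s, Run B p (initial (params α n k) [matrixArray α X]) t s ∧ t ≤ T ∧
    s.mem 1 = digit (Fintype.card F) (decode α X)

end Tasks

end GrassGray

namespace GrassGray

/-! ### A program logic -/

section Machine

/-! Both programs take at most 4000·nk·n word operations and contain no long multiplication. That
suffices because every multiplication cost satisfies `m ≤ M m` for `m ≠ 0` (`IsMulCost.le`): the
product of 1 + q + ⋯ + q^(m-1) and 1 has m non-zero digits, all of which must be written, and a run
of t steps changes at most t cells of an array (`Run.ncard_changed_le`).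

Hence each of the n columns may cost O(nk), which is the length of the numbers involved, since the
Gaussian coefficients that occur are below q^(nk+1). Powers of q are shifts. The coefficients are
updated rather than recomputed: neighbours in Pascal's triangle satisfy g (q^a - 1) = h (q^b - 1)
for suitable a and b (`gaussRec_mul_pow_sub_one`, `gaussRec_succ_right`). Multiplication by q^a - 1
is one shifted subtraction, W = g q^a - g. The exact division by q^b - 1 is another one: h solves h
= h q^b - W modulo q^L, and for b > 0 the digit i of h q^b is the digit i - b of h, which is already
known when the digits are produced from the lowest one on. The solution is unique because q^b - 1 is
invertible modulo q^L (`eq_of_sub_eqs`, `mulDivProg_spec`).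

Decoding inverts encoding by induction on the number of columns (`decode_encode`). In the row case
the smaller matrix and the new row are combined into T = q^(n-k) D + S, and the shift by one in the
definitions is a rotation of the range of T, where only T = 0 wraps around, to the largest number
(`decode_of_row`).

Canonical form enters only through two properties of τ (`tau_isLead_trailInj`): the leading
coefficients move to the right, and the last non-zero coefficients of different rows are in
different columns. By the second one each column is responsible for at most one row. The decoding
program adds the columns from left to right, although the matrices it meets are obtained from X by
deletions from the right; `Halts.loop_backward` handles this.

The encoding program unrolls the recursion from right to left and records which columns remove a
row, with the digits of that row (`IsTrace`). It then builds the rows from left to right and finally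
puts them into the order of their leading columns. -/

@[simp] theorem State.setReg_reg (s : State) (x w y : ℕ) :
    (s.setReg x w).reg y = if y = x then w else s.reg y := by
  simp [State.setReg, Function.update_apply]

@[simp] theorem State.setReg_mem (s : State) (x w : ℕ) : (s.setReg x w).mem = s.mem := rfl

@[simp] theorem State.setMem_reg (s : State) (a i w : ℕ) : (s.setMem a i w).reg = s.reg := rfl

theorem State.setMem_mem (s : State) (a i w b : ℕ) :
    (s.setMem a i w).mem b = if b = a then Function.update (s.mem a) i w else s.mem b := by
  simp [State.setMem, Function.update_apply]

@[simp] theorem State.setMem_mem_ne (s : State) {a i w b : ℕ} (h : b ≠ a) :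
    (s.setMem a i w).mem b = s.mem b := by
  simp [State.setMem_mem, h]

@[simp] theorem State.setMem_mem_self (s : State) (a i w j : ℕ) :
    (s.setMem a i w).mem a j = if j = i then w else s.mem a j := by
  simp [State.setMem_mem, Function.update_apply]

/-- From the state `s`, reached after `t` steps, the program `p` halts, and the total number of
steps and the final state satisfy `Q`. -/
def Halts (B : ℕ) (p : Prog) (t : ℕ) (s : State) (Q : ℕ → State → Prop) : Prop :=
  ∃ t' s', Run B p s t' s' ∧ Q (t + t') s'

variable {B t : ℕ} {s : State} {Q : ℕ → State → Prop}

theorem Halts.mono {p : Prog} {Q' : ℕ → State → Prop} (h : Halts B p t s Q')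
    (hQ : ∀ t' s', Q' t' s' → Q t' s') : Halts B p t s Q := by
  obtain ⟨t', s', h, h'⟩ := h
  exact ⟨t', s', h, hQ _ _ h'⟩

theorem Halts.skip (h : Q (t + 1) s) : Halts B .skip t s Q := ⟨1, s, .skip s, h⟩

theorem Halts.assign {x : ℕ} {e : WordExpr} (hf : e.Fits B s)
    (h : Q (t + (e.cost + 1)) (s.setReg x (e.eval s))) : Halts B (.assign x e) t s Q :=
  ⟨_, _, .assign s x e hf, h⟩

theorem Halts.store {a : ℕ} {i e : WordExpr} (hi : i.Fits B s) (he : e.Fits B s)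
    (h : Q (t + (i.cost + e.cost + 1)) (s.setMem a (i.eval s) (e.eval s))) :
    Halts B (.store a i e) t s Q :=
  ⟨_, _, .store s a i e hi he, h⟩

theorem Halts.seq {p₁ p₂ : Prog} (h : Halts B p₁ t s fun t' s' => Halts B p₂ t' s' Q) :
    Halts B (.seq p₁ p₂) t s Q := by
  obtain ⟨t₁, s₁, h₁, t₂, s₂, h₂, h₃⟩ := h
  exact ⟨t₁ + t₂, s₂, .seq h₁ h₂, by rwa [← add_assoc]⟩

theorem Halts.ite {e₁ e₂ : WordExpr} {p₁ p₂ : Prog} (h₁ : e₁.Fits B s) (h₂ : e₂.Fits B s)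
    (ht : e₁.eval s < e₂.eval s → Halts B p₁ (t + (e₁.cost + e₂.cost + 1)) s Q)
    (hf : e₂.eval s ≤ e₁.eval s → Halts B p₂ (t + (e₁.cost + e₂.cost + 1)) s Q) :
    Halts B (.ite e₁ e₂ p₁ p₂) t s Q := by
  rcases lt_or_ge (e₁.eval s) (e₂.eval s) with h | h
  · obtain ⟨t', s', hr, hq⟩ := ht h
    exact ⟨_, s', .ite_true h₁ h₂ h hr, by rwa [← add_assoc]⟩
  · obtain ⟨t', s', hr, hq⟩ := hf h
    exact ⟨_, s', .ite_false h₁ h₂ h hr, by rwa [← add_assoc]⟩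

/-- A loop with `m` iterations, each of which takes at most `T` steps. The invariant `I i y` depends
on data `y` that are determined backwards, from the end of the loop. -/
theorem Halts.loop_backward {β : ℕ → Type*} {e₁ e₂ : WordExpr} {p : Prog} (P : ∀ i, β i → Prop)
    (I : ∀ i, β i → State → Prop) (m T : ℕ) (y : β m) (hy : P m y) (h0 : ∀ y, P 0 y → I 0 y s)
    (hstep : ∀ i < m, ∀ y, P (i + 1) y → ∃ y', P i y' ∧ ∀ s, I i y' s →
      e₁.Fits B s ∧ e₂.Fits B s ∧ e₁.eval s < e₂.eval s ∧
      ∀ t, Halts B p t s fun t' s' => t' ≤ t + T ∧ I (i + 1) y s')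
    (hend : ∀ s, I m y s → e₁.Fits B s ∧ e₂.Fits B s ∧ e₂.eval s ≤ e₁.eval s)
    (hQ : ∀ t' s', t' ≤ t + (m * (T + (e₁.cost + e₂.cost + 1)) + (e₁.cost + e₂.cost + 1)) →
      I m y s' → Q t' s') :
    Halts B (.loop e₁ e₂ p) t s Q := by
  -- The run of a loop is built from its end, whereas the iterations are executed from the front. So
  -- the induction carries a continuation: any run of the loop from the state after `i` iterations
  -- extends to one from `s`.
  suffices h : ∀ i ≤ m, ∀ y, P i y → ∃ t' s', t' ≤ i * (T + (e₁.cost + e₂.cost + 1)) ∧ I i y s' ∧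
      ∀ t₂ s₂, Run B (.loop e₁ e₂ p) s' t₂ s₂ → Run B (.loop e₁ e₂ p) s (t' + t₂) s₂ by
    obtain ⟨t', s', ht, hI, hr⟩ := h m le_rfl y hy
    obtain ⟨h₁, h₂, h₃⟩ := hend s' hI
    exact ⟨_, s', hr _ _ (.loop_false h₁ h₂ h₃), hQ _ _ (by omega) hI⟩
  intro i
  induction i with
  | zero => exact fun _ y hy => ⟨0, s, by simp, h0 y hy, fun t₂ s₂ h => by simpa using h⟩
  | succ i ih =>
    intro hi y hy
    obtain ⟨y', hy', hs⟩ := hstep i hi y hy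
    obtain ⟨t', s', ht, hI, hr⟩ := ih (by omega) y' hy'
    obtain ⟨h₁, h₂, h₃, h₄⟩ := hs s' hI
    obtain ⟨t₁, s₁, hr₁, ht₁, hI₁⟩ := h₄ 0
    refine ⟨t' + (e₁.cost + e₂.cost + 1 + t₁), s₁, ?_, hI₁, fun t₂ s₂ h => ?_⟩
    · rw [Nat.succ_mul]
      omega
    · rw [add_assoc]
      exact hr _ _ (.loop_true h₁ h₂ h₃ hr₁ h)

/-- A loop with `m` iterations, each of which takes at most `T` steps. -/
theorem Halts.loop {e₁ e₂ : WordExpr} {p : Prog} (I : ℕ → State → Prop) (m T : ℕ) (h0 : I 0 s)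
    (hstep : ∀ i < m, ∀ s, I i s → e₁.Fits B s ∧ e₂.Fits B s ∧ e₁.eval s < e₂.eval s ∧
      ∀ t, Halts B p t s fun t' s' => t' ≤ t + T ∧ I (i + 1) s')
    (hend : ∀ s, I m s → e₁.Fits B s ∧ e₂.Fits B s ∧ e₂.eval s ≤ e₁.eval s)
    (hQ : ∀ t' s', t' ≤ t + (m * (T + (e₁.cost + e₂.cost + 1)) + (e₁.cost + e₂.cost + 1)) →
      I m s' → Q t' s') :
    Halts B (.loop e₁ e₂ p) t s Q :=
  Halts.loop_backward (β := fun _ => Unit) (fun _ _ => True) (fun i _ => I i) m T () trivial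
    (fun _ _ => h0) (fun i hi _ _ => ⟨(), trivial, hstep i hi⟩) hend hQ

/-- A run of `t` steps changes at most `t` cells of an array. -/
theorem Run.ncard_changed_le {p : Prog} {s s' : State} {t : ℕ} (h : Run B p s t s') (a : ℕ) :
    {i | s'.mem a i ≠ s.mem a i}.Finite ∧ {i | s'.mem a i ≠ s.mem a i}.ncard ≤ t := by
  have trans : ∀ {s₁ s₂ s₃ : State} {t₁ t₂ : ℕ},
      ({i | s₂.mem a i ≠ s₁.mem a i}.Finite ∧ {i | s₂.mem a i ≠ s₁.mem a i}.ncard ≤ t₁) →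
      ({i | s₃.mem a i ≠ s₂.mem a i}.Finite ∧ {i | s₃.mem a i ≠ s₂.mem a i}.ncard ≤ t₂) →
      {i | s₃.mem a i ≠ s₁.mem a i}.Finite ∧ {i | s₃.mem a i ≠ s₁.mem a i}.ncard ≤ t₁ + t₂ := by
    intro s₁ s₂ s₃ t₁ t₂ h₁ h₂
    -- A cell that differs after both runs was changed by at least one of them.
    have hsub : {i | s₃.mem a i ≠ s₁.mem a i} ⊆
        {i | s₂.mem a i ≠ s₁.mem a i} ∪ {i | s₃.mem a i ≠ s₂.mem a i} := by
      intro i hi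
      by_contra hc
      simp only [Set.mem_union, Set.mem_ofPred_eq, not_or, not_not] at hc hi
      exact hi (hc.2.trans hc.1)
    have hfin := h₁.1.union h₂.1
    refine ⟨hfin.subset hsub, (Set.ncard_le_ncard hsub hfin).trans ?_⟩
    exact (Set.ncard_union_le _ _).trans (by omega)
  induction h with
  | skip s => simp
  | assign s x e h => simp
  | store s b i e hi he =>
    have hsub : {j | (s.setMem b (i.eval s) (e.eval s)).mem a j ≠ s.mem a j} ⊆ {i.eval s} := by
      intro j hj
      by_contra hc
      apply hj
      by_cases hab : a = b
      · subst hab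
        simp only [Set.mem_singleton_iff] at hc
        simp [hc]
      · simp [hab]
    refine ⟨(Set.finite_singleton _).subset hsub, ?_⟩
    refine (Set.ncard_le_ncard hsub (Set.finite_singleton _)).trans ?_
    simp
  | seq _ _ ih₁ ih₂ => exact trans ih₁ ih₂
  | ite_true _ _ _ _ ih => exact ⟨ih.1, ih.2.trans (by omega)⟩
  | ite_false _ _ _ _ ih => exact ⟨ih.1, ih.2.trans (by omega)⟩
  | loop_true _ _ _ _ _ ih₁ ih₂ =>
    have := trans ih₁ ih₂
    exact ⟨this.1, this.2.trans (by omega)⟩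
  | loop_false => simp

end Machine

/-! ### Digits -/

theorem digit_lt {q : ℕ} (hq : 0 < q) (x l : ℕ) : digit q x l < q := Nat.mod_lt _ hq

theorem digit_eq_zero {q x l L : ℕ} (hx : x < q ^ L) (hl : L ≤ l) : digit q x l = 0 := by
  rcases Nat.eq_zero_or_pos q with rfl | hq
  · rcases Nat.eq_zero_or_pos L with rfl | hL
    · have : x = 0 := by simpa using hx
      simp [digit, this]
    · simp [zero_pow hL.ne'] at hx
  · have : x / q ^ l = 0 := Nat.div_eq_of_lt (hx.trans_le (Nat.pow_le_pow_right hq hl))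
    simp [digit, this]

@[simp] theorem digit_zero (q l : ℕ) : digit q 0 l = 0 := by simp [digit]

theorem sum_digit (q x L : ℕ) :
    ∑ t ∈ Finset.range L, digit q x t * q ^ t = x % q ^ L := by
  induction L with
  | zero => simp [Nat.mod_one]
  | succ L ih => rw [Finset.sum_range_succ, ih, Nat.mod_pow_succ, digit, mul_comm (q ^ L)]

theorem sum_mul_pow_lt {q : ℕ} (f : ℕ → ℕ) (L : ℕ) (hf : ∀ t < L, f t < q) :
    ∑ t ∈ Finset.range L, f t * q ^ t < q ^ L := by
  induction L with
  | zero => simp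
  | succ L ih =>
    rw [Finset.sum_range_succ]
    have h1 := ih fun t ht => hf t (by omega)
    have h2 := Nat.mul_le_mul_right (q ^ L) (hf L (by omega))
    rw [Nat.succ_mul] at h2
    rw [pow_succ, mul_comm (q ^ L)]
    omega

theorem digit_sum {q : ℕ} (f : ℕ → ℕ) (L : ℕ) (hf : ∀ t < L, f t < q) (l : ℕ) (hl : l < L) :
    digit q (∑ t ∈ Finset.range L, f t * q ^ t) l = f l := by
  induction L with
  | zero => omega
  | succ L ih =>
    have hq : 0 < q := (Nat.zero_le _).trans_lt (hf 0 (by omega))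
    have hlt := sum_mul_pow_lt f L fun t ht => hf t (by omega)
    rw [Finset.sum_range_succ, digit]
    rcases Nat.lt_succ_iff_lt_or_eq.1 hl with h | rfl
    · rw [← ih (fun t ht => hf t (by omega)) h, digit]
      obtain ⟨d, rfl⟩ := Nat.exists_eq_add_of_lt h
      have : f (l + d + 1) * q ^ (l + d + 1) = q ^ l * (q * (f (l + d + 1) * q ^ d)) := by ring
      rw [this, Nat.add_mul_div_left _ _ (by positivity), Nat.add_mul_mod_self_left]
    · rw [Nat.add_mul_div_right _ _ (by positivity), Nat.div_eq_of_lt hlt, zero_add,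
        Nat.mod_eq_of_lt (hf l (by omega))]

/-- Numbers are compared with whole arrays, so the cells beyond the last digit have to be known to
vanish. -/
theorem eq_digit_sum {q : ℕ} (f : ℕ → ℕ) (L : ℕ) (hf : ∀ t < L, f t < q)
    (h0 : ∀ t, L ≤ t → f t = 0) :
    f = digit q (∑ t ∈ Finset.range L, f t * q ^ t) := by
  funext l
  rcases lt_or_ge l L with h | h
  · exact (digit_sum f L hf l h).symm
  · rw [h0 l h, digit_eq_zero (sum_mul_pow_lt f L hf) h]

theorem digit_mul_pow {q : ℕ} (hq : 0 < q) (x a t : ℕ) :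
    digit q (x * q ^ a) t = if t < a then 0 else digit q x (t - a) := by
  split_ifs with h
  · obtain ⟨d, rfl⟩ := Nat.exists_eq_add_of_lt h
    have : x * q ^ (t + d + 1) = q ^ t * (q * (x * q ^ d)) := by ring
    rw [digit, this, Nat.mul_div_cancel_left _ (by positivity), Nat.mul_mod_right]
  · obtain ⟨d, rfl⟩ := Nat.exists_eq_add_of_le (not_lt.1 h)
    rw [digit, digit, pow_add, mul_comm x, Nat.mul_div_mul_left _ _ (by positivity),
      Nat.add_sub_cancel_left]

theorem digit_div_pow (q x a t : ℕ) : digit q (x / q ^ a) t = digit q x (a + t) := by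
  rw [digit, digit, Nat.div_div_eq_div_mul, pow_add]

theorem digit_mod_pow {q x a t : ℕ} (h : t < a) : digit q (x % q ^ a) t = digit q x t := by
  obtain ⟨d, rfl⟩ := Nat.exists_eq_add_of_lt h
  rw [digit, digit, add_assoc, pow_add, Nat.mod_mul_right_div_self, pow_succ',
    Nat.mod_mul_right_mod]

end GrassGray

namespace GrassGray

/-! ### Subroutines

The registers below `20` belong to the calling program. -/

section Subroutines

open WordExpr

/-- With `a = reg 24` and the borrow `reg 21`, the number in the array `z` becomes
`x * q ^ a - y - borrow`, where `x` and `y` are the arrays of the minuend and the subtrahend. There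
are `reg 5` digits, and the final borrow is left in `reg 21`. -/
def subProg (z x y : ℕ) : Prog :=
  .seq (.assign 20 (const 0)) <|
  .loop (reg 20) (reg 5) <|
  .seq (.ite (reg 20) (reg 24) (.assign 22 (const 0))
    (.assign 22 (load x (sub (reg 20) (reg 24))))) <|
  .seq (.assign 23 (add (load y (reg 20)) (reg 21))) <|
  .seq (.ite (reg 22) (reg 23)
    (.seq (.store z (reg 20) (sub (add (reg 22) (reg 0)) (reg 23))) (.assign 21 (const 1)))
    (.seq (.store z (reg 20) (sub (reg 22) (reg 23))) (.assign 21 (const 0)))) <|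
  .assign 20 (add (reg 20) (const 1))

/-- The digits of `x * q ^ a`, if the array `f` holds those of `x`. -/
def shiftDigits (a : ℕ) (f : ℕ → ℕ) (t : ℕ) : ℕ := if t < a then 0 else f (t - a)

/-- This is schoolbook subtraction. The array `z` may coincide with the minuend `x` if `0 < a`: the
cell `i - a` that is read in round `i` then already contains a digit of the result. For this reason
the equation refers to the final contents of `x`, and in that case it is an implicit equation for
the result. -/
theorem subProg_digits {B q L a b₀ t : ℕ} {s : State} {z x y : ℕ} (hq : s.reg 0 = q)
    (hL : s.reg 5 = L) (ha : s.reg 24 = a) (hb : s.reg 21 = b₀) (hb1 : b₀ ≤ 1) (hq2 : 2 ≤ q)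
    (hqB : 2 * q < B) (hLB : L < B) (haB : a < B) (hzy : z ≠ y) (hzx : z ≠ x ∨ 0 < a)
    (hx : ∀ i, s.mem x i < q) (hy : ∀ i, s.mem y i < q) :
    Halts B (subProg z x y) t s fun t' s' =>
      t' ≤ t + (40 * L + 10) ∧ (∀ r < 20, s'.reg r = s.reg r) ∧
      (∀ b, b ≠ z → s'.mem b = s.mem b) ∧ (∀ i < L, s'.mem z i < q) ∧
      (∀ i, L ≤ i → s'.mem z i = s.mem z i) ∧ s'.reg 21 ≤ 1 ∧
      ∑ i ∈ Finset.range L, s'.mem z i * q ^ i + ∑ i ∈ Finset.range L, s.mem y i * q ^ i + b₀ =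
        ∑ i ∈ Finset.range L, shiftDigits a (s'.mem x) i * q ^ i + q ^ L * s'.reg 21 := by
  refine Halts.seq (Halts.assign (by simp only [Fits]; omega) ?_)
  -- The last clause is the equation for the lowest `i` digits, with the current borrow at weight `q
  -- ^ i`.
  refine Halts.loop (fun i s' => s'.reg 20 = i ∧ s'.reg 24 = a ∧ (∀ r < 20, s'.reg r = s.reg r) ∧
      (∀ b, b ≠ z → s'.mem b = s.mem b) ∧ (∀ j < i, s'.mem z j < q) ∧
      (∀ j, i ≤ j → s'.mem z j = s.mem z j) ∧ s'.reg 21 ≤ 1 ∧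
      ∑ j ∈ Finset.range i, s'.mem z j * q ^ j + ∑ j ∈ Finset.range i, s.mem y j * q ^ j + b₀ =
        ∑ j ∈ Finset.range i, shiftDigits a (s'.mem x) j * q ^ j + q ^ i * s'.reg 21)
    L 29 ?_ ?_ ?_ ?_
  · refine ⟨by simp [eval], by simp [ha], ?_, by simp, by simp, by simp, by simp [hb, hb1], ?_⟩
    · intro r hr
      simp [show r ≠ 20 by omega]
    · simp [hb]
  · rintro i hi s₁ ⟨h20, h24, hreg, hmem, hlt, hge, hbor, hsum⟩
    have h0 : s₁.reg 0 = q := by rw [hreg 0 (by simp), hq]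
    have h5 : s₁.reg 5 = L := by rw [hreg 5 (by simp), hL]
    refine ⟨by simp only [Fits]; omega, by simp only [Fits]; omega, by simp only [eval]; omega, ?_⟩
    intro t₁
    have hxq : ∀ j < i, s₁.mem x j < q := by
      intro j hj
      by_cases hxz : x = z
      · rw [hxz]; exact hlt j hj
      · rw [hmem x hxz]; exact hx j
    have hxlt : ¬ i < a → s₁.mem x (i - a) < q := by
      intro hia
      by_cases hxz : x = z
      · have : 0 < a := by tauto
        exact hxq _ (by omega)
      · rw [hmem x hxz]; exact hx _
    have hyi : s₁.mem y i < q := by rw [hmem y hzy.symm]; exact hy i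
    refine Halts.seq ?_
    have key : Halts B (.ite (reg 20) (reg 24) (.assign 22 (const 0))
        (.assign 22 (load x (sub (reg 20) (reg 24))))) t₁ s₁ fun t' s' =>
        t' ≤ t₁ + 8 ∧ s' = s₁.setReg 22 (shiftDigits a (s₁.mem x) i) := by
      refine Halts.ite (by simp only [Fits]; omega) (by simp only [Fits]; omega) ?_ ?_
      · intro h
        simp only [eval, h20, h24] at h
        refine Halts.assign (by simp only [Fits]; omega) ⟨by simp [cost], ?_⟩
        simp [eval, shiftDigits, h]
      · intro h
        simp only [eval, h20, h24] at h
        refine Halts.assign ?_ ⟨by simp [cost], ?_⟩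
        · have := hxlt (by omega)
          simp only [Fits, eval, h20, h24]
          omega
        · simp [eval, shiftDigits, h20, h24, not_lt.2 h]
    refine key.mono ?_
    rintro t₂ _ ⟨ht₂, rfl⟩
    set u := shiftDigits a (s₁.mem x) i with hu
    have huq : u < q := by
      rw [hu, shiftDigits]
      split_ifs with h
      · omega
      · exact hxlt h
    refine Halts.seq (Halts.assign ?_ ?_)
    · simp [Fits, eval, h20]
      omega
    -- Both branches of the test lead to a digit `d` and a borrow `b'` with d + y_i + borrow = u + q
    -- b'; this extends the invariant by one digit.
    have main : ∀ d b', b' ≤ 1 → d < q → d + s₁.mem y i + s₁.reg 21 = u + q * b' → ∀ s' : State,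
        s' = ((((s₁.setReg 22 u).setReg 23 (s₁.mem y i + s₁.reg 21)).setMem z i d).setReg 21
          b').setReg 20 (i + 1) →
        s'.reg 20 = i + 1 ∧ s'.reg 24 = a ∧ (∀ r < 20, s'.reg r = s.reg r) ∧
        (∀ b, b ≠ z → s'.mem b = s.mem b) ∧ (∀ j < i + 1, s'.mem z j < q) ∧
        (∀ j, i + 1 ≤ j → s'.mem z j = s.mem z j) ∧ s'.reg 21 ≤ 1 ∧
        ∑ j ∈ Finset.range (i + 1), s'.mem z j * q ^ j +
          ∑ j ∈ Finset.range (i + 1), s.mem y j * q ^ j + b₀ =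
        ∑ j ∈ Finset.range (i + 1), shiftDigits a (s'.mem x) j * q ^ j +
          q ^ (i + 1) * s'.reg 21 := by
      rintro d b' hb' hd heq s' rfl
      refine ⟨by simp, by simp [h24], ?_, ?_, ?_, ?_, by simp [hb'], ?_⟩
      · intro r hr
        simp [show r ≠ 20 by omega, show r ≠ 21 by omega, show r ≠ 22 by omega,
          show r ≠ 23 by omega, hreg r hr]
      · intro b hbz
        simp [hbz, hmem b hbz]
      · intro j hj
        simp only [State.setReg_mem, State.setMem_mem_self]
        split_ifs
        · exact hd
        · exact hlt j (by omega)
      · intro j hj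
        simp [show j ≠ i by omega, hge j (by omega)]
      -- The store at `i` does not disturb the shifted digits up to `i`: either `z` is not `x`, or
      -- they come from the cells `j - a < i`.
      · have e1 : ∀ j ≤ i, shiftDigits a ((((s₁.setReg 22 u).setReg 23
            (s₁.mem y i + s₁.reg 21)).setMem z i d).mem x) j = shiftDigits a (s₁.mem x) j := by
          intro j hj
          simp only [shiftDigits]
          split_ifs with hja
          · rfl
          · by_cases hxz : x = z
            · have : 0 < a := by tauto
              rw [hxz, State.setMem_mem_self, if_neg (by omega)]
              rfl
            · rw [State.setMem_mem_ne _ hxz]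
              rfl
        have e2 : ∀ j ∈ Finset.range i, (if j = i then d else s₁.mem z j) * q ^ j =
            s₁.mem z j * q ^ j := fun j hj => by
          rw [if_neg (Finset.mem_range.1 hj).ne]
        have e3 : ∀ j ∈ Finset.range i, shiftDigits a ((((s₁.setReg 22 u).setReg 23
            (s₁.mem y i + s₁.reg 21)).setMem z i d).mem x) j * q ^ j =
              shiftDigits a (s₁.mem x) j * q ^ j := fun j hj => by
          rw [e1 j (Finset.mem_range.1 hj).le]
        simp only [State.setReg_mem, State.setMem_mem_self, State.setReg_reg, if_true,
          show (21 : ℕ) ≠ 20 by decide, if_false]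
        rw [Finset.sum_range_succ, Finset.sum_range_succ, Finset.sum_range_succ, e1 i le_rfl,
          Finset.sum_congr rfl e2, if_pos rfl, Finset.sum_congr rfl e3, ← hu]
        rw [← hmem y hzy.symm] at hsum ⊢
        have h3 : (d + s₁.mem y i + s₁.reg 21) * q ^ i = (u + q * b') * q ^ i := by rw [heq]
        rw [pow_succ]
        linarith
    refine Halts.seq (Halts.ite ?_ ?_ ?_ ?_)
    · simp [Fits]; omega
    · simp [Fits, eval, h20]; omega
    · intro h
      simp [eval, h20] at h
      refine Halts.seq (Halts.store ?_ ?_ (Halts.assign ?_ (Halts.assign ?_ ⟨?_, ?_⟩)))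
      · simp [Fits, h20]; omega
      · simp [Fits, eval, h20, h0]; omega
      · simp [Fits]; omega
      · simp [Fits, eval, h20]; omega
      · simp only [cost]; omega
      · refine main (u + q - (s₁.mem y i + s₁.reg 21)) 1 le_rfl (by omega) (by omega) _ ?_
        simp [eval, h20, h0]
    · intro h
      simp [eval, h20] at h
      refine Halts.seq (Halts.store ?_ ?_ (Halts.assign ?_ (Halts.assign ?_ ⟨?_, ?_⟩)))
      · simp [Fits, h20]; omega
      · simp [Fits, eval, h20]; omega
      · simp [Fits]; omega
      · simp [Fits, eval, h20]; omega
      · simp only [cost]; omega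
      · refine main (u - (s₁.mem y i + s₁.reg 21)) 0 (by omega) (by omega) (by omega) _ ?_
        simp [eval, h20]
  · rintro s₁ ⟨h20, h24, hreg, -⟩
    have h5 : s₁.reg 5 = L := by rw [hreg 5 (by simp), hL]
    exact ⟨by simp only [Fits]; omega, by simp only [Fits]; omega, by simp only [eval]; omega⟩
  · rintro t' s' ht' ⟨h20, h24, hreg, hmem, hlt, hge, hbor, hsum⟩
    refine ⟨?_, hreg, hmem, hlt, hge, hbor, hsum⟩
    simp only [cost] at ht'
    omega

/-- The array `a` holds the number `x`, in base `q`. -/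
def Holds (q L : ℕ) (s : State) (a x : ℕ) : Prop := x < q ^ L ∧ s.mem a = digit q x

/-- The final number `X'` in `x` is quantified inside the conclusion, because it is not known
beforehand when `x` is `z` itself. -/
theorem subProg_spec {B q L a b₀ X Y Z t : ℕ} {s : State} {z x y : ℕ} (hq : s.reg 0 = q)
    (hL : s.reg 5 = L) (ha : s.reg 24 = a) (hb : s.reg 21 = b₀) (hb1 : b₀ ≤ 1) (hq2 : 2 ≤ q)
    (hqB : 2 * q < B) (hLB : L < B) (haB : a < B) (hzy : z ≠ y) (hzx : z ≠ x ∨ 0 < a)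
    (hx : Holds q L s x X) (hy : Holds q L s y Y) (hz : Holds q L s z Z) :
    Halts B (subProg z x y) t s fun t' s' =>
      t' ≤ t + (40 * L + 10) ∧ (∀ r < 20, s'.reg r = s.reg r) ∧
      (∀ b, b ≠ z → s'.mem b = s.mem b) ∧ s'.reg 21 ≤ 1 ∧ ∃ Z', Holds q L s' z Z' ∧
      ∀ X', s'.mem x = digit q X' → Z' + Y + b₀ = X' * q ^ a % q ^ L + q ^ L * s'.reg 21 := by
  have hq0 : 0 < q := by omega
  refine (subProg_digits hq hL ha hb hb1 hq2 hqB hLB haB hzy hzx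
    (by simp [hx.2, digit_lt hq0]) (by simp [hy.2, digit_lt hq0])).mono ?_
  rintro t' s' ⟨ht, hreg, hmem, hlt, hge, hbor, hsum⟩
  refine ⟨ht, hreg, hmem, hbor, ∑ i ∈ Finset.range L, s'.mem z i * q ^ i,
    ⟨sum_mul_pow_lt _ _ hlt, eq_digit_sum _ _ hlt fun i hi => ?_⟩, fun X' hX' => ?_⟩
  · rw [hge i hi, hz.2, digit_eq_zero hz.1 hi]
  · rw [hy.2, sum_digit, Nat.mod_eq_of_lt hy.1] at hsum
    rw [hsum, hX', ← sum_digit]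
    simp only [digit_mul_pow hq0, shiftDigits]

/-- The number in the array `x` is multiplied by `q ^ a - 1` and divided by `q ^ b - 1`, where
`a = reg 14` and `b = reg 15`. The result goes to the array `z`, and the array `w` is overwritten. -/
def mulDivProg (z x w : ℕ) : Prog :=
  .seq (.assign 24 (reg 14)) <| .seq (.assign 21 (const 0)) <| .seq (subProg w x x) <|
  .seq (.assign 24 (reg 15)) <| .seq (.assign 21 (const 0)) <| subProg z z w

/-- Modulo q^L the two equations say W = g (q^a - 1) = h (q^b - 1) and W = Z (q^b - 1). Since q^b -
1 is a unit modulo q^L, Z and h are congruent, and both are below q^L. Overflow in W is therefore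
harmless. -/
theorem eq_of_sub_eqs {q L a b g h W Z c c' : ℕ} (hq : 2 ≤ q) (hb : 0 < b) (hh : h < q ^ L)
    (hZ : Z < q ^ L) (hgh : g * (q ^ a - 1) = h * (q ^ b - 1))
    (h1 : W + g = g * q ^ a % q ^ L + q ^ L * c) (h2 : Z + W = Z * q ^ b % q ^ L + q ^ L * c') :
    Z = h := by
  have hcop : IsCoprime ((q : ℤ) ^ L) ((q : ℤ) ^ b - 1) := by
    -- The Bézout relation is q^(b-1) · q - (q^b - 1) = 1, which needs b > 0.
    refine IsCoprime.pow_left ⟨(q : ℤ) ^ (b - 1), -1, ?_⟩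
    obtain ⟨b, rfl⟩ := Nat.exists_eq_succ_of_ne_zero hb.ne'
    simp only [Nat.succ_eq_add_one, Nat.add_sub_cancel]
    ring
  have e1 := Nat.mod_add_div (g * q ^ a) (q ^ L)
  have e2 := Nat.mod_add_div (Z * q ^ b) (q ^ L)
  have hqa : 1 ≤ q ^ a := Nat.one_le_pow _ _ (by omega)
  have hqb : 1 ≤ q ^ b := Nat.one_le_pow _ _ (by omega)
  zify [hqa, hqb] at *
  have hdvd : (q : ℤ) ^ L ∣ (q ^ b - 1) * ((Z : ℤ) - h) := by
    refine ⟨c - c' + (Z * q ^ b / q ^ L) - (g * q ^ a / q ^ L), ?_⟩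
    linear_combination h1 - e2 - h2 + e1 + hgh
  have hdvd := hcop.dvd_of_dvd_mul_left hdvd
  have := Int.eq_zero_of_abs_lt_dvd hdvd (by rw [abs_lt]; constructor <;> linarith)
  linarith

/-- The first subtraction gives W = g q^a - g. The second one uses `z` both as the minuend and as
the target, so that its result satisfies Z = Z q^b - W modulo q^L; this is division by q^b - 1 in
linear time. -/
theorem mulDivProg_spec {B q L a b g h Z W t : ℕ} {s : State} {z x w : ℕ} (hq : s.reg 0 = q)
    (hL : s.reg 5 = L) (ha : s.reg 14 = a) (hb : s.reg 15 = b) (hq2 : 2 ≤ q)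
    (hqB : 2 * q < B) (hLB : L < B) (haB : a < B) (hbB : b < B) (hb0 : 0 < b) (hxw : x ≠ w)
    (hzw : z ≠ w) (hx : Holds q L s x g) (hw : Holds q L s w W) (hz : Holds q L s z Z)
    (hgh : g * (q ^ a - 1) = h * (q ^ b - 1)) (hh : h < q ^ L) :
    Halts B (mulDivProg z x w) t s fun t' s' =>
      t' ≤ t + (80 * L + 30) ∧ (∀ r < 20, s'.reg r = s.reg r) ∧
      (∀ b, b ≠ z → b ≠ w → s'.mem b = s.mem b) ∧ (∃ W', Holds q L s' w W') ∧
      Holds q L s' z h := by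
  refine Halts.seq (Halts.assign (by simp only [Fits]; omega) ?_)
  refine Halts.seq (Halts.assign (by simp only [Fits]; omega) ?_)
  refine Halts.seq ((subProg_spec (b₀ := 0) (by simp [hq]) (by simp [hL]) (by simp [eval, ha])
    (by simp [eval]) (by omega) hq2 hqB hLB haB hxw.symm (.inl hxw.symm) (by exact hx) (by exact hx) (by exact hw)).mono ?_)
  rintro t₁ s₁ ⟨ht₁, hreg₁, hmem₁, -, W', hW', heq₁⟩
  replace heq₁ := heq₁ g ((hmem₁ x hxw).trans hx.2)
  refine Halts.seq (Halts.assign ?_ ?_)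
  · simp [Fits, hreg₁, hb, hbB]
  refine Halts.seq (Halts.assign (by simp only [Fits]; omega) ?_)
  have hz₁ : Holds q L s₁ z Z := ⟨hz.1, (hmem₁ z hzw).trans hz.2⟩
  apply Halts.mono
  · exact subProg_spec (b₀ := 0) (a := b) (by simp [hreg₁, hq]) (by simp [hreg₁, hL])
      (by simp [eval, hreg₁, hb]) (by simp [eval]) (by omega) hq2 hqB hLB hbB hzw (.inr hb0)
      hz₁ hW' hz₁
  rintro t₂ s₂ ⟨ht₂, hreg₂, hmem₂, -, Z', hZ', heq₂⟩
  replace heq₂ := heq₂ Z' hZ'.2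
  obtain rfl : Z' = h := eq_of_sub_eqs hq2 hb0 hh hZ'.1 hgh heq₁ heq₂
  refine ⟨?_, ?_, ?_, ⟨W', hW'.1, ?_⟩, hZ'⟩
  · simp only [cost] at *
    omega
  · intro r hr
    simp [hreg₂ r hr, hreg₁ r hr, show r ≠ 24 by omega, show r ≠ 21 by omega]
  · intro b hbz hbw
    simp [hmem₂ b hbz, hmem₁ b hbw]
  · simp [hmem₂ w hzw.symm, hW'.2]

/-- `reg 28` cells of the array `x`, beginning with the cell `reg 27`, are copied to the
array `z`, beginning with the cell `reg 26`. -/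
def copyProg (z x : ℕ) : Prog :=
  .seq (.assign 25 (const 0)) <|
  .loop (reg 25) (reg 28) <|
  .seq (.store z (add (reg 26) (reg 25)) (load x (add (reg 27) (reg 25)))) <|
  .assign 25 (add (reg 25) (const 1))

theorem copyProg_spec {B i j m t : ℕ} {s : State} {z x : ℕ} (hi : s.reg 26 = i)
    (hj : s.reg 27 = j) (hm : s.reg 28 = m) (hzx : z ≠ x) (hiB : i + m + 1 < B)
    (hjB : j + m + 1 < B) (hxB : ∀ c < m, s.mem x (j + c) < B) :
    Halts B (copyProg z x) t s fun t' s' =>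
      t' ≤ t + (20 * m + 10) ∧ (∀ r < 20, s'.reg r = s.reg r) ∧
      (∀ b, b ≠ z → s'.mem b = s.mem b) ∧
      ∀ c, s'.mem z c = if i ≤ c ∧ c < i + m then s.mem x (j + (c - i)) else s.mem z c := by
  refine Halts.seq (Halts.assign (by simp only [Fits]; omega) ?_)
  refine Halts.loop (fun l s' => s'.reg 25 = l ∧ s'.reg 26 = i ∧ s'.reg 27 = j ∧ s'.reg 28 = m ∧
      (∀ r < 20, s'.reg r = s.reg r) ∧ (∀ b, b ≠ z → s'.mem b = s.mem b) ∧
      ∀ c, s'.mem z c = if i ≤ c ∧ c < i + l then s.mem x (j + (c - i)) else s.mem z c)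
    m 12 ?_ ?_ ?_ ?_
  · refine ⟨by simp [eval], by simp [hi], by simp [hj], by simp [hm], ?_, by simp, ?_⟩
    · intro r hr
      simp [show r ≠ 25 by omega]
    · intro c
      rw [if_neg (by omega)]
      rfl
  · rintro l hl s₁ ⟨h25, h26, h27, h28, hreg, hmem, hz⟩
    refine ⟨by simp only [Fits]; omega, by simp only [Fits]; omega, by simp only [eval]; omega, ?_⟩
    intro t₁
    have hxl := hxB l hl
    refine Halts.seq (Halts.store ?_ ?_ (Halts.assign ?_ ⟨?_, ?_⟩))
    · simp only [Fits, h25, h26, eval]; omega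
    · simp only [Fits, h25, h27, eval, hmem x hzx.symm]; omega
    · simp only [Fits, State.setMem_reg, h25, eval]; omega
    · simp only [cost]; omega
    · refine ⟨by simp [eval, h25], by simp [h26], by simp [h27], by simp [h28], ?_, ?_, ?_⟩
      · intro r hr
        simp [show r ≠ 25 by omega, hreg r hr]
      · intro b hb
        simp [hb, hmem b hb]
      · intro c
        simp only [State.setReg_mem, State.setMem_mem_self, eval, h25, h26, h27, hz,
          hmem x hzx.symm]
        by_cases hc : c = i + l
        · rw [if_pos hc, if_pos (by omega), hc, Nat.add_sub_cancel_left]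
        · rw [if_neg hc]
          congr 1
          simp only [eq_iff_iff]
          omega
  · rintro s₁ ⟨h25, h26, h27, h28, -⟩
    exact ⟨by simp only [Fits]; omega, by simp only [Fits]; omega, by simp only [eval]; omega⟩
  · rintro t' s' ht' ⟨h25, h26, h27, h28, hreg, hmem, hz⟩
    refine ⟨?_, hreg, hmem, hz⟩
    simp only [cost] at ht'
    omega

end Subroutines

end GrassGray

namespace GrassGray

/-! ### Gaussian coefficients by Pascal's rule -/

section Gauss

/-- The Gaussian coefficients, defined by Pascal's rule. -/
def gaussRec (q : ℕ) : ℕ → ℕ → ℕ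
  | _, 0 => 1
  | 0, _ + 1 => 0
  | n + 1, k + 1 => gaussRec q n (k + 1) + q ^ (n - k) * gaussRec q n k

@[simp] theorem gaussRec_zero_right (q n : ℕ) : gaussRec q n 0 = 1 := by
  cases n <;> rfl

theorem gaussRec_succ_succ (q n k : ℕ) :
    gaussRec q (n + 1) (k + 1) = gaussRec q n (k + 1) + q ^ (n - k) * gaussRec q n k := rfl

theorem gaussRec_eq_zero {q n k : ℕ} (h : n < k) : gaussRec q n k = 0 := by
  induction n generalizing k with
  | zero => cases k with
    | zero => omega
    | succ k => rfl
  | succ n ih => cases k with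
    | zero => omega
    | succ k => rw [gaussRec_succ_succ, ih (by omega), ih (by omega), mul_zero, add_zero]

@[simp] theorem gaussRec_self (q n : ℕ) : gaussRec q n n = 1 := by
  induction n with
  | zero => rfl
  | succ n ih => rw [gaussRec_succ_succ, gaussRec_eq_zero (by omega), ih]; simp

theorem gaussRec_pos {q : ℕ} (hq : 0 < q) {n k : ℕ} (h : k ≤ n) : 0 < gaussRec q n k := by
  induction n generalizing k with
  | zero => obtain rfl : k = 0 := by omega
            simp
  | succ n ih => cases k with
    | zero => simp
    | succ k =>
      rw [gaussRec_succ_succ]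
      have := Nat.mul_pos (Nat.pow_pos (n := n - k) hq) (ih (k := k) (by omega))
      omega

/-- Both summands of Pascal's rule are at most q^n q^(nk), and the exponent available for `n + 1`
and `k + 1` exceeds this by k + 1 ≥ 1, so that the additional factor is at least 2. -/
theorem gaussRec_le_pow {q : ℕ} (hq : 2 ≤ q) (n k : ℕ) : gaussRec q n k ≤ q ^ (n * k) := by
  induction n generalizing k with
  | zero => cases k with
    | zero => simp
    | succ k => simp [gaussRec]
  | succ n ih => cases k with
    | zero => simp
    | succ k =>
      rw [gaussRec_succ_succ]
      have h1 := ih (k + 1)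
      have h2 : q ^ (n - k) * gaussRec q n k ≤ q ^ n * q ^ (n * k) :=
        Nat.mul_le_mul (Nat.pow_le_pow_right (by omega) (by omega)) (ih k)
      have e1 : q ^ (n * (k + 1)) = q ^ n * q ^ (n * k) := by ring
      have e2 : q ^ ((n + 1) * (k + 1)) = q ^ n * q ^ (n * k) * (q * q ^ k) := by ring
      have h3 : 2 * 1 ≤ q * q ^ k := Nat.mul_le_mul hq (Nat.one_le_pow _ _ (by omega))
      rw [e1] at h1
      rw [e2]
      nlinarith

/-- This is why numbers of `n * k + 1` digits suffice throughout both programs. -/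
theorem gaussRec_lt_pow {q : ℕ} (hq : 2 ≤ q) {n k N K : ℕ} (hn : n ≤ N) (hk : k ≤ K) :
    gaussRec q n k < q ^ (N * K + 1) :=
  (gaussRec_le_pow hq n k).trans_lt <|
    Nat.pow_lt_pow_right (by omega) (Nat.lt_succ_of_le (Nat.mul_le_mul hn hk))

/-- The first identity moves along a column of Pascal's triangle, the second along a diagonal. They
are proved together, because after Pascal's rule each of them for `n + 1` is a linear combination of
both for `n`. -/
theorem gaussRec_mul_pow_sub_one {q : ℕ} (hq : 0 < q) {n k : ℕ} (h : k ≤ n + 1) :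
    gaussRec q n k * (q ^ (n + 1) - 1) = gaussRec q (n + 1) k * (q ^ (n + 1 - k) - 1) ∧
    ∀ l, k = l + 1 → gaussRec q (n + 1) k * (q ^ k - 1) = gaussRec q n l * (q ^ (n + 1) - 1) := by
  have one_le : ∀ a, 1 ≤ q ^ a := fun a => Nat.one_le_pow _ _ hq
  induction n generalizing k with
  | zero =>
    interval_cases k
    · simp
    · simp [gaussRec]
  | succ n ih =>
    cases k with
    | zero => simp
    | succ k =>
      have goal2 : gaussRec q (n + 2) (k + 1) * (q ^ (k + 1) - 1) =
          gaussRec q (n + 1) k * (q ^ (n + 2) - 1) := by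
        rcases Nat.lt_or_ge n k with hk | hk
        -- At the border `k = n + 1` both coefficients are 1 and the two factors agree.
        · obtain rfl : k = n + 1 := by omega
          simp
        · obtain ⟨d, rfl⟩ := Nat.exists_eq_add_of_le hk
          have h1 := (ih (k := k + 1) (by omega)).2 k rfl
          have h2 := (ih (k := k) (by omega)).1
          have h3 := gaussRec_succ_succ q (k + d + 1) k
          rw [show k + d + 1 - k = d + 1 by omega] at h2 h3
          rw [h3]
          clear ih
          zify [one_le] at *
          linear_combination h1 + h2
      refine ⟨?_, ?_⟩
      · rcases Nat.lt_or_ge n k with hk | hk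
        · obtain rfl : k = n + 1 := by omega
          rw [gaussRec_eq_zero (by omega)]
          simp
        · obtain ⟨d, rfl⟩ := Nat.exists_eq_add_of_le hk
          have h3 := gaussRec_succ_succ q (k + d + 1) k
          rw [show k + d + 1 - k = d + 1 by omega] at h3
          have h2 := (ih (k := k + 1) (by omega)).2 k rfl
          have h1 := (ih (k := k) (by omega)).1
          rw [show k + d + 1 - k = d + 1 by omega] at h1
          rw [show k + d + 1 + 1 - (k + 1) = d + 1 by omega, h3]
          clear ih goal2
          zify [one_le] at *
          linear_combination (q : ℤ) ^ (d + 1) * (h2 + h1)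
      · rintro l hl
        obtain rfl : k = l := by omega
        exact goal2

/-- The diagonal identity, divided by q - 1, is the recursion of the quotient of q-factorials. It
shows that the quotient in `gauss` is exact. -/
theorem gauss_eq_gaussRec {q : ℕ} (hq : 2 ≤ q) {n k : ℕ} (h : k ≤ n) :
    gauss q n k = gaussRec q n k := by
  have hnum : ∀ m, qNumber q m * (q - 1) = q ^ m - 1 := fun m => by
    have h1 : 1 ≤ q := by omega
    have h2 : 1 ≤ q ^ m := Nat.one_le_pow _ _ h1
    zify [h1, h2, qNumber]
    exact geom_sum_mul _ _
  have hpos : ∀ m, 0 < qFactorial q m := fun m => Finset.prod_pos fun i _ => by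
    rw [qNumber, Finset.sum_range_succ]
    positivity
  have hfac : ∀ m, qFactorial q (m + 1) = qFactorial q m * qNumber q (m + 1) := fun m =>
    Finset.prod_range_succ _ _
  have key : ∀ d k, gaussRec q (d + k) k * (qFactorial q k * qFactorial q d) =
      qFactorial q (d + k) := by
    intro d k
    induction k with
    | zero => simp [qFactorial]
    | succ k ih =>
      have h1 := (gaussRec_mul_pow_sub_one (q := q) (by omega) (n := d + k) (k := k + 1)
        (by omega)).2 k rfl
      rw [← hnum, ← hnum, ← mul_assoc, ← mul_assoc] at h1
      have h2 := Nat.eq_of_mul_eq_mul_right (by omega) h1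
      rw [← add_assoc, hfac, hfac, ← ih]
      linear_combination (qFactorial q k * qFactorial q d) * h2
  obtain ⟨d, rfl⟩ := Nat.exists_eq_add_of_le' h
  rw [gauss, Nat.add_sub_cancel, ← key d k, Nat.mul_div_cancel _ (Nat.mul_pos (hpos _) (hpos _))]

end Gauss

end GrassGray

namespace GrassGray

/-! ### Matrices in echelon form -/

section EchelonForm

variable {F : Type*} [Field F]

@[simp] theorem appendZero_castSucc {k n : ℕ} (M : Matrix (Fin k) (Fin n) F) (r : Fin k)
    (c : Fin n) : appendZero M r c.castSucc = M r c := by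
  simp [appendZero]

@[simp] theorem appendZero_last {k n : ℕ} (M : Matrix (Fin k) (Fin n) F) (r : Fin k) :
    appendZero M r (Fin.last n) = 0 := by
  simp [appendZero]

@[simp] theorem dropLast_appendZero {k n : ℕ} (M : Matrix (Fin k) (Fin n) F) :
    dropLast (appendZero M) = M := by
  ext r c
  simp [dropLast]

theorem appendZero_dropLast {k n : ℕ} {M : Matrix (Fin k) (Fin (n + 1)) F}
    (h : ∀ r, M r (Fin.last n) = 0) : appendZero (dropLast M) = M := by
  ext r c
  induction c using Fin.lastCases with
  | last => simp [h]
  | cast c => simp [dropLast]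

@[simp] theorem insertRow_self {k n : ℕ} (i : Fin (k + 1)) (v : Fin n → F)
    (M : Matrix (Fin k) (Fin n) F) : insertRow i v M i = v :=
  Fin.insertNth_apply_same _ _ _

@[simp] theorem insertRow_succAbove {k n : ℕ} (i : Fin (k + 1)) (v : Fin n → F)
    (M : Matrix (Fin k) (Fin n) F) (r : Fin k) : insertRow i v M (i.succAbove r) = M r :=
  Fin.insertNth_apply_succAbove _ _ _ _

@[simp] theorem deleteRow_insertRow {k n : ℕ} (i : Fin (k + 1)) (v : Fin n → F)
    (M : Matrix (Fin k) (Fin n) F) : deleteRow i (insertRow i v M) = M := by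
  ext r c
  simp [deleteRow]

theorem IsLead.unique {k n : ℕ} {M : Matrix (Fin k) (Fin n) F} {r : Fin k} {c c' : Fin n}
    (h : IsLead M r c) (h' : IsLead M r c') : c = c' := by
  rcases lt_trichotomy c c' with hc | hc | hc
  · exact absurd (h'.2 c hc) h.1
  · exact hc
  · exact absurd (h.2 c' hc) h'.1

theorem isLead_appendZero_castSucc {k n : ℕ} {M : Matrix (Fin k) (Fin n) F} {r : Fin k}
    {c : Fin n} : IsLead (appendZero M) r c.castSucc ↔ IsLead M r c := by
  simp only [IsLead, appendZero_castSucc]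
  refine and_congr_right fun _ => ⟨fun h c' hc' => ?_, fun h c' hc' => ?_⟩
  · simpa using h c'.castSucc (by simpa using hc')
  · induction c' using Fin.lastCases with
    | last => simp
    | cast c' => simpa using h c' (by simpa using hc')

theorem not_isLead_appendZero_last {k n : ℕ} {M : Matrix (Fin k) (Fin n) F} {r : Fin k} :
    ¬ IsLead (appendZero M) r (Fin.last n) := fun h => h.1 (by simp)

/-- The leading coefficients move to the right from row to row. -/
def Echelon {k n : ℕ} (M : Matrix (Fin k) (Fin n) F) : Prop :=
  ∃ p : Fin k → Fin n, StrictMono p ∧ ∀ r, IsLead M r (p r)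

theorem Echelon.appendZero {k n : ℕ} {M : Matrix (Fin k) (Fin n) F} (h : Echelon M) :
    Echelon (appendZero M) := by
  obtain ⟨p, hp, hl⟩ := h
  exact ⟨fun r => (p r).castSucc, fun a b hab => by simpa using hp hab,
    fun r => isLead_appendZero_castSucc.2 (hl r)⟩

theorem echelon_appendZero_iff {k n : ℕ} {M : Matrix (Fin k) (Fin n) F} :
    Echelon (GrassGray.appendZero M) ↔ Echelon M := by
  refine ⟨?_, Echelon.appendZero⟩
  rintro ⟨p, hp, hl⟩
  have h : ∀ r, ∃ c : Fin n, c.castSucc = p r := fun r => by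
    refine Fin.exists_castSucc_eq.2 fun hr => ?_
    have := hl r
    rw [hr] at this
    exact not_isLead_appendZero_last this
  choose p' hp' using h
  refine ⟨p', fun a b hab => ?_, fun r => ?_⟩
  · have := hp hab
    rwa [← hp', ← hp', Fin.castSucc_lt_castSucc_iff] at this
  · rw [← isLead_appendZero_castSucc, hp']
    exact hl r

theorem Echelon.le {k n : ℕ} {M : Matrix (Fin k) (Fin n) F} (h : Echelon M) : k ≤ n := by
  obtain ⟨p, hp, -⟩ := h
  simpa using Fintype.card_le_of_injective p hp.injective

theorem Echelon.isLead_inj {k n : ℕ} {M : Matrix (Fin k) (Fin n) F} (h : Echelon M) {r r' : Fin k}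
    {c : Fin n} (hr : IsLead M r c) (hr' : IsLead M r' c) : r = r' := by
  obtain ⟨p, hp, hl⟩ := h
  exact hp.injective (((hl r).unique hr).trans ((hl r').unique hr').symm)

theorem Echelon.deleteRow {k n : ℕ} {M : Matrix (Fin (k + 1)) (Fin n) F} (h : Echelon M)
    (i : Fin (k + 1)) : Echelon (deleteRow i M) := by
  obtain ⟨p, hp, hl⟩ := h
  exact ⟨fun r => p (i.succAbove r), fun a b hab => hp (Fin.strictMono_succAbove i hab),
    fun r => hl _⟩

theorem echelon_simpleMatrix {k n : ℕ} (h : k ≤ n) :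
    Echelon (simpleMatrix k n : Matrix (Fin k) (Fin n) F) := by
  refine ⟨Fin.castLE h, Fin.strictMono_castLE h, fun r => ⟨by simp [simpleMatrix], ?_⟩⟩
  intro c' hc'
  have : (c' : ℕ) < r := by simpa [Fin.lt_def] using hc'
  simp only [simpleMatrix]
  rw [if_neg (by omega)]

variable [DecidableEq F]

@[simp] theorem mem_leadCols {k n : ℕ} {M : Matrix (Fin k) (Fin n) F} {c : Fin n} :
    c ∈ leadCols M ↔ ∃ r, IsLead M r c := by
  simp [leadCols]

theorem Echelon.card_leadCols {k n : ℕ} {M : Matrix (Fin k) (Fin n) F} (h : Echelon M) :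
    (leadCols M).card = k := by
  obtain ⟨p, hp, hl⟩ := h
  have : leadCols M = Finset.univ.image p := by
    ext c
    simp only [mem_leadCols, Finset.mem_image, Finset.mem_univ, true_and]
    exact exists_congr fun r => ⟨fun hr => (hl r).unique hr, fun hr => hr ▸ hl r⟩
  rw [this, Finset.card_image_of_injective _ hp.injective, Finset.card_univ, Fintype.card_fin]

theorem Echelon.card_compl_leadCols {k n : ℕ} {M : Matrix (Fin k) (Fin n) F} (h : Echelon M) :
    (leadCols M)ᶜ.card = n - k := by
  rw [Finset.card_compl, h.card_leadCols, Fintype.card_fin]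

/-- The leading columns increase with the row, so the rows that lead to the left of `c` form an
initial segment, and its cardinality is exactly the position at which `v` has to be inserted. -/
theorem Echelon.insertRow {k n : ℕ} {M : Matrix (Fin k) (Fin n) F} (h : Echelon M)
    {v : Fin n → F} {c : Fin n} (hv : v c ≠ 0) (hv' : ∀ c' < c, v c' = 0) (hc : c ∉ leadCols M) :
    Echelon (insertRow (rowPosition M v) v M) := by
  obtain ⟨p, hp, hl⟩ := h
  have hne : ∀ r, p r ≠ c := fun r hr => hc (mem_leadCols.2 ⟨r, hr ▸ hl r⟩)
  have hS : (Finset.univ.filter fun r => ∃ c, IsLead M r c ∧ ∀ c' ≤ c, v c' = 0) =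
      Finset.univ.filter fun r => p r < c := by
    ext r
    simp only [Finset.mem_filter, Finset.mem_univ, true_and]
    constructor
    · rintro ⟨c', hl', h0⟩
      rw [(hl r).unique hl']
      by_contra hlt
      exact hv (h0 c (not_lt.1 hlt))
    · exact fun hlt => ⟨p r, hl r, fun c' hc' => hv' c' (hc'.trans_lt hlt)⟩
  -- An initial segment is compared with its cardinality by enclosing it between `Finset.Iic r` and
  -- `Finset.Iio r`.
  have hiff : ∀ r : Fin k, r.castSucc < rowPosition M v ↔ p r < c := by
    intro r
    have hval : (rowPosition M v : ℕ) = (Finset.univ.filter fun r => p r < c).card := by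
      rw [← hS]; rfl
    rw [Fin.lt_def, hval, Fin.val_castSucc]
    constructor
    · intro hlt
      by_contra hr
      have : (Finset.univ.filter fun r => p r < c) ⊆ Finset.Iio r := by
        intro r' hr'
        simp only [Finset.mem_filter, Finset.mem_univ, true_and] at hr'
        rw [Finset.mem_Iio]
        by_contra hge
        exact hr ((hp.monotone (not_lt.1 hge)).trans_lt hr')
      have := Finset.card_le_card this
      rw [Fin.card_Iio] at this
      omega
    · intro hr
      have : Finset.Iic r ⊆ (Finset.univ.filter fun r => p r < c) := by
        intro r' hr'
        simp only [Finset.mem_filter, Finset.mem_univ, true_and]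
        exact (hp.monotone (Finset.mem_Iic.1 hr')).trans_lt hr
      have := Finset.card_le_card this
      rw [Fin.card_Iic] at this
      omega
  refine ⟨(rowPosition M v).insertNth (α := fun _ => Fin n) c p, ?_, fun r => ?_⟩
  · refine (Fin.strictMono_insertNth_iff _ _ _).2 ⟨hp, fun r hr => (hiff r).1 hr, fun r hr => ?_⟩
    refine lt_of_le_of_ne (not_lt.1 fun hlt => ?_) (hne r).symm
    exact absurd ((hiff r).2 hlt) (not_lt.2 hr)
  · induction r using Fin.succAboveCases (rowPosition M v) with
    | x => simpa [IsLead] using ⟨hv, hv'⟩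
    | p r => simpa [IsLead] using hl r

/-- The number of non-leading columns to the left of the column with index `c`. -/
def freeRank {k n : ℕ} (M : Matrix (Fin k) (Fin n) F) (c : ℕ) : ℕ :=
  ((leadCols M)ᶜ.filter fun c' : Fin n => (c' : ℕ) < c).card

@[simp] theorem freeRank_zero {k n : ℕ} (M : Matrix (Fin k) (Fin n) F) : freeRank M 0 = 0 := by
  simp [freeRank]

theorem freeRank_succ {k n : ℕ} (M : Matrix (Fin k) (Fin n) F) (c : Fin n) :
    freeRank M (c + 1) = freeRank M c + if c ∈ leadCols M then 0 else 1 := by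
  split_ifs with h
  · refine congrArg Finset.card (Finset.filter_congr fun c' hc' => ?_)
    have : c' ≠ c := by
      rintro rfl
      exact Finset.mem_compl.1 hc' h
    rw [Ne, Fin.ext_iff] at this
    omega
  · have : (leadCols M)ᶜ.filter (fun c' : Fin n => (c' : ℕ) < c + 1) =
        insert c ((leadCols M)ᶜ.filter fun c' : Fin n => (c' : ℕ) < c) := by
      ext c'
      simp only [Finset.mem_filter, Finset.mem_insert, Finset.mem_compl]
      rcases eq_or_ne c' c with rfl | hc
      · simp [h]
      · rw [Ne, Fin.ext_iff] at hc
        simp only [Fin.ext_iff]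
        constructor
        · rintro ⟨h1, h2⟩
          exact .inr ⟨h1, by omega⟩
        · rintro (h1 | h1)
          · omega
          · exact ⟨h1.1, by omega⟩
    rw [freeRank, this, Finset.card_insert_of_notMem (by simp)]
    rfl

theorem freeRank_self {k n : ℕ} (M : Matrix (Fin k) (Fin n) F) :
    freeRank M n = (leadCols M)ᶜ.card := by
  simp [freeRank]

theorem freeRank_mono {k n : ℕ} (M : Matrix (Fin k) (Fin n) F) : Monotone (freeRank M) :=
  fun _ _ h => Finset.card_le_card (Finset.monotone_filter_right _ fun _ _ h' => h'.trans_le h)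

/-- `freeRank` inverts the enumeration of the non-leading columns. Unlike `freeCol`, it can be
maintained by a counter during a scan of the columns. -/
theorem freeRank_freeCol {k n : ℕ} (M : Matrix (Fin k) (Fin n) F) (l : Fin (leadCols M)ᶜ.card) :
    freeRank M (freeCol M l) = l := by
  have : (leadCols M)ᶜ.filter (fun c' : Fin n => (c' : ℕ) < freeCol M l) =
      (Finset.Iio l).map (freeCol M).toEmbedding := by
    ext c'
    simp only [Finset.mem_filter, Finset.mem_map, Finset.mem_Iio]
    constructor
    · rintro ⟨h1, h2⟩
      rw [← Finset.mem_coe, ← Finset.range_orderEmbOfFin _ rfl] at h1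
      obtain ⟨l', rfl⟩ := h1
      exact ⟨l', (freeCol M).lt_iff_lt.1 h2, rfl⟩
    · rintro ⟨l', h1, rfl⟩
      exact ⟨Finset.orderEmbOfFin_mem _ rfl _, (freeCol M).lt_iff_lt.2 h1⟩
  rw [freeRank, this, Finset.card_map, Fin.card_Iio]

theorem freeCol_notMem {k n : ℕ} (M : Matrix (Fin k) (Fin n) F) (l : Fin (leadCols M)ᶜ.card) :
    freeCol M l ∉ leadCols M :=
  Finset.mem_compl.1 (Finset.orderEmbOfFin_mem _ rfl _)

theorem exists_freeCol {k n : ℕ} {M : Matrix (Fin k) (Fin n) F} {c : Fin n}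
    (h : c ∉ leadCols M) : ∃ l, freeCol M l = c := by
  have h1 := Finset.mem_compl.2 h
  rwa [← Finset.mem_coe, ← Finset.range_orderEmbOfFin _ rfl] at h1

theorem exists_isLead {n : ℕ} {v : Fin n → F} (hv : v ≠ 0) :
    ∃ c, v c ≠ 0 ∧ ∀ c' < c, v c' = 0 := by
  obtain ⟨c, hc⟩ := Function.ne_iff.1 hv
  have hne : (Finset.univ.filter fun c => v c ≠ 0).Nonempty := ⟨c, by simpa using hc⟩
  refine ⟨_, by simpa using Finset.min'_mem _ hne, fun c' hc' => ?_⟩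
  by_contra h
  exact absurd (Finset.min'_le _ c' (by simpa using h)) (not_le.2 hc')

variable [Fintype F]

theorem newVector_last (α : Fin (Fintype.card F) ≃ F) {k n : ℕ} (C : Matrix (Fin k) (Fin n) F)
    (j : ℕ) : newVector α C j (Fin.last n) = 1 := by
  simp [newVector, Finset.sum_apply, (Fin.castSucc_lt_last _).ne']

/-- In this form the entries of the new row are available in one scan: the digit index is the number
of non-leading columns passed so far. -/
theorem newVector_castSucc (α : Fin (Fintype.card F) ≃ F) {k n : ℕ}
    (C : Matrix (Fin k) (Fin n) F) (j : ℕ) (c : Fin n) :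
    newVector α C j c.castSucc = if c ∈ leadCols C then 0 else
      α ⟨digit (Fintype.card F) j (freeRank C c), Nat.mod_lt _ Fintype.card_pos⟩ := by
  have h0 : (Pi.single (Fin.last n) 1 : Fin (n + 1) → F) c.castSucc = 0 := by
    simp [(Fin.castSucc_lt_last c).ne]
  rw [newVector, Pi.add_apply, h0, zero_add, Finset.sum_apply]
  split_ifs with h
  · refine Finset.sum_eq_zero fun l _ => ?_
    have : c.castSucc ≠ (freeCol C l).castSucc := fun hc =>
      freeCol_notMem C l (Fin.castSucc_injective _ hc ▸ h)
    simp [this]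
  · obtain ⟨l, rfl⟩ := exists_freeCol h
    rw [Finset.sum_eq_single l]
    · simp [freeRank_freeCol]
    · intro l' _ hl'
      have : (freeCol C l).castSucc ≠ (freeCol C l').castSucc := fun hc =>
        hl' ((freeCol C).injective (Fin.castSucc_injective _ hc)).symm
      simp [this]
    · simp

/-- The new vector vanishes at the leading columns of `C` and is 1 in the last column, where
`appendZero C` has no leading coefficient. Hence its own leading column is new. -/
theorem exists_isLead_newVector (α : Fin (Fintype.card F) ≃ F) {k n : ℕ}
    (C : Matrix (Fin k) (Fin n) F) (j : ℕ) :
    ∃ c, newVector α C j c ≠ 0 ∧ (∀ c' < c, newVector α C j c' = 0) ∧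
      c ∉ leadCols (appendZero C) := by
  obtain ⟨c, hc, hc'⟩ := exists_isLead (v := newVector α C j)
    (fun h => one_ne_zero ((newVector_last α C j).symm.trans (congrFun h _)))
  refine ⟨c, hc, hc', fun hl => ?_⟩
  obtain ⟨r, hr⟩ := mem_leadCols.1 hl
  induction c using Fin.lastCases with
  | last => exact not_isLead_appendZero_last hr
  | cast c =>
    rw [newVector_castSucc, if_pos (mem_leadCols.2 ⟨r, isLead_appendZero_castSucc.1 hr⟩)] at hc
    exact hc rfl

end EchelonForm

end GrassGray

namespace GrassGray

/-! ### Canonical matrices -/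

section Canonical

variable {F : Type*} [Field F]

/-- `c` is the position of the last non-zero coefficient of the row of `M` with index `r`. -/
def IsTrail {k n : ℕ} (M : Matrix (Fin k) (Fin n) F) (r : Fin k) (c : Fin n) : Prop :=
  M r c ≠ 0 ∧ ∀ c' > c, M r c' = 0

/-- The last non-zero coefficients of the rows are in different columns. -/
def TrailInj {k n : ℕ} (M : Matrix (Fin k) (Fin n) F) : Prop :=
  ∀ r r' c, IsTrail M r c → IsTrail M r' c → r = r'

theorem IsTrail.unique {k n : ℕ} {M : Matrix (Fin k) (Fin n) F} {r : Fin k} {c c' : Fin n}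
    (h : IsTrail M r c) (h' : IsTrail M r c') : c = c' := by
  rcases lt_trichotomy c c' with hc | hc | hc
  · exact absurd (h.2 c' hc) h'.1
  · exact hc
  · exact absurd (h'.2 c hc) h.1

theorem isTrail_appendZero_castSucc {k n : ℕ} {M : Matrix (Fin k) (Fin n) F} {r : Fin k}
    {c : Fin n} : IsTrail (appendZero M) r c.castSucc ↔ IsTrail M r c := by
  simp only [IsTrail, appendZero_castSucc]
  refine and_congr_right fun _ => ⟨fun h c' hc' => ?_, fun h c' hc' => ?_⟩
  · simpa using h c'.castSucc (by simpa using hc')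
  · induction c' using Fin.lastCases with
    | last => simp
    | cast c' => simpa using h c' (by simpa using hc')

theorem not_isTrail_appendZero_last {k n : ℕ} {M : Matrix (Fin k) (Fin n) F} {r : Fin k} :
    ¬ IsTrail (appendZero M) r (Fin.last n) := fun h => h.1 (by simp)

theorem isTrail_last {k n : ℕ} {M : Matrix (Fin k) (Fin (n + 1)) F} {r : Fin k}
    (h : M r (Fin.last n) ≠ 0) : IsTrail M r (Fin.last n) :=
  ⟨h, fun c hc => absurd (Fin.le_last c) (not_le.2 hc)⟩

theorem trailInj_appendZero_iff {k n : ℕ} {M : Matrix (Fin k) (Fin n) F} :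
    TrailInj (appendZero M) ↔ TrailInj M := by
  refine ⟨fun h r r' c hr hr' => ?_, fun h r r' c hr hr' => ?_⟩
  · exact h r r' _ (isTrail_appendZero_castSucc.2 hr) (isTrail_appendZero_castSucc.2 hr')
  · induction c using Fin.lastCases with
    | last => exact absurd hr not_isTrail_appendZero_last
    | cast c =>
      exact h r r' c (isTrail_appendZero_castSucc.1 hr) (isTrail_appendZero_castSucc.1 hr')

theorem TrailInj.deleteRow {k n : ℕ} {M : Matrix (Fin (k + 1)) (Fin n) F} (h : TrailInj M)
    (i : Fin (k + 1)) : TrailInj (deleteRow i M) :=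
  fun _ _ c hr hr' => Fin.succAbove_right_injective (h _ _ c hr hr')

/-- The new row ends in the last column, where all the other rows are zero. -/
theorem TrailInj.insertRow {k n : ℕ} {M : Matrix (Fin k) (Fin n) F} (h : TrailInj M)
    (i : Fin (k + 1)) {v : Fin (n + 1) → F} (hv : v (Fin.last n) ≠ 0) :
    TrailInj (insertRow i v (appendZero M)) := by
  have hi : ∀ c, IsTrail (GrassGray.insertRow i v (appendZero M)) i c → c = Fin.last n :=
    fun c hc => hc.unique (isTrail_last (by simpa using hv))
  have hr : ∀ r c, IsTrail (GrassGray.insertRow i v (appendZero M)) (i.succAbove r) c →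
      IsTrail (appendZero M) r c := fun r c hc => by
    simpa only [IsTrail, insertRow_succAbove] using hc
  intro r r' c h1 h2
  induction r using Fin.succAboveCases i with
  | x =>
    obtain rfl := hi c h1
    induction r' using Fin.succAboveCases i with
    | x => rfl
    | p r' => exact absurd (hr _ _ h2) not_isTrail_appendZero_last
  | p r =>
    induction r' using Fin.succAboveCases i with
    | x =>
      obtain rfl := hi c h2
      exact absurd (hr _ _ h1) not_isTrail_appendZero_last
    | p r' => exact congrArg _ (trailInj_appendZero_iff.2 h r r' c (hr _ _ h1) (hr _ _ h2))

variable [DecidableEq F]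

/-- The row `i` used for clearing is the lowest one with a non-zero last entry, so only rows above
it change. Their leading columns lie to the left of that of row `i`, where row `i` is zero, and row
`i` is also zero in all the other pivot columns. Clearing thus preserves reduced echelon form with
the same pivots, and the induction applies to the matrix without row `i`. The pivot map is an
explicit argument because τ has to keep it. -/
theorem tau_isLead_trailInj {k n : ℕ} {M : Matrix (Fin k) (Fin n) F} {p : Fin k → Fin n}
    (hp : StrictMono p)
    (hM : ∀ r, (∀ c < p r, M r c = 0) ∧ ∀ r', M r' (p r) = if r' = r then 1 else 0) :
    (∀ r, IsLead (tau M) r (p r)) ∧ TrailInj (tau M) := by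
  induction n generalizing k with
  | zero => exact ⟨fun r => (p r).elim0, fun r => (p r).elim0⟩
  | succ n ih =>
    cases k with
    | zero => exact ⟨fun r => r.elim0, fun r => r.elim0⟩
    | succ k =>
      rw [tau]
      split_ifs with hne
      · set i := (lastSupport M).max' hne with hi
        have hilast : M i (Fin.last n) ≠ 0 := by
          exact (Finset.mem_filter.1 ((lastSupport M).max'_mem hne)).2
        have hile : ∀ r, M r (Fin.last n) ≠ 0 → r ≤ i := fun r hr =>
          (lastSupport M).le_max' r (by simpa [lastSupport] using hr)
        clear_value i
        simp only
        set v := (M i (Fin.last n))⁻¹ • M i with hv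
        have hvlast : v (Fin.last n) = 1 := by simp [hv, hilast]
        -- The last column is not the pivot column of another row, because row `i` is non-zero
        -- there.
        have hpne : ∀ r, ∃ c : Fin n, c.castSucc = p (i.succAbove r) := fun r => by
          refine Fin.exists_castSucc_eq.2 fun hr => hilast ?_
          rw [← hr, (hM _).2, if_neg (Fin.succAbove_ne i r).symm]
        choose p' hp' using hpne
        have hmono : StrictMono p' := fun a b hab => by
          have := hp (Fin.strictMono_succAbove i hab)
          rwa [← hp', ← hp', Fin.castSucc_lt_castSucc_iff] at this
        obtain ⟨ih1, ih2⟩ := ih (M := dropLast (deleteRow i fun r => M r - M r (Fin.last n) • v))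
          hmono (fun r => by
            refine ⟨fun c hc => ?_, fun r' => ?_⟩
            · have hc' : c.castSucc < p (i.succAbove r) := by
                rw [← hp']
                simpa using hc
              simp only [dropLast, deleteRow, Pi.sub_apply, Pi.smul_apply, smul_eq_mul,
                (hM _).1 _ hc', zero_sub, neg_eq_zero, mul_eq_zero]
              by_contra hcon
              rw [not_or] at hcon
              have h1 := lt_of_le_of_ne (hile _ hcon.1) (Fin.succAbove_ne i r)
              apply hcon.2
              simp [hv, (hM i).1 _ (hc'.trans (hp h1))]
            · simp only [dropLast, deleteRow, Pi.sub_apply, Pi.smul_apply, smul_eq_mul, hp', hv,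
                (hM _).2]
              simp [(Fin.succAbove_ne i r).symm])
        refine ⟨fun r => ?_, ih2.insertRow i (by rw [hvlast]; exact one_ne_zero)⟩
        induction r using Fin.succAboveCases i with
        | x =>
          simp only [IsLead, insertRow_self]
          refine ⟨by simp [hv, (hM i).2, hilast], fun c hc => ?_⟩
          simp [hv, (hM i).1 c hc]
        | p r =>
          simp only [IsLead, insertRow_succAbove]
          rw [← hp']
          exact isLead_appendZero_castSucc.2 (ih1 r)
      · have hlast : ∀ r, M r (Fin.last n) = 0 := fun r => by
          by_contra hr
          exact hne ⟨r, by simpa [lastSupport] using hr⟩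
        have hpne : ∀ r, ∃ c : Fin n, c.castSucc = p r := fun r => by
          refine Fin.exists_castSucc_eq.2 fun hr => ?_
          have := (hM r).2 r
          rw [hr, hlast] at this
          simp at this
        choose p' hp' using hpne
        have hmono : StrictMono p' := fun a b hab => by
          have := hp hab
          rwa [← hp', ← hp', Fin.castSucc_lt_castSucc_iff] at this
        obtain ⟨ih1, ih2⟩ := ih (M := dropLast M) hmono (fun r => by
          refine ⟨fun c hc => (hM r).1 _ ?_, fun r' => ?_⟩
          · rw [← hp']
            simpa using hc
          · rw [← (hM r).2 r', ← hp']
            rfl)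
        refine ⟨fun r => ?_, trailInj_appendZero_iff.2 ih2⟩
        rw [← hp']
        exact isLead_appendZero_castSucc.2 (ih1 r)

theorem IsCanonical.echelon {k n : ℕ} {W : Submodule F (Fin n → F)} {X : Matrix (Fin k) (Fin n) F}
    (h : IsCanonical W X) : Echelon X := by
  obtain ⟨M, ⟨p, hp, hM⟩, -, rfl⟩ := h
  exact ⟨p, hp, (tau_isLead_trailInj hp hM).1⟩

theorem IsCanonical.trailInj {k n : ℕ} {W : Submodule F (Fin n → F)}
    {X : Matrix (Fin k) (Fin n) F} (h : IsCanonical W X) : TrailInj X := by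
  obtain ⟨M, ⟨p, hp, hM⟩, -, rfl⟩ := h
  exact (tau_isLead_trailInj hp hM).2

end Canonical

/-! ### The recursions for encoding and decoding -/

section Recursion

variable {F : Type*} [Field F] [DecidableEq F] [Fintype F] (α : Fin (Fintype.card F) ≃ F)

local notation "qF" => Fintype.card F

theorem encode_self (n m : ℕ) : encode α n n m = simpleMatrix n n := by
  cases n <;> simp [encode]

theorem encode_of_lt {n k m : ℕ} (hk : k ≤ n + 1) (h : m < gaussRec qF n k) :
    encode α (n + 1) k m = appendZero (encode α n k m) := by
  cases k with
  | zero => ext r; exact r.elim0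
  | succ k =>
    have hkn : k + 1 ≤ n := by
      by_contra hc
      rw [gaussRec_eq_zero (by omega)] at h
      omega
    rw [encode]
    simp only
    rw [if_neg (by omega), gauss_eq_gaussRec Fintype.one_lt_card hkn, if_pos h]

/-- When all the columns of `C` are leading, the new vector is the last unit vector. The exceptional
case k = n of the encoding is therefore an instance of the general row case, and the program needs
no separate branch for it. -/
theorem simpleMatrix_succ (n j : ℕ) :
    (simpleMatrix (n + 1) (n + 1) : Matrix (Fin (n + 1)) (Fin (n + 1)) F) =
      insertRow (rowPosition (appendZero (simpleMatrix n n)) (newVector α (simpleMatrix n n) j))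
        (newVector α (simpleMatrix n n) j) (appendZero (simpleMatrix n n)) := by
  have hlead : ∀ r : Fin n, IsLead (simpleMatrix n n : Matrix (Fin n) (Fin n) F) r r := fun r => by
    refine ⟨by simp [simpleMatrix], fun c' hc' => ?_⟩
    have : (c' : ℕ) < r := hc'
    simp only [simpleMatrix]
    rw [if_neg (by omega)]
  have hv : ∀ c : Fin n, newVector α (simpleMatrix n n) j c.castSucc = 0 := fun c => by
    rw [newVector_castSucc, if_pos (mem_leadCols.2 ⟨c, hlead c⟩)]
  have hpos : rowPosition (appendZero (simpleMatrix n n : Matrix (Fin n) (Fin n) F))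
      (newVector α (simpleMatrix n n) j) = Fin.last n := by
    ext
    simp only [rowPosition, Fin.val_last]
    rw [Finset.filter_true_of_mem, Finset.card_univ, Fintype.card_fin]
    intro r _
    refine ⟨r.castSucc, isLead_appendZero_castSucc.2 (hlead r), fun c' hc' => ?_⟩
    induction c' using Fin.lastCases with
    | last => exact absurd hc' (not_le.2 (Fin.castSucc_lt_last r))
    | cast c' => exact hv c'
  rw [hpos]
  ext r c
  induction r using Fin.succAboveCases (Fin.last n) with
  | x =>
    rw [insertRow_self]
    induction c using Fin.lastCases with
    | last => simp [simpleMatrix, newVector_last]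
    | cast c =>
      rw [hv, simpleMatrix, if_neg]
      have := c.2
      simp only [Fin.val_last, Fin.val_castSucc]
      omega
  | p r =>
    rw [insertRow_succAbove]
    induction c using Fin.lastCases with
    | last =>
      rw [appendZero_last, simpleMatrix, if_neg]
      have := r.2
      simp only [Fin.val_last, Fin.succAbove_last, Fin.val_castSucc]
      omega
    | cast c => simp [simpleMatrix]

/-- The recursion holds without the exception k = n, by `simpleMatrix_succ`. -/
theorem encode_of_ge {n k m : ℕ} (hk : k ≤ n) (h : gaussRec qF n (k + 1) ≤ m)
    (h' : m < gaussRec qF (n + 1) (k + 1)) :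
    let C := encode α n k ((m - gaussRec qF n (k + 1) + 1) / qF ^ (n - k) % gaussRec qF n k)
    let v := newVector α C ((m - gaussRec qF n (k + 1) + 1) % qF ^ (n - k))
    encode α (n + 1) (k + 1) m = insertRow (rowPosition (appendZero C) v) v (appendZero C) := by
  rcases hk.eq_or_lt with rfl | hkn
  · rw [encode_self, encode_self]
    exact simpleMatrix_succ α k _
  · rw [encode]
    simp only
    rw [if_neg (by omega), gauss_eq_gaussRec Fintype.one_lt_card (show k + 1 ≤ n from hkn), if_neg (by omega),
      gauss_eq_gaussRec Fintype.one_lt_card hk]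

theorem echelon_encode {n k : ℕ} (hk : k ≤ n) (m : ℕ) : Echelon (encode α n k m) := by
  induction n generalizing k m with
  | zero =>
    obtain rfl : k = 0 := by omega
    exact echelon_simpleMatrix le_rfl
  | succ n ih =>
    cases k with
    | zero => exact echelon_simpleMatrix hk
    | succ k =>
      rw [encode]
      simp only
      split_ifs with h1 h2
      · exact echelon_simpleMatrix hk
      · exact (ih (by omega) m).appendZero
      · obtain ⟨c, hc, hc', hcl⟩ := exists_isLead_newVector α
          (encode α n k ((m - gauss qF n (k + 1) + 1) / qF ^ (n - k) % gauss qF n k))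
          ((m - gauss qF n (k + 1) + 1) % qF ^ (n - k))
        exact (ih (by omega) _).appendZero.insertRow hc hc' hcl

theorem lastSupport_eq_singleton {k n : ℕ} {M : Matrix (Fin k) (Fin (n + 1)) F} {i : Fin k}
    (hi : M i (Fin.last n) ≠ 0) (hr : ∀ r ≠ i, M r (Fin.last n) = 0) : lastSupport M = {i} := by
  ext r
  simp only [lastSupport, Finset.mem_filter, Finset.mem_univ, true_and, Finset.mem_singleton]
  refine ⟨fun h => ?_, fun h => h ▸ hi⟩
  by_contra hne
  exact h (hr r hne)

theorem echelon_dropLast {k n : ℕ} {M : Matrix (Fin k) (Fin (n + 1)) F} (h : Echelon M)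
    (h0 : ∀ r, M r (Fin.last n) = 0) : Echelon (dropLast M) := by
  rwa [← echelon_appendZero_iff, appendZero_dropLast h0]

theorem decode_of_col {k n : ℕ} {M : Matrix (Fin k) (Fin (n + 1)) F} (h : Echelon M)
    (h0 : ∀ r, M r (Fin.last n) = 0) : decode α M = decode α (dropLast M) := by
  cases k with
  | zero => simp [decode]
  | succ k =>
    have := (echelon_dropLast h h0).le
    rw [decode]
    simp only
    rw [if_neg (by omega), dif_neg]
    rintro ⟨r, hr⟩
    simp [lastSupport, h0] at hr

theorem decode_lt {k n : ℕ} {M : Matrix (Fin k) (Fin n) F} (h : Echelon M) :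
    decode α M < gaussRec qF n k := by
  have hq : 2 ≤ qF := Fintype.one_lt_card
  induction n generalizing k with
  | zero =>
    obtain rfl : k = 0 := by have := h.le; omega
    simp [decode]
  | succ n ih =>
    cases k with
    | zero => simp [decode]
    | succ k =>
      have hkn := h.le
      rw [decode]
      simp only
      split_ifs with h1 h2
      · exact gaussRec_pos (by omega) hkn
      · rw [gaussRec_succ_succ, gauss_eq_gaussRec hq (by omega), gauss_eq_gaussRec hq (by omega)]
        have hpos : 0 < qF ^ (n - k) * gaussRec qF n k :=
          Nat.mul_pos (by positivity) (gaussRec_pos (by omega) (by omega))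
        refine Nat.add_lt_add_left ?_ _
        have hpos' : (0 : ℤ) < qF ^ (n - k) * gaussRec qF n k := by exact_mod_cast hpos
        zify
        rw [Int.toNat_of_nonneg (Int.emod_nonneg _ hpos'.ne')]
        exact Int.emod_lt_of_pos _ hpos'
      · have h0 : ∀ r, M r (Fin.last n) = 0 := fun r => by
          by_contra hr
          exact h2 ⟨r, by simpa [lastSupport] using hr⟩
        have := ih (echelon_dropLast h h0)
        rw [gaussRec_succ_succ]
        omega

/-- The digits of a new row, as a number. -/
def rowValue {k n : ℕ} (C : Matrix (Fin k) (Fin n) F) (v : Fin (n + 1) → F) : ℕ :=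
  ∑ l : Fin (leadCols C)ᶜ.card, (α.symm (v (freeCol C l).castSucc) : ℕ) * qF ^ (l : ℕ)

theorem rowValue_eq_sum {k n : ℕ} {C : Matrix (Fin k) (Fin n) F} (hC : Echelon C)
    {v : Fin (n + 1) → F} {f : ℕ → ℕ}
    (hf : ∀ c ∉ leadCols C, f (freeRank C c) = α.symm (v c.castSucc)) :
    rowValue α C v = ∑ l ∈ Finset.range (n - k), f l * qF ^ l := by
  rw [← hC.card_compl_leadCols, Finset.sum_range, rowValue]
  refine Finset.sum_congr rfl fun l _ => ?_
  rw [← hf _ (freeCol_notMem C l), freeRank_freeCol]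

theorem rowValue_lt {k n : ℕ} {C : Matrix (Fin k) (Fin n) F} (hC : Echelon C)
    (v : Fin (n + 1) → F) : rowValue α C v < qF ^ (n - k) := by
  rw [← hC.card_compl_leadCols]
  have := sum_mul_pow_lt (q := qF) (fun l => if h : l < (leadCols C)ᶜ.card then
    (α.symm (v (freeCol C ⟨l, h⟩).castSucc) : ℕ) else 0) (leadCols C)ᶜ.card
    (fun t ht => by rw [dif_pos ht]; exact Fin.is_lt _)
  rw [Finset.sum_range] at this
  simpa [rowValue] using this

theorem echelon_dropLast_deleteRow {k n : ℕ} {M : Matrix (Fin (k + 1)) (Fin (n + 1)) F}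
    (h : Echelon M) {i : Fin (k + 1)} (hr : ∀ r ≠ i, M r (Fin.last n) = 0) :
    Echelon (dropLast (deleteRow i M)) :=
  echelon_dropLast (h.deleteRow i) fun r => hr _ (Fin.succAbove_ne i r)

/-- Since T < N for N = q^(n-k) · `gaussRec` n k, reducing T - 1 modulo N matters only for T = 0,
where it gives N - 1, and by Pascal's rule the result is then the largest number. For k = n one has
N = 1, so T = 0, and the formula gives the prescribed value 0. -/
theorem decode_of_row {k n : ℕ} {M : Matrix (Fin (k + 1)) (Fin (n + 1)) F} (h : Echelon M)
    {i : Fin (k + 1)} (hi : M i (Fin.last n) ≠ 0) (hr : ∀ r ≠ i, M r (Fin.last n) = 0) {T : ℕ}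
    (hT : T = qF ^ (n - k) * decode α (dropLast (deleteRow i M)) +
      rowValue α (dropLast (deleteRow i M)) (M i)) :
    decode α M = if T = 0 then gaussRec qF (n + 1) (k + 1) - 1
      else gaussRec qF n (k + 1) + T - 1 := by
  have hq : 2 ≤ qF := Fintype.one_lt_card
  have hC := echelon_dropLast_deleteRow h hr
  have hD := decode_lt α hC
  have hs := rowValue_lt α hC (M i)
  have hkn := hC.le
  have hTlt : T < qF ^ (n - k) * gaussRec qF n k := by
    have := Nat.mul_le_mul_left (qF ^ (n - k)) hD
    rw [Nat.succ_eq_add_one, mul_add, mul_one] at this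
    omega
  rcases hkn.eq_or_lt with rfl | hkn
  · have hT0 : T = 0 := by simpa using hTlt
    rw [decode, if_pos hT0]
    simp
  · have hmax : ∀ hne : (lastSupport M).Nonempty, (lastSupport M).max' hne = i := fun hne => by
      simp [lastSupport_eq_singleton hi hr]
    have hne : (lastSupport M).Nonempty := by simp [lastSupport_eq_singleton hi hr]
    rw [decode]
    simp only
    rw [if_neg (by omega), dif_pos hne, hmax hne, gauss_eq_gaussRec hq (show k + 1 ≤ n from hkn),
      gauss_eq_gaussRec hq hkn.le]
    have hint : ((qF : ℤ) ^ (n - k) * (decode α (dropLast (deleteRow i M)) : ℤ) - 1 +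
        ((∑ l : Fin (leadCols (dropLast (deleteRow i M)))ᶜ.card, (α.symm (M i (freeCol
          (dropLast (deleteRow i M)) l).castSucc) : ℕ) * qF ^ (l : ℕ) : ℕ) : ℤ)) = (T : ℤ) - 1 := by
      rw [hT, rowValue]
      push_cast
      ring
    rw [hint]
    have hN : ((qF : ℤ) ^ (n - k) * (gaussRec qF n k : ℤ)) =
        ((qF ^ (n - k) * gaussRec qF n k : ℕ) : ℤ) := by push_cast; rfl
    rw [hN, gaussRec_succ_succ]
    generalize qF ^ (n - k) * gaussRec qF n k = N at *
    split_ifs with hT0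
    · rw [hT0, ← Int.add_mul_emod_self_left _ _ 1, Int.emod_eq_of_lt] <;> push_cast <;> omega
    · rw [Int.emod_eq_of_lt] <;> omega

/-- In the row case m' = m - `gaussRec` n (k + 1) + 1 lies between 1 and N = q^(n-k) · `gaussRec` n
k. For m' < N quotient and remainder give back T = m'; for m' = N the quotient is reduced to 0, and
T = 0 is decoded to the largest number. -/
theorem decode_encode {n k m : ℕ} (hk : k ≤ n) (hm : m < gaussRec qF n k) :
    decode α (encode α n k m) = m := by
  have hq : 2 ≤ qF := Fintype.one_lt_card
  induction n generalizing k m with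
  | zero =>
    obtain rfl : k = 0 := by omega
    simp at hm
    simp [decode, hm]
  | succ n ih =>
    rcases lt_or_ge m (gaussRec qF n k) with h | h
    · have hkn : k ≤ n := by
        by_contra hc
        rw [gaussRec_eq_zero (by omega)] at h
        omega
      have he := echelon_encode α hk m
      rw [encode_of_lt α hk h] at he ⊢
      rw [decode_of_col α he (by simp), dropLast_appendZero, ih hkn h]
    · cases k with
      | zero => simp at h hm; omega
      | succ k =>
        have hkn : k ≤ n := by omega
        have he := echelon_encode α hk m
        rw [encode_of_ge α hkn h hm] at he ⊢
        set C := encode α n k ((m - gaussRec qF n (k + 1) + 1) / qF ^ (n - k) % gaussRec qF n k)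
          with hCdef
        set j := (m - gaussRec qF n (k + 1) + 1) % qF ^ (n - k) with hj
        have hC : Echelon C := echelon_encode α hkn _
        have hHpos := gaussRec_pos (q := qF) (by omega) hkn
        have hpow : 0 < qF ^ (n - k) := by positivity
        have hD : decode α C = (m - gaussRec qF n (k + 1) + 1) / qF ^ (n - k) % gaussRec qF n k :=
          ih hkn (Nat.mod_lt _ hHpos)
        have hs : rowValue α C (newVector α C j) = j := by
          rw [rowValue_eq_sum α hC (f := digit qF j), sum_digit, Nat.mod_eq_of_lt
            (Nat.mod_lt _ hpow)]
          intro c hc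
          rw [newVector_castSucc, if_neg hc, Equiv.symm_apply_apply]
        rw [decode_of_row α he (i := rowPosition (appendZero C) (newVector α C j))
          (by simp [newVector_last]) (fun r hr => by
            obtain ⟨r, rfl⟩ := Fin.exists_succAbove_eq hr
            simp) rfl]
        simp only [deleteRow_insertRow, dropLast_appendZero, insertRow_self, hs, hD]
        rw [gaussRec_succ_succ] at hm ⊢
        have hdm := Nat.div_add_mod (m - gaussRec qF n (k + 1) + 1) (qF ^ (n - k))
        rw [← hj] at hdm
        rcases lt_or_ge ((m - gaussRec qF n (k + 1) + 1) / qF ^ (n - k)) (gaussRec qF n k)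
          with hlt | hge
        · rw [Nat.mod_eq_of_lt hlt, if_neg (by omega)]
          omega
        -- This is the wrap-around m' = N: the quotient equals the smaller Gaussian coefficient, and
        -- the remainder is 0.
        · have hle := Nat.mul_le_mul_left (qF ^ (n - k)) hge
          have heq : (m - gaussRec qF n (k + 1) + 1) / qF ^ (n - k) = gaussRec qF n k := by
            refine le_antisymm ?_ hge
            refine Nat.le_of_mul_le_mul_left ?_ hpow
            omega
          rw [heq, Nat.mod_self, mul_zero, zero_add, if_pos (by rw [heq] at hdm; omega)]
          rw [heq] at hdm
          omega

end Recursion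

end GrassGray

namespace GrassGray

/-! ### The environment of the encoding and decoding programs -/

section Environment

open WordExpr

/-- The sizes of the parameters, of the number `L` of digits and of the words. -/
structure Bounds (B q n k z o L : ℕ) : Prop where
  two_le : 2 ≤ q
  lt : 2 * q + n * n + n * k + 3 * n + 10 < B
  zero_lt : z < q
  one_lt : o < q
  digits : L = n * k + 1
  one_le : 1 ≤ k
  le : k ≤ n

/-- The registers that are not changed after the beginning. -/
structure Env (q n k z o L : ℕ) (s : State) : Prop where
  reg0 : s.reg 0 = q
  reg1 : s.reg 1 = n
  reg2 : s.reg 2 = k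
  reg3 : s.reg 3 = z
  reg4 : s.reg 4 = o
  reg5 : s.reg 5 = L

variable {B q n k z o L : ℕ}

theorem Env.congr {s s' : State} (h : Env q n k z o L s) (hs : ∀ r < 6, s'.reg r = s.reg r) :
    Env q n k z o L s' :=
  ⟨(hs 0 (by simp)).trans h.reg0, (hs 1 (by simp)).trans h.reg1, (hs 2 (by simp)).trans h.reg2,
    (hs 3 (by simp)).trans h.reg3, (hs 4 (by simp)).trans h.reg4, (hs 5 (by simp)).trans h.reg5⟩

theorem Env.setReg {s : State} (h : Env q n k z o L s) (x w : ℕ) (hx : 6 ≤ x) :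
    Env q n k z o L (s.setReg x w) :=
  h.congr fun r hr => by simp [show r ≠ x by omega]

theorem Env.setMem {s : State} (h : Env q n k z o L s) (a i w : ℕ) :
    Env q n k z o L (s.setMem a i w) :=
  h.congr fun _ _ => rfl

theorem Holds.congr {s s' : State} {a x : ℕ} (h : Holds q L s a x) (hs : s'.mem a = s.mem a) :
    Holds q L s' a x :=
  ⟨h.1, hs.trans h.2⟩

theorem Holds.lt {s : State} {a x : ℕ} (hq : 2 ≤ q) (h : Holds q L s a x) (i : ℕ) :
    s.mem a i < q := by
  rw [h.2]
  exact digit_lt (by omega) _ _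

/-- The number in the array `z` becomes `x * q ^ e - y - b`. -/
def subCall (z x y : ℕ) (e : WordExpr) (b : ℕ) : Prog :=
  .seq (.assign 24 e) <| .seq (.assign 21 (const b)) <| subProg z x y

theorem subCall_spec {s : State} {a b x y w X Y W t : ℕ} {e : WordExpr}
    (hB : Bounds B q n k z o L) (hE : Env q n k z o L s) (he : e.Fits B s) (hea : e.eval s = a)
    (ha : a ≤ n + 1) (hb : b ≤ 1) (hwy : w ≠ y) (hwx : w ≠ x) (hx : Holds q L s x X)
    (hy : Holds q L s y Y) (hw : Holds q L s w W) :
    Halts B (subCall w x y e b) t s fun t' s' =>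
      t' ≤ t + (40 * L + e.cost + 20) ∧ (∀ r < 20, s'.reg r = s.reg r) ∧
      (∀ b, b ≠ w → s'.mem b = s.mem b) ∧ s'.reg 21 ≤ 1 ∧ ∃ W', Holds q L s' w W' ∧
      W' + Y + b = X * q ^ a % q ^ L + q ^ L * s'.reg 21 := by
  have hlt := hB.lt
  refine Halts.seq (Halts.assign he (Halts.seq (Halts.assign ?_ ?_)))
  · simp only [Fits]; omega
  apply Halts.mono
  · refine subProg_spec (q := q) (L := L) (a := a) (b₀ := b) (X := X) (Y := Y) (Z := W) ?_ ?_ ?_ ?_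
      hb hB.two_le (by omega) (by have := hB.digits; omega) (by omega) hwy (.inl hwx) hx hy hw
    · simp [hE.reg0]
    · simp [hE.reg5]
    · simp [hea]
    · simp [eval]
  · rintro t' s' ⟨ht, hreg, hmem, hbor, W', hW', heq⟩
    refine ⟨?_, fun r hr => ?_, hmem, hbor, W', hW', heq X ((hmem x hwx.symm).trans hx.2)⟩
    · simp only [cost] at ht
      omega
    · simp [hreg r hr, show r ≠ 24 by omega, show r ≠ 21 by omega]

theorem mulDivProg_spec' {s : State} {a b x y w g h W Y t : ℕ}
    (hB : Bounds B q n k z o L) (hE : Env q n k z o L s) (ha : s.reg 14 = a) (hb : s.reg 15 = b)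
    (han : a ≤ n + 1) (hbn : b ≤ n + 1) (hb0 : 0 < b) (hxw : x ≠ w) (hyw : y ≠ w)
    (hx : Holds q L s x g) (hw : Holds q L s w W) (hy : Holds q L s y Y)
    (hgh : g * (q ^ a - 1) = h * (q ^ b - 1)) (hh : h < q ^ L) :
    Halts B (mulDivProg y x w) t s fun t' s' =>
      t' ≤ t + (80 * L + 30) ∧ (∀ r < 20, s'.reg r = s.reg r) ∧
      (∀ b, b ≠ y → b ≠ w → s'.mem b = s.mem b) ∧ (∃ W', Holds q L s' w W') ∧
      Holds q L s' y h := by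
  have hlt := hB.lt
  have hdig := hB.digits
  exact mulDivProg_spec hE.reg0 hE.reg5 ha hb hB.two_le (by omega) (by omega) (by omega)
    (by omega) hb0 hxw hyw hx hw hy hgh hh

/-- `reg 5` becomes the number of digits. -/
def lengthProg : Prog :=
  .seq (.assign 5 (const 1)) <| .seq (.assign 6 (const 0)) <|
  .loop (reg 6) (reg 2) <|
  .seq (.assign 5 (add (reg 5) (reg 1))) <| .assign 6 (add (reg 6) (const 1))

theorem lengthProg_spec {s : State} {t : ℕ} (hB : Bounds B q n k z o L) (h0 : s.reg 0 = q)
    (h1 : s.reg 1 = n) (h2 : s.reg 2 = k) (h3 : s.reg 3 = z) (h4 : s.reg 4 = o) :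
    Halts B lengthProg t s fun t' s' =>
      t' ≤ t + (20 * k + 10) ∧ Env q n k z o L s' ∧ s'.mem = s.mem := by
  have hlt := hB.lt
  refine Halts.seq (Halts.assign (by simp only [Fits]; omega)
    (Halts.seq (Halts.assign (by simp only [Fits]; omega) ?_)))
  -- The machine has no multiplication, so `n * k + 1` is reached by adding `n` repeatedly.
  refine Halts.loop (fun i s' => s'.reg 5 = n * i + 1 ∧ s'.reg 6 = i ∧
    (∀ r < 5, s'.reg r = s.reg r) ∧ s'.mem = s.mem) k 9 ?_ ?_ ?_ ?_
  · refine ⟨by simp [eval], by simp [eval], fun r hr => ?_, rfl⟩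
    simp [show r ≠ 5 by omega, show r ≠ 6 by omega]
  · rintro i hi s₁ ⟨h5, h6, hreg, hmem⟩
    have h1' : s₁.reg 1 = n := (hreg 1 (by simp)).trans h1
    have h2' : s₁.reg 2 = k := (hreg 2 (by simp)).trans h2
    have hle := hB.le
    have hm : n * (i + 1) ≤ n * k := Nat.mul_le_mul_left n hi
    rw [mul_add, mul_one] at hm
    refine ⟨by simp only [Fits]; omega, by simp only [Fits]; omega, by simp only [eval]; omega,
      fun t₁ => Halts.seq (Halts.assign ?_ (Halts.assign ?_ ⟨?_, ?_⟩))⟩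
    · simp only [Fits, eval, h5, h1']
      omega
    · simp [Fits, eval, h6]
      omega
    · simp only [cost]
      omega
    · refine ⟨?_, by simp [eval, h6], fun r hr => ?_, hmem⟩
      · simp [eval, h5, h1']
        ring
      · simp [show r ≠ 5 by omega, show r ≠ 6 by omega, hreg r hr]
  · rintro s₁ ⟨h5, h6, hreg, hmem⟩
    have h2' : s₁.reg 2 = k := (hreg 2 (by simp)).trans h2
    have hle := hB.le
    exact ⟨by simp only [Fits]; omega, by simp only [Fits]; omega, by simp only [eval]; omega⟩
  · rintro t' s' ht ⟨h5, h6, hreg, hmem⟩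
    refine ⟨?_, ⟨?_, ?_, ?_, ?_, ?_, ?_⟩, hmem⟩
    · simp only [cost] at ht
      omega
    all_goals first | rw [h5, hB.digits] | skip
    · exact (hreg 0 (by simp)).trans h0
    · exact (hreg 1 (by simp)).trans h1
    · exact (hreg 2 (by simp)).trans h2
    · exact (hreg 3 (by simp)).trans h3
    · exact (hreg 4 (by simp)).trans h4

/-- Whether the word `e` is different from the word that stands for `0` in the field. -/
def nonzeroExpr (e : WordExpr) : WordExpr := add (sub e (reg 3)) (sub (reg 3) e)

theorem nonzeroExpr_eval (e : WordExpr) (s : State) : (nonzeroExpr e).eval s =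
    (e.eval s - s.reg 3) + (s.reg 3 - e.eval s) := rfl

theorem nonzeroExpr_fits {e : WordExpr} {s : State} (he : e.Fits B s)
    (h : e.eval s + s.reg 3 < B) : (nonzeroExpr e).Fits B s := by
  have h3 : s.reg 3 < B := by omega
  refine ⟨⟨he, h3⟩, ⟨h3, he⟩, ?_⟩
  simp only [eval]
  omega

/-- The non-leading columns to the left of the column `reg 10` are visited (the leading columns `c`
are those with a non-zero mark in the array `9`). The words in the array `x` that belong to them are
copied to the array `y`, and `reg 16` becomes the first column with a word different from that
of `0`, or `reg 10`. The register `17` counts the columns, and `18` is the current column. The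
addresses are `reg xb + reg xi` and `reg yb + reg yi`, where `xi` and `yi` are `17` or `18`. -/
def scanProg (x xb xi y yb yi : ℕ) : Prog :=
  .seq (.assign 16 (reg 10)) <| .seq (.assign 17 (const 0)) <| .seq (.assign 18 (const 0)) <|
  .loop (reg 18) (reg 10) <|
  .seq (.ite (const 0) (load 9 (reg 18)) .skip <|
    .seq (.ite (reg 16) (reg 10) .skip <|
      .ite (const 0) (nonzeroExpr (load x (add (reg xb) (reg xi)))) (.assign 16 (reg 18)) .skip) <|
    .seq (.store y (add (reg yb) (reg yi)) (load x (add (reg xb) (reg xi)))) <|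
    .assign 17 (add (reg 17) (const 1))) <|
  .assign 18 (add (reg 18) (const 1))

/-- The scan serves both directions. Decoding reads by column and writes by rank, which packs the
free entries of a row into consecutive digits; encoding reads by rank and writes by column. The
functions `f` and `g` are the addresses for reading and writing, and `lead = N` means that only zero
entries were met. -/
theorem scanProg_spec {F : Type*} [Field F] [DecidableEq F] {κ N : ℕ}
    {C : Matrix (Fin κ) (Fin N) F} {s : State} {x xb xi y yb yi t lead : ℕ}
    (hB : Bounds B q n k z o L) (hE : Env q n k z o L s) (hN : s.reg 10 = N) (hNn : N ≤ n)
    (hmark : ∀ c : Fin N, s.mem 9 c ≠ 0 ↔ c ∈ leadCols C) (hmarkB : ∀ c, s.mem 9 c < B)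
    (hxy : x ≠ y) (hy9 : y ≠ 9) (hxb : xb ≠ 16 ∧ xb ≠ 17 ∧ xb ≠ 18)
    (hyb : yb ≠ 16 ∧ yb ≠ 17 ∧ yb ≠ 18) (hxi : xi = 17 ∨ xi = 18) (hyi : yi = 17 ∨ yi = 18)
    (hxbB : s.reg xb + N < B) (hybB : s.reg yb + N < B) {f g : Fin N → ℕ}
    (hf : ∀ c, f c = s.reg xb + if xi = 17 then freeRank C c else c)
    (hg : ∀ c, g c = s.reg yb + if yi = 17 then freeRank C c else c)
    (hxq : ∀ c ∉ leadCols C, s.mem x (f c) < q)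
    (hlead : lead ≤ N) (hlead0 : ∀ c ∉ leadCols C, c < lead → s.mem x (f c) = z)
    (hlead1 : ∀ c : Fin N, (c : ℕ) = lead → c ∉ leadCols C ∧ s.mem x (f c) ≠ z) :
    Halts B (scanProg x xb xi y yb yi) t s fun t' s' =>
      t' ≤ t + (70 * N + 20) ∧ (∀ r < 16, s'.reg r = s.reg r) ∧ s'.reg 19 = s.reg 19 ∧
      (∀ b, b ≠ y → s'.mem b = s.mem b) ∧ s'.reg 16 = lead ∧
      (∀ c ∉ leadCols C, s'.mem y (g c) = s.mem x (f c)) ∧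
      ∀ i, (∀ c ∉ leadCols C, i ≠ g c) → s'.mem y i = s.mem y i := by
  have hlt := hB.lt
  have hzq := hB.zero_lt
  have hrank : ∀ c : Fin N, freeRank C c ≤ c := by
    have : ∀ c ≤ N, freeRank C c ≤ c := by
      intro c
      induction c with
      | zero => simp
      | succ c ih =>
        intro hc
        have := freeRank_succ C ⟨c, hc⟩
        have := ih (by omega)
        simp only at *
        split_ifs at * <;> omega
    exact fun c => this c c.2.le
  -- The addresses for writing increase strictly over the free columns, so that no stored word is
  -- overwritten.
  have hginj : ∀ c ∉ leadCols C, ∀ c' ∉ leadCols C, c < c' → g c < g c' := by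
    intro c hc c' hc' hlt
    rw [hg, hg]
    have h1 := freeRank_succ C c
    rw [if_neg hc] at h1
    have h2 := freeRank_mono C (Nat.succ_le_of_lt (Fin.lt_def.1 hlt))
    rw [Nat.succ_eq_add_one] at h2
    have := Fin.lt_def.1 hlt
    split_ifs <;> omega
  refine Halts.seq (Halts.assign (by simp only [Fits]; omega) <|
    Halts.seq <| Halts.assign (by simp only [Fits]; omega) <|
    Halts.seq <| Halts.assign (by simp only [Fits]; omega) ?_)
  -- Register 16 keeps the value `N` until the column `lead` has been passed, so `N` also serves as
  -- the sign for "not found yet".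
  refine Halts.loop (fun i s' => s'.reg 16 = (if lead < i then lead else N) ∧
      s'.reg 17 = freeRank C i ∧ s'.reg 18 = i ∧
      (∀ r, r ≠ 16 → r ≠ 17 → r ≠ 18 → s'.reg r = s.reg r) ∧
      (∀ b, b ≠ y → s'.mem b = s.mem b) ∧
      (∀ c ∉ leadCols C, (c : ℕ) < i → s'.mem y (g c) = s.mem x (f c)) ∧
      ∀ j, (∀ c ∉ leadCols C, (c : ℕ) < i → j ≠ g c) → s'.mem y j = s.mem y j) N 60 ?_ ?_ ?_ ?_
  · refine ⟨by simp [eval, hN], by simp [eval], by simp [eval], ?_, by simp, by simp, by simp⟩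
    intro r h1 h2 h3
    simp [h1, h2, h3]
  · rintro i hi s₁ ⟨h16, h17, h18, hreg, hmem, hyl, hyg⟩
    set c : Fin N := ⟨i, hi⟩ with hc
    have hci : (c : ℕ) = i := rfl
    have h10 : s₁.reg 10 = N := (hreg 10 (by simp) (by simp) (by simp)).trans hN
    have h3 : s₁.reg 3 = z := (hreg 3 (by simp) (by simp) (by simp)).trans hE.reg3
    have h9 : s₁.mem 9 = s.mem 9 := hmem 9 hy9.symm
    have hmx : s₁.mem x = s.mem x := hmem x hxy
    have hri := hrank c
    rw [hci] at hri
    have hfr := freeRank_succ C c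
    rw [hci] at hfr
    have hfe : (add (reg xb) (reg xi)).eval s₁ = f c := by
      simp only [eval, hf, hreg xb hxb.1 hxb.2.1 hxb.2.2, hci]
      rcases hxi with rfl | rfl
      · simp [h17]
      · simp [h18]
    have hge : ∀ s₂ : State, s₂.reg 17 = s₁.reg 17 → s₂.reg 18 = s₁.reg 18 →
        s₂.reg yb = s₁.reg yb → (add (reg yb) (reg yi)).eval s₂ = g c := by
      intro s₂ e1 e2 e3
      simp only [eval, hg, e3, hreg yb hyb.1 hyb.2.1 hyb.2.2, hci]
      rcases hyi with rfl | rfl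
      · simp [h17, e1]
      · simp [h18, e2]
    have hfB : f c < B := by rw [hf, hci]; split_ifs <;> omega
    have hgB : g c < B := by rw [hg, hci]; split_ifs <;> omega
    have hfits : ∀ s₂ : State, s₂.reg 17 = s₁.reg 17 → s₂.reg 18 = s₁.reg 18 → ∀ b l,
        s₂.reg b = s₁.reg b → (l = 17 ∨ l = 18) → (add (reg b) (reg l)).eval s₂ < B →
        (add (reg b) (reg l)).Fits B s₂ := by
      intro s₂ e1 e2 b l e3 hl h
      simp only [eval] at h
      simp only [Fits, eval]
      omega
    refine ⟨by simp only [Fits]; omega, by simp only [Fits]; omega, by simp only [eval]; omega,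
      fun t₁ => Halts.seq ?_⟩
    have fin : ∀ t₂ s₂, t₂ ≤ t₁ + 52 → s₂.reg 16 = (if lead < i + 1 then lead else N) →
        s₂.reg 17 = freeRank C (i + 1) → s₂.reg 18 = i →
        (∀ r, r ≠ 16 → r ≠ 17 → r ≠ 18 → s₂.reg r = s.reg r) →
        (∀ b, b ≠ y → s₂.mem b = s.mem b) →
        (∀ c ∉ leadCols C, (c : ℕ) < i + 1 → s₂.mem y (g c) = s.mem x (f c)) →
        (∀ j, (∀ c ∉ leadCols C, (c : ℕ) < i + 1 → j ≠ g c) → s₂.mem y j = s.mem y j) →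
        Halts B (.assign 18 (add (reg 18) (const 1))) t₂ s₂ fun t' s' => t' ≤ t₁ + 60 ∧
          s'.reg 16 = (if lead < i + 1 then lead else N) ∧
          s'.reg 17 = freeRank C (i + 1) ∧ s'.reg 18 = i + 1 ∧
          (∀ r, r ≠ 16 → r ≠ 17 → r ≠ 18 → s'.reg r = s.reg r) ∧
          (∀ b, b ≠ y → s'.mem b = s.mem b) ∧
          (∀ c ∉ leadCols C, (c : ℕ) < i + 1 → s'.mem y (g c) = s.mem x (f c)) ∧
          ∀ j, (∀ c ∉ leadCols C, (c : ℕ) < i + 1 → j ≠ g c) → s'.mem y j = s.mem y j := by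
      intro t₂ s₂ ht₂ e16 e17 e18 ereg emem eyl eyg
      refine Halts.assign (by simp only [Fits, eval]; omega) ⟨by simp only [cost]; omega, ?_⟩
      refine ⟨by simp [e16], by simp [e17], by simp [eval, e18], fun r a1 a2 a3 => ?_, emem, eyl,
        eyg⟩
      simp [a3, ereg r a1 a2 a3]
    refine Halts.ite (by simp only [Fits]; omega) ?_ ?_ ?_
    · simp only [Fits, eval, h18, h9]
      exact ⟨by omega, hmarkB _⟩
    · intro hm
      simp only [eval, h18, h9] at hm
      have hcl : c ∈ leadCols C := (hmark c).1 (by rw [hci]; omega)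
      rw [if_pos hcl, add_zero] at hfr
      have hne : i ≠ lead := fun h => (hlead1 c (hci.trans h)).1 hcl
      refine Halts.skip (fin _ _ (by simp only [cost]; omega) ?_ (h17.trans hfr.symm) h18 hreg hmem
        (fun c' hc' hlt => hyl c' hc' ?_) (fun j hj => hyg j fun c' hc' hlt => hj c' hc' ?_))
      · rw [h16]
        congr 1
        simp only [eq_iff_iff]
        omega
      · have : c' ≠ c := fun h => hc' (h ▸ hcl)
        rw [Ne, Fin.ext_iff, hci] at this
        omega
      · omega
    · intro hm
      simp only [eval, h18, h9] at hm
      have hcl : c ∉ leadCols C := fun h => (hmark c).2 h (by rw [hci]; omega)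
      rw [if_neg hcl] at hfr
      have hw := hxq c hcl
      have key : Halts B (.ite (reg 16) (reg 10) .skip <|
          .ite (const 0) (nonzeroExpr (load x (add (reg xb) (reg xi)))) (.assign 16 (reg 18)) .skip)
          (t₁ + ((const 0).cost + (load 9 (reg 18)).cost + 1)) s₁ fun t' s' => t' ≤ t₁ + 30 ∧
            s' = s₁.setReg 16 (if lead < i + 1 then lead else N) := by
        -- Branches without an assignment are described as assignments of the old value, so that all
        -- of them end in a state of the same form.
        have hset : ∀ w, w = s₁.reg 16 → s₁ = s₁.setReg 16 w := by
          rintro w rfl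
          simp [State.setReg]
        refine Halts.ite (by simp only [Fits]; split_ifs at h16 <;> omega)
          (by simp only [Fits]; omega) (fun h => ?_) (fun h => ?_)
        · simp only [eval, h16, h10] at h
          refine Halts.skip ⟨by simp only [cost]; omega, hset _ ?_⟩
          rw [h16]
          split_ifs at * <;> omega
        · simp only [eval, h16, h10] at h
          have hle : ¬ lead < i ∨ lead = N := by
            split_ifs at h <;> omega
          have hle : i ≤ lead := by omega
          refine Halts.ite (by simp only [Fits]; omega) ?_ (fun h' => ?_) (fun h' => ?_)
          · refine nonzeroExpr_fits ⟨hfits s₁ rfl rfl xb xi rfl hxi (by rw [hfe]; exact hfB), ?_⟩ ?_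
            · rw [hfe, hmx]
              omega
            · rw [eval, hfe, hmx, h3]
              omega
          · rw [nonzeroExpr_eval, eval, eval, hfe, hmx, h3] at h'
            have : i = lead := by
              by_contra hne
              have := hlead0 c hcl (by omega)
              omega
            refine Halts.assign (by simp only [Fits]; omega) ⟨?_, ?_⟩
            · simp only [nonzeroExpr, cost]; omega
            · rw [if_pos (by omega), eval, h18, this]
          · rw [nonzeroExpr_eval, eval, eval, hfe, hmx, h3] at h'
            refine Halts.skip ⟨by simp only [nonzeroExpr, cost]; omega, hset _ ?_⟩
            have : i ≠ lead := fun h => (hlead1 c (hci.trans h)).2 (by omega)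
            rw [h16]
            split_ifs <;> omega
      refine Halts.seq (key.mono ?_)
      rintro t₂ _ ⟨ht₂, rfl⟩
      have hge' := hge (s₁.setReg 16 (if lead < i + 1 then lead else N)) (by simp) (by simp)
        (by simp [hyb.1])
      have hfe' : (add (reg xb) (reg xi)).eval
          (s₁.setReg 16 (if lead < i + 1 then lead else N)) = f c := by
        rw [← hfe]
        rcases hxi with rfl | rfl <;> simp [eval, hxb.1]
      refine Halts.seq (Halts.store ?_ ?_ (Halts.assign ?_ ?_))
      · exact hfits _ (by simp) (by simp) yb yi (by simp [hyb.1]) hyi (by rw [hge']; exact hgB)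
      · refine ⟨hfits _ (by simp) (by simp) xb xi (by simp [hxb.1]) hxi
          (by rw [hfe']; exact hfB), ?_⟩
        rw [hfe', State.setReg_mem, hmx]
        omega
      · simp [Fits, eval, h17]
        omega
      · rw [hge', eval, hfe']
        refine fin _ _ (by simp only [cost]; omega) (by simp) (by simp [eval, h17, hfr])
          (by simp [h18]) (fun r a1 a2 a3 => by simp [a1, a2, hreg r a1 a2 a3])
          (fun b hb => by simp [hb, hmem b hb]) (fun c' hc' hlt => ?_) (fun j hj => ?_)
        · simp only [State.setReg_mem, State.setMem_mem_self, hmx]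
          rcases lt_trichotomy c' c with h | rfl | h
          · rw [if_neg (hginj c' hc' c hcl h).ne]
            exact hyl c' hc' h
          · rw [if_pos rfl]
          · have := Fin.lt_def.1 h
            omega
        · simp only [State.setReg_mem, State.setMem_mem_self]
          rw [if_neg (hj c hcl (by omega))]
          exact hyg j fun c' hc' hlt => hj c' hc' (by omega)
  · rintro s₁ ⟨h16, h17, h18, hreg, -⟩
    have h10 : s₁.reg 10 = N := (hreg 10 (by simp) (by simp) (by simp)).trans hN
    exact ⟨by simp only [Fits]; omega, by simp only [Fits]; omega, by simp only [eval]; omega⟩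
  · rintro t' s' ht ⟨h16, h17, h18, hreg, hmem, hyl, hyg⟩
    refine ⟨?_, fun r hr => hreg r (by omega) (by omega) (by omega),
      hreg 19 (by simp) (by simp) (by simp), hmem, ?_,
      fun c hc => hyl c hc c.2, fun i hi => hyg i fun c hc _ => hi c hc⟩
    · simp only [cost] at ht
      omega
    · rw [h16]
      split_ifs <;> omega

end Environment

end GrassGray

namespace GrassGray

open WordExpr

/-! ### The decoding program -/

section Decoding

/-- The coefficient in the row above is eliminated from the two identities of
`gaussRec_mul_pow_sub_one`. This neighbour supplies the summand `gaussRec q n (k + 1)` of the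
decoding formula. -/
theorem gaussRec_succ_right {q : ℕ} (hq : 0 < q) {n k : ℕ} (h : k ≤ n) :
    gaussRec q n k * (q ^ (n - k) - 1) = gaussRec q n (k + 1) * (q ^ (k + 1) - 1) := by
  rcases h.eq_or_lt with rfl | h
  · simp [gaussRec_eq_zero]
  · obtain ⟨n, rfl⟩ := Nat.exists_eq_succ_of_ne_zero (n := n) (by omega)
    rw [Nat.succ_eq_add_one, (gaussRec_mul_pow_sub_one hq (n := n) (k := k + 1) (by omega)).2 k rfl,
      (gaussRec_mul_pow_sub_one hq (n := n) (k := k) h.le).1]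

theorem digit_shift_add {q s a D : ℕ} (hs : s < q ^ a) (j : ℕ) :
    digit q (q ^ a * D + s) j = if j < a then digit q s j else digit q D (j - a) := by
  split_ifs with h
  · rw [← digit_mod_pow h, Nat.mul_add_mod, Nat.mod_eq_of_lt hs]
  · obtain ⟨d, rfl⟩ := Nat.exists_eq_add_of_le (not_lt.1 h)
    rw [← digit_div_pow, Nat.add_sub_cancel_left, Nat.mul_add_div (by omega),
      Nat.div_eq_of_lt hs, add_zero]

theorem isLead_dropLast {F : Type*} [Field F] {k n : ℕ} {M : Matrix (Fin k) (Fin (n + 1)) F}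
    {r : Fin k} {c : Fin n} : IsLead (dropLast M) r c ↔ IsLead M r c.castSucc := by
  refine and_congr_right fun _ => ⟨fun h c' hc' => ?_, fun h c' hc' => ?_⟩
  · induction c' using Fin.lastCases with
    | last => exact absurd hc' (not_lt.2 (Fin.castSucc_lt_last c).le)
    | cast c' => exact h c' (by simpa using hc')
  · exact h c'.castSucc (by simpa using hc')

theorem isTrail_dropLast {F : Type*} [Field F] {k n : ℕ} {M : Matrix (Fin k) (Fin (n + 1)) F}
    {r : Fin k} {c : Fin n} (h0 : M r (Fin.last n) = 0) :
    IsTrail (dropLast M) r c ↔ IsTrail M r c.castSucc := by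
  refine and_congr_right fun _ => ⟨fun h c' hc' => ?_, fun h c' hc' => ?_⟩
  · induction c' using Fin.lastCases with
    | last => exact h0
    | cast c' => exact h c' (by simpa using hc')
  · exact h c'.castSucc (by simpa using hc')

/-- The base address plus one of each row of the matrix in the array `0` is stored in the array
`10`, under the column of the last non-zero coefficient of the row. -/
def trailProg : Prog :=
  .seq (.assign 10 (const 0)) <| .seq (.assign 13 (const 0)) <|
  .loop (reg 10) (reg 2) <|
  .seq (.assign 18 (const 0)) <|
  .seq (.loop (reg 18) (reg 1) <|
    .seq (.ite (const 0) (nonzeroExpr (load 0 (add (reg 13) (reg 18)))) (.assign 16 (reg 18)) .skip)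
      (.assign 18 (add (reg 18) (const 1)))) <|
  .seq (.store 10 (reg 16) (add (reg 13) (const 1))) <|
  .seq (.assign 13 (add (reg 13) (reg 1))) <| .assign 10 (add (reg 10) (const 1))

/-- One pass over the matrix makes the row that ends in a given column available in constant time
afterwards. The offset one reserves the word 0 for columns in which no row ends. -/
theorem trailProg_spec {B q n k z o L t : ℕ} {s : State} {p : ℕ → ℕ}
    (hB : Bounds B q n k z o L) (hE : Env q n k z o L s) (hX : ∀ i, s.mem 0 i < q)
    (hp : ∀ r < k, p r < n) (hinj : ∀ r < k, ∀ r' < k, p r = p r' → r = r')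
    (hne : ∀ r < k, s.mem 0 (n * r + p r) ≠ z)
    (hz : ∀ r < k, ∀ c < n, p r < c → s.mem 0 (n * r + c) = z) (h10 : ∀ i, s.mem 10 i = 0) :
    Halts B trailProg t s fun t' s' =>
      t' ≤ t + (k * (60 * n + 60) + 20) ∧ Env q n k z o L s' ∧
      (∀ b, b ≠ 10 → s'.mem b = s.mem b) ∧ (∀ r < k, s'.mem 10 (p r) = n * r + 1) ∧
      ∀ i, (∀ r < k, i ≠ p r) → s'.mem 10 i = 0 := by
  have hlt := hB.lt
  have hle := hB.le
  have hzq := hB.zero_lt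
  refine Halts.seq (Halts.assign (by simp only [Fits]; omega) <|
    Halts.seq <| Halts.assign (by simp only [Fits]; omega) ?_)
  refine Halts.loop (fun i s' => s'.reg 10 = i ∧ s'.reg 13 = n * i ∧ Env q n k z o L s' ∧
    (∀ b, b ≠ 10 → s'.mem b = s.mem b) ∧
    (∀ r < i, s'.mem 10 (p r) = n * r + 1) ∧
    ∀ j, (∀ r < i, j ≠ p r) → s'.mem 10 j = 0) k (n * 50 + 40) ?_ ?_ ?_ ?_
  · refine ⟨by simp [eval], by simp [eval], (hE.setReg _ _ (by simp)).setReg _ _ (by simp),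
      by simp, by simp, fun j _ => h10 j⟩
  · rintro i hi s₁ ⟨e10, e13, hE₁, hmem, htr, htr0⟩
    have e2 := hE₁.reg2
    have e1 := hE₁.reg1
    have e0 : s₁.mem 0 = s.mem 0 := hmem 0 (by simp)
    have hni : n * (i + 1) ≤ n * k := Nat.mul_le_mul_left n hi
    rw [mul_add, mul_one] at hni
    have hpi := hp i hi
    refine ⟨by simp only [Fits]; omega, by simp only [Fits]; omega, by simp only [eval]; omega,
      fun t₁ => Halts.seq (Halts.assign (by simp only [Fits]; omega) (Halts.seq ?_))⟩
    -- Register 16 is overwritten at each non-zero entry. Its value is controlled only from `p i`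
    -- on, after which no further overwriting takes place.
    refine Halts.loop (fun c s' => s'.reg 18 = c ∧ (p i < c → s'.reg 16 = p i) ∧
      (∀ r, r ≠ 16 → r ≠ 18 → s'.reg r = s₁.reg r) ∧ s'.mem = s₁.mem) n 30 ?_ ?_ ?_ ?_
    · refine ⟨by simp [eval], by simp, fun r h16 h18 => by simp [h18], rfl⟩
    · rintro c hc s₂ ⟨e18, e16, hreg₂, hmem₂⟩
      have f1 : s₂.reg 1 = n := (hreg₂ 1 (by simp) (by simp)).trans e1
      have f3 : s₂.reg 3 = z := (hreg₂ 3 (by simp) (by simp)).trans hE₁.reg3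
      have f13 : s₂.reg 13 = n * i := (hreg₂ 13 (by simp) (by simp)).trans e13
      have hw : (load 0 (add (reg 13) (reg 18))).eval s₂ = s.mem 0 (n * i + c) := by
        simp only [eval, f13, e18, hmem₂, e0]
      have hwq := hX (n * i + c)
      refine ⟨by simp only [Fits]; omega, by simp only [Fits]; omega, by simp only [eval]; omega,
        fun t₂ => Halts.seq (Halts.ite (by simp only [Fits]; omega) ?_ (fun h => ?_) fun h => ?_)⟩
      · refine nonzeroExpr_fits ⟨by simp only [Fits, eval]; omega, ?_⟩ (by rw [hw]; omega)
        rw [eval] at hw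
        rw [hw]
        omega
      · rw [nonzeroExpr_eval, hw, f3, eval] at h
        refine Halts.assign (by simp only [Fits]; omega) (Halts.assign ?_
          ⟨by simp only [nonzeroExpr, cost]; omega, ?_⟩)
        · simp [Fits, eval, e18]
          omega
        · refine ⟨by simp [eval, e18], fun hpc => ?_, fun r h1 h2 => ?_, hmem₂⟩
          · have : ¬ p i < c := fun hpc' => by
              have := hz i hi c hc hpc'
              omega
            simp [eval, e18]
            omega
          · simp [h1, h2, hreg₂]
      · rw [nonzeroExpr_eval, hw, f3, eval] at h
        refine Halts.skip (Halts.assign (by simp only [Fits, eval]; omega)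
          ⟨by simp only [nonzeroExpr, cost]; omega, ?_⟩)
        refine ⟨by simp [eval, e18], fun hpc => ?_, fun r h1 h2 => ?_, hmem₂⟩
        · have : p i ≠ c := fun hpc' => by
            have := hne i hi
            rw [hpc'] at this
            omega
          simp only [State.setReg_reg]
          rw [if_neg (by simp), e16 (by omega)]
        · simp [h2, hreg₂ r h1 h2]
    · rintro s₂ ⟨e18, e16, hreg₂, hmem₂⟩
      have f1 : s₂.reg 1 = n := (hreg₂ 1 (by simp) (by simp)).trans e1
      exact ⟨by simp only [Fits]; omega, by simp only [Fits]; omega, by simp only [eval]; omega⟩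
    · rintro t₂ s₂ ht₂ ⟨e18, e16, hreg₂, hmem₂⟩
      have f1 : s₂.reg 1 = n := (hreg₂ 1 (by simp) (by simp)).trans e1
      have f10 : s₂.reg 10 = i := (hreg₂ 10 (by simp) (by simp)).trans e10
      have f13 : s₂.reg 13 = n * i := (hreg₂ 13 (by simp) (by simp)).trans e13
      have f16 := e16 hpi
      refine Halts.seq (Halts.store ?_ ?_ (Halts.seq (Halts.assign ?_ (Halts.assign ?_ ⟨?_, ?_⟩))))
      · simp only [Fits]; omega
      · simp only [Fits, eval]; omega
      · simp only [Fits, eval, State.setMem_reg]; omega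
      · simp [Fits, eval, f10]; omega
      · simp only [cost] at *
        omega
      · refine ⟨by simp [eval, f10], ?_, ?_, ?_, ?_, ?_⟩
        · simp [eval, f13, f1]
          ring
        · refine Env.setReg (Env.setReg (Env.setMem ?_ _ _ _) _ _ (by simp)) _ _ (by simp)
          exact hE₁.congr fun r hr => hreg₂ r (by omega) (by omega)
        · intro b hb
          simp [hb, hmem₂, hmem]
        · intro r hr
          simp only [State.setReg_mem, State.setMem_mem_self, eval, f16, f13, hmem₂]
          rcases Nat.lt_succ_iff_lt_or_eq.1 hr with hr | rfl
          · rw [if_neg, htr r hr]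
            intro h
            have := hinj r (by omega) i hi h
            omega
          · simp
        · intro j hj
          simp only [State.setReg_mem, State.setMem_mem_self, eval, f16, hmem₂]
          rw [if_neg (hj i (by omega))]
          exact htr0 j fun r hr => hj r (by omega)
  · rintro s₁ ⟨e10, e13, hE₁, -⟩
    have e2 := hE₁.reg2
    exact ⟨by simp only [Fits]; omega, by simp only [Fits]; omega, by simp only [eval]; omega⟩
  · rintro t' s' ht ⟨e10, e13, hE₁, hmem, htr, htr0⟩
    refine ⟨?_, hE₁, hmem, htr, htr0⟩
    simp only [cost] at ht
    have h1 : k * (n * 50 + 40 + (1 + 1 + 1)) ≤ k * (60 * n + 60) :=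
      Nat.mul_le_mul_left _ (by omega)
    omega

/-- One step of the decoding: the column `reg 10` is appended to the matrix with `reg 11` rows whose
number is in the array `1`, and whose Gaussian coefficient is in the array `2`. -/
def decodeStep : Prog :=
  .seq (.ite (const 0) (load 10 (reg 10))
    (.seq (.assign 13 (sub (load 10 (reg 10)) (const 1))) <|
    .seq (.assign 14 (sub (reg 10) (reg 11))) <|
    .seq (subCall 3 1 8 (reg 14) 0) <|
    .seq (scanProg 0 13 18 3 19 17) <|
    .seq (.assign 15 (add (reg 11) (const 1))) <|
    .seq (mulDivProg 4 2 12) <|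
    .seq (.assign 14 (add (reg 10) (const 1))) <|
    .seq (mulDivProg 2 2 12) <|
    .seq (subCall 6 3 8 (const 0) 1) <|
    .seq (.ite (const 0) (reg 21) (subCall 1 2 8 (const 0) 1)
      (.seq (subCall 7 8 4 (const 0) 0) (subCall 1 6 7 (const 0) 0))) <|
    .seq (.store 9 (reg 16) (const 1)) <|
    .assign 11 (add (reg 11) (const 1)))
    (.seq (.assign 14 (add (reg 10) (const 1))) <|
    .seq (.assign 15 (sub (add (reg 10) (const 1)) (reg 11))) <|
    mulDivProg 2 2 12)) <|
  .assign 10 (add (reg 10) (const 1))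

variable {F : Type*} [Field F] [DecidableEq F] [Fintype F] (α : Fin (Fintype.card F) ≃ F)

local notation "qF" => Fintype.card F

/-- The rows of the matrix `X` are stored in `x` at the addresses `base r`, and `tr` points to the
rows whose last non-zero coefficients are in the given columns. -/
structure IsStored (n k : ℕ) (x tr : ℕ → ℕ) {κ N : ℕ} (X : Matrix (Fin κ) (Fin N) F)
    (base : Fin κ → ℕ) : Prop where
  echelon : Echelon X
  trailInj : TrailInj X
  base_le : ∀ r, base r + N ≤ n * k
  entry : ∀ r (c : Fin N), x (base r + c) = α.symm (X r c)
  trail : ∀ r (c : Fin N), IsTrail X r c → tr c = base r + 1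
  exists_trail : ∀ c : Fin N, tr c ≠ 0 → ∃ r, IsTrail X r c

/-- The state of the decoding program, if the matrix `X` has been decoded. -/
structure DecodeState (n k L : ℕ) (x tr : ℕ → ℕ) {κ N : ℕ} (X : Matrix (Fin κ) (Fin N) F)
    (s : State) : Prop where
  env : Env qF n k (α.symm 0) (α.symm 1) L s
  reg10 : s.reg 10 = N
  reg11 : s.reg 11 = κ
  reg19 : s.reg 19 = 0
  result : Holds qF L s 1 (decode α X)
  gauss : Holds qF L s 2 (gaussRec qF N κ)
  tmp3 : ∃ w, Holds qF L s 3 w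
  tmp4 : ∃ w, Holds qF L s 4 w
  tmp6 : ∃ w, Holds qF L s 6 w
  tmp7 : ∃ w, Holds qF L s 7 w
  tmp12 : ∃ w, Holds qF L s 12 w
  zero : Holds qF L s 8 0
  input : s.mem 0 = x
  trail : s.mem 10 = tr
  mark : ∀ c : Fin N, s.mem 9 c ≠ 0 ↔ c ∈ leadCols X
  mark_zero : ∀ c, N ≤ c → s.mem 9 c = 0
  mark_le : ∀ c, s.mem 9 c ≤ 1

variable {α}

/-- The deletion of a row and a column leaves the stored words where they are; only the table of
base addresses is reindexed. -/
theorem IsStored.of_row {n k : ℕ} {x tr : ℕ → ℕ} {κ N : ℕ}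
    {X : Matrix (Fin (κ + 1)) (Fin (N + 1)) F} {base : Fin (κ + 1) → ℕ}
    (h : IsStored α n k x tr X base) {i : Fin (κ + 1)} (hr : ∀ r ≠ i, X r (Fin.last N) = 0)
    (hi : X i (Fin.last N) ≠ 0) :
    IsStored α n k x tr (dropLast (deleteRow i X)) fun r => base (i.succAbove r) where
  echelon := echelon_dropLast_deleteRow h.echelon hr
  trailInj := by
    have := h.trailInj.deleteRow i
    rwa [← appendZero_dropLast (M := deleteRow i X) fun r => hr _ (Fin.succAbove_ne i r),
      trailInj_appendZero_iff] at this
  base_le r := by have := h.base_le (i.succAbove r); omega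
  entry r c := h.entry (i.succAbove r) c.castSucc
  trail r c hc := h.trail (i.succAbove r) c.castSucc
    ((isTrail_dropLast (M := deleteRow i X) (hr _ (Fin.succAbove_ne i r))).1 hc)
  exists_trail c hc := by
    obtain ⟨r, hrc⟩ := h.exists_trail c.castSucc hc
    have hri : r ≠ i := by
      rintro rfl
      exact (Fin.castSucc_lt_last c).ne (hrc.unique (isTrail_last hi))
    obtain ⟨r, rfl⟩ := Fin.exists_succAbove_eq hri
    exact ⟨r, (isTrail_dropLast (M := deleteRow i X) (hr _ hri)).2 hrc⟩

theorem IsStored.of_col {n k : ℕ} {x tr : ℕ → ℕ} {κ N : ℕ}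
    {X : Matrix (Fin κ) (Fin (N + 1)) F} {base : Fin κ → ℕ}
    (h : IsStored α n k x tr X base) (h0 : ∀ r, X r (Fin.last N) = 0) :
    IsStored α n k x tr (dropLast X) base where
  echelon := echelon_dropLast h.echelon h0
  trailInj := by
    have := h.trailInj
    rwa [← appendZero_dropLast h0, trailInj_appendZero_iff] at this
  base_le r := by have := h.base_le r; omega
  entry r c := h.entry r c.castSucc
  trail r c hc := h.trail r c.castSucc ((isTrail_dropLast (h0 r)).1 hc)
  exists_trail c hc := by
    obtain ⟨r, hrc⟩ := h.exists_trail c.castSucc hc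
    exact ⟨r, (isTrail_dropLast (h0 r)).2 hrc⟩

end Decoding

end GrassGray

namespace GrassGray

open WordExpr

/-! ### Correctness and cost of one decoding step -/

section DecodeStep

variable {F : Type*} [Field F] [DecidableEq F] [Fintype F] {α : Fin (Fintype.card F) ≃ F}

local notation "qF" => Fintype.card F

/-- A zero column does not change the number. Only the coefficient is updated, by the factor
(q^(N+1) - 1) / (q^(N+1-κ) - 1). -/
theorem decodeStep_col {B n k L κ N t : ℕ} {x tr : ℕ → ℕ}
    (hB : Bounds B qF n k (α.symm 0) (α.symm 1) L) {X : Matrix (Fin κ) (Fin (N + 1)) F}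
    {base : Fin κ → ℕ} (hX : IsStored α n k x tr X base) (hN : N < n) (hκ : κ ≤ k)
    (h0 : ∀ r, X r (Fin.last N) = 0) {s : State} (hs : DecodeState α n k L x tr (dropLast X) s) :
    Halts B decodeStep t s fun t' s' => t' ≤ t + (800 * L + 800) ∧ DecodeState α n k L x tr X s' := by
  have hlt := hB.lt
  have hdig := hB.digits
  have hκN := (echelon_dropLast hX.echelon h0).le
  have htr : tr N = 0 := by
    by_contra hne
    obtain ⟨r, hr⟩ := hX.exists_trail (Fin.last N) (by simpa using hne)
    exact hr.1 (h0 r)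
  have e10 := hs.reg10
  have e11 := hs.reg11
  obtain ⟨w12, h12⟩ := hs.tmp12
  refine Halts.seq (Halts.ite (by simp only [Fits]; omega) ?_ (fun h => ?_) fun _ => ?_)
  · simp only [Fits, eval, hs.trail, e10, htr]
    omega
  · simp [eval, hs.trail, e10, htr] at h
  · refine Halts.seq (Halts.assign (by simp only [Fits, eval]; omega)
      (Halts.seq (Halts.assign ?_ (Halts.mono (mulDivProg_spec' (a := N + 1) (b := N + 1 - κ)
        (g := gaussRec qF N κ) (h := gaussRec qF (N + 1) κ) hB
        ((hs.env.setReg _ _ (by simp)).setReg _ _ (by simp)) (by simp [eval, e10])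
        (by simp [eval, e10, e11]) (by omega) (by omega) (by omega) (by simp) (by simp)
        (by exact hs.gauss) (by exact h12) (by exact hs.gauss)
        (gaussRec_mul_pow_sub_one (by have := hB.two_le; omega) (by omega)).1
        (by rw [hdig]; exact gaussRec_lt_pow hB.two_le (by omega) hκ)) ?_))))
    · simp [Fits, eval, e10, e11]
      omega
    · rintro t₁ s₁ ⟨ht₁, hreg, hmem, ⟨w, hw⟩, hg⟩
      simp only [State.setReg_mem] at hmem
      have f : ∀ r < 14, s₁.reg r = s.reg r := fun r hr => by
        rw [hreg r (by omega)]
        simp [show r ≠ 14 by omega, show r ≠ 15 by omega]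
      have f10 : s₁.reg 10 = N := by rw [f 10 (by simp), e10]
      refine Halts.assign (by simp only [Fits, eval]; omega) ⟨by simp only [cost] at *; omega, ?_⟩
      have tmp : ∀ a, a ≠ 2 → a ≠ 12 → ∀ y, Holds qF L s a y →
          Holds qF L (s₁.setReg 10 (eval s₁ ((reg 10).add (const 1)))) a y :=
        fun a h1 h2 y hy => hy.congr (hmem a h1 h2)
      have m9 : s₁.mem 9 = s.mem 9 := hmem 9 (by simp) (by simp)
      have hlead0 : ∀ r, ¬ IsLead X r (Fin.last N) := fun r hr => hr.1 (h0 r)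
      exact {
        env := (hs.env.congr fun r hr => f r (by omega)).setReg _ _ (by simp)
        reg10 := by simp [eval, f10]
        reg11 := by simp [f 11 (by simp), e11]
        reg19 := by
          have := hreg 19 (by simp)
          simp at this
          simp [this, hs.reg19]
        result := by
          rw [decode_of_col α hX.echelon h0]
          exact tmp 1 (by simp) (by simp) _ hs.result
        gauss := hg
        tmp3 := hs.tmp3.imp (tmp 3 (by simp) (by simp))
        tmp4 := hs.tmp4.imp (tmp 4 (by simp) (by simp))
        tmp6 := hs.tmp6.imp (tmp 6 (by simp) (by simp))
        tmp7 := hs.tmp7.imp (tmp 7 (by simp) (by simp))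
        tmp12 := ⟨w, hw⟩
        zero := tmp 8 (by simp) (by simp) _ hs.zero
        input := (hmem 0 (by simp) (by simp)).trans hs.input
        trail := (hmem 10 (by simp) (by simp)).trans hs.trail
        mark := fun c => by
          rw [State.setReg_mem, m9, mem_leadCols]
          induction c using Fin.lastCases with
          | last => simp [hs.mark_zero, hlead0]
          | cast c => simpa [isLead_dropLast] using hs.mark c
        mark_zero := fun c hc => by
          rw [State.setReg_mem, m9]
          exact hs.mark_zero c (by omega)
        mark_le := fun c => by
          rw [State.setReg_mem, m9]
          exact hs.mark_le c }

theorem borrow_eq_zero {P Z X b : ℕ} (h : Z = X + P * b) (hZ : Z < P) : b = 0 := by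
  by_contra hb
  have := Nat.mul_le_mul_left P (Nat.one_le_iff_ne_zero.2 hb)
  omega

/-- The result of the combination of the two differences `V = T - 1` and `A + V` in `decodeStep`. -/
theorem add_of_sub_eqs {P A V W D b c : ℕ} (hb : b ≤ 1) (hc : c ≤ 1) (hAV : A + V < P)
    (hD : D < P) (h1 : W + A = P * b) (h2 : D + W = V + P * c) : D = A + V := by
  interval_cases b <;> interval_cases c <;> omega

/-- The number D of the smaller matrix is shifted by N - κ places, and the digits of the row fill
the vacated low cells, which yields T. Then T - 1 is computed: a borrow reveals T = 0, where the
result is the new coefficient minus one; otherwise `gaussRec` N (κ + 1), found from the neighbouring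
coefficient, is added. -/
theorem decodeStep_row {B n k L κ N t : ℕ} {x tr : ℕ → ℕ}
    (hB : Bounds B qF n k (α.symm 0) (α.symm 1) L) (hx : ∀ i, x i < qF)
    {X : Matrix (Fin (κ + 1)) (Fin (N + 1)) F}
    {base : Fin (κ + 1) → ℕ} (hX : IsStored α n k x tr X base) (hN : N < n) (hκ : κ < k)
    {i : Fin (κ + 1)} (hr : ∀ r ≠ i, X r (Fin.last N) = 0) (hi : X i (Fin.last N) ≠ 0) {s : State}
    (hs : DecodeState α n k L x tr (dropLast (deleteRow i X)) s) :
    Halts B decodeStep t s fun t' s' => t' ≤ t + (800 * L + 800) ∧ DecodeState α n k L x tr X s' := by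
  have hlt := hB.lt
  have hdig := hB.digits
  have hq := hB.two_le
  have hk := hB.one_le
  have hnk : n * 1 ≤ n * k := Nat.mul_le_mul_left n hk
  have htr : tr N = base i + 1 := hX.trail i (Fin.last N) (isTrail_last hi)
  have hbase := hX.base_le i
  have hdec := decode_of_row α hX.echelon hi hr rfl
  obtain ⟨p, hp, hpl⟩ := hX.echelon
  have hpi := hpl i
  have hlead_eq : ∀ r c, IsLead X r c → c = p i → r = i := fun r c h1 h2 =>
    hX.echelon.isLead_inj (h2 ▸ h1) hpi
  have hleadC : ∀ c : Fin N, c ∈ leadCols (dropLast (deleteRow i X)) ↔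
      ∃ r, r ≠ i ∧ IsLead X r c.castSucc := fun c => by
    rw [mem_leadCols]
    constructor
    · rintro ⟨r, h⟩
      exact ⟨_, Fin.succAbove_ne i r, (isLead_dropLast (M := deleteRow i X)).1 h⟩
    · rintro ⟨r, hri, h⟩
      obtain ⟨r, rfl⟩ := Fin.exists_succAbove_eq hri
      exact ⟨r, (isLead_dropLast (M := deleteRow i X)).2 h⟩
  have hC := echelon_dropLast_deleteRow hX.echelon hr
  set C := dropLast (deleteRow i X) with hCdef
  have hκN := hC.le
  have e10 := hs.reg10
  have e11 := hs.reg11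
  obtain ⟨w3, h3⟩ := hs.tmp3
  obtain ⟨w4, h4⟩ := hs.tmp4
  obtain ⟨w6, h6⟩ := hs.tmp6
  obtain ⟨w7, h7⟩ := hs.tmp7
  obtain ⟨w12, h12⟩ := hs.tmp12
  have hs_lt := rowValue_lt α hC (X i)
  have hD_lt := decode_lt α hC
  set S := rowValue α C (X i) with hS
  set D := decode α C with hD
  have hH : gaussRec qF (N + 1) (κ + 1) < qF ^ L := by
    rw [hdig]
    exact gaussRec_lt_pow hq hN hκ
  have hH0 : 0 < gaussRec qF (N + 1) (κ + 1) := gaussRec_pos (by omega) (by omega)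
  have hsucc := gaussRec_succ_succ qF N κ
  have hTN : qF ^ (N - κ) * D + S < qF ^ (N - κ) * gaussRec qF N κ := by
    have := Nat.mul_le_mul_left (qF ^ (N - κ)) hD_lt
    rw [Nat.succ_eq_add_one, mul_add, mul_one] at this
    omega
  refine Halts.seq (Halts.ite (by simp only [Fits]; omega) ?_ (fun _ => ?_) fun h => ?_)
  · simp only [Fits, eval, hs.trail, e10, htr]
    omega
  · refine Halts.seq (Halts.assign (by simp only [Fits, eval, e10, hs.trail, htr]; omega) ?_)
    have v13 : eval s ((load 10 (reg 10)).sub (const 1)) = base i := by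
      simp [eval, e10, hs.trail, htr]
    rw [v13]
    refine Halts.seq (Halts.assign (by simp [Fits, e10, e11]; omega) ?_)
    have v14 : eval (s.setReg 13 (base i)) ((reg 10).sub (reg 11)) = N - κ := by
      simp [eval, e10, e11]
    rw [v14]
    have hE₀ := (hs.env.setReg 13 (base i) (by simp)).setReg 14 (N - κ) (by simp)
    refine Halts.seq (Halts.mono (subCall_spec (a := N - κ) hB hE₀ (by simp [Fits]; omega)
      (by simp [eval]) (by omega) (by simp) (by simp) (by simp) (by exact hs.result)
      (by exact hs.zero) (by exact h3)) ?_)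
    rintro t₁ s₁ ⟨ht₁, hreg₁, hmem₁, hbor₁, W₁, hW₁, heq₁⟩
    simp only [State.setReg_mem] at hmem₁
    -- No digit is lost by the shift, because even T is bounded by a summand of the next Gaussian
    -- coefficient.
    have hDlt : D * qF ^ (N - κ) < qF ^ L := by
      rw [mul_comm]
      omega
    rw [add_zero, add_zero, Nat.mod_eq_of_lt hDlt] at heq₁
    rw [borrow_eq_zero heq₁ hW₁.1, mul_zero, add_zero] at heq₁
    subst heq₁
    have hE₁ := hE₀.congr fun r hr => hreg₁ r (by omega)
    have r10 : s₁.reg 10 = N := by rw [hreg₁ 10 (by simp)]; simp [e10]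
    have r11 : s₁.reg 11 = κ := by rw [hreg₁ 11 (by simp)]; simp [e11]
    have r13 : s₁.reg 13 = base i := by rw [hreg₁ 13 (by simp)]; simp
    have r14 : s₁.reg 14 = N - κ := by rw [hreg₁ 14 (by simp)]; simp
    have r19 : s₁.reg 19 = 0 := by rw [hreg₁ 19 (by simp)]; simp [hs.reg19]
    have m9 : s₁.mem 9 = s.mem 9 := hmem₁ 9 (by simp)
    have m0 : s₁.mem 0 = x := (hmem₁ 0 (by simp)).trans hs.input
    have entry : ∀ c : Fin N, s₁.mem 0 (base i + c) = α.symm (X i c.castSucc) := fun c => by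
      rw [m0]
      exact hX.entry i c.castSucc
    refine Halts.seq (Halts.mono (scanProg_spec (C := C) (lead := p i) (f := fun c => base i + c)
      (g := fun c => freeRank C c) hB hE₁ r10 hN.le (by rw [m9]; exact hs.mark)
      (fun c => by rw [m9]; have := hs.mark_le c; omega) (by simp) (by simp) (by simp) (by simp)
      (by simp) (by simp) (by omega) (by omega) (by simp [r13]) (by simp [r19])
      (fun c _ => by rw [m0]; exact hx _) (Nat.lt_succ_iff.1 (p i).2) ?_ ?_) ?_)
    · intro c hc hlt
      rw [entry, hpi.2 c.castSucc (by simpa [Fin.lt_def] using hlt)]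
    · intro c hc
      have hpc : c.castSucc = p i := Fin.ext hc
      refine ⟨fun hcl => ?_, ?_⟩
      · obtain ⟨r, hri, hrl⟩ := (hleadC c).1 hcl
        exact hri (hlead_eq r _ hrl hpc)
      · rw [entry, hpc]
        intro h
        exact hpi.1 (α.symm.injective (Fin.ext h))
    rintro t₂ s₂ ⟨ht₂, hreg₂, r19₂, hmem₂, r16₂, hy₂, hy₂'⟩
    simp only [entry] at hy₂
    have hT : Holds qF L s₂ 3 (qF ^ (N - κ) * D + S) := by
      refine ⟨by omega, funext fun j => ?_⟩
      rw [digit_shift_add hs_lt]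
      split_ifs with hj
      · rw [hS, rowValue_eq_sum α hC (f := s₂.mem 3) hy₂]
        refine (digit_sum _ _ (fun l hl => ?_) j hj).symm
        rw [← hC.card_compl_leadCols] at hl
        have := hy₂ _ (freeCol_notMem C ⟨l, hl⟩)
        rw [freeRank_freeCol] at this
        rw [this]
        exact Fin.is_lt _
      -- The scan writes only at ranks of free columns, all smaller than N - κ, so the higher digits
      -- remain those of D.
      · rw [hy₂' j fun c hc hjc => hj ?_, hW₁.2, digit_mul_pow (by omega), if_neg hj]
        have h1 := freeRank_succ C c
        have h2 := freeRank_mono C (Nat.succ_le_of_lt c.2)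
        rw [if_neg hc] at h1
        rw [Nat.succ_eq_add_one, freeRank_self, hC.card_compl_leadCols] at h2
        omega
    have hE₂ := hE₁.congr fun r hr => hreg₂ r (by omega)
    have r10 : s₂.reg 10 = N := by rw [hreg₂ 10 (by simp), r10]
    have r11 : s₂.reg 11 = κ := by rw [hreg₂ 11 (by simp), r11]
    have r14 : s₂.reg 14 = N - κ := by rw [hreg₂ 14 (by simp), r14]
    have r19 : s₂.reg 19 = 0 := r19₂.trans r19
    have hmem₂ : ∀ a, a ≠ 3 → s₂.mem a = s.mem a := fun a ha => (hmem₂ a ha).trans (hmem₁ a ha)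
    refine Halts.seq (Halts.assign (by simp only [Fits, eval]; omega) ?_)
    have hA := gaussRec_succ_right (q := qF) (n := N) (k := κ) (by omega) hκN
    refine Halts.seq (Halts.mono (mulDivProg_spec' (a := N - κ) (b := κ + 1)
      (g := gaussRec qF N κ) (h := gaussRec qF N (κ + 1)) hB (hE₂.setReg _ _ (by simp))
      (by simp [r14]) (by simp [eval, r11]) (by omega) (by omega) (by omega) (by simp) (by simp)
      (by exact hs.gauss.congr (hmem₂ 2 (by simp))) (by exact h12.congr (hmem₂ 12 (by simp)))
      (by exact h4.congr (hmem₂ 4 (by simp))) hA (by omega)) ?_)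
    rintro t₃ s₃ ⟨ht₃, hreg₃, hmem₃, ⟨w12', h12'⟩, hA₃⟩
    simp only [State.setReg_mem] at hmem₃
    have hreg₃' : ∀ r < 20, r ≠ 15 → s₃.reg r = s₂.reg r := fun r h1 h2 => by
      rw [hreg₃ r h1]
      simp [h2]
    have hE₃ := hE₂.congr fun r hr => hreg₃' r (by omega) (by omega)
    have r10 : s₃.reg 10 = N := by rw [hreg₃' 10 (by simp) (by simp), r10]
    have r11 : s₃.reg 11 = κ := by rw [hreg₃' 11 (by simp) (by simp), r11]
    have r15 : s₃.reg 15 = κ + 1 := by rw [hreg₃ 15 (by simp)]; simpa [eval, hreg₃'] using r11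
    have r16 : s₃.reg 16 = p i := by rw [hreg₃' 16 (by simp) (by simp), r16₂]
    have r19 : s₃.reg 19 = 0 := by rw [hreg₃' 19 (by simp) (by simp), r19]
    refine Halts.seq (Halts.assign (by simp only [Fits, eval]; omega) ?_)
    have hG₃ : Holds qF L s₃ 2 (gaussRec qF N κ) :=
      hs.gauss.congr ((hmem₃ 2 (by simp) (by simp)).trans (hmem₂ 2 (by simp)))
    have hT₃ := hT.congr (hmem₃ 3 (by simp) (by simp))
    have hmem₃ : ∀ a, a ≠ 3 → a ≠ 4 → a ≠ 12 → s₃.mem a = s.mem a := fun a h1 h2 h3 =>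
      (hmem₃ a h2 h3).trans (hmem₂ a h1)
    refine Halts.seq (Halts.mono (mulDivProg_spec' (a := N + 1) (b := κ + 1)
      (g := gaussRec qF N κ) (h := gaussRec qF (N + 1) (κ + 1)) hB (hE₃.setReg _ _ (by simp))
      (by simp [eval, r10]) (by simp [r15]) (by omega) (by omega) (by omega) (by simp) (by simp)
      (by exact hG₃) (by exact h12') (by exact hG₃)
      ((gaussRec_mul_pow_sub_one (by omega) (by omega)).2 κ rfl).symm hH) ?_)
    rintro t₄ s₄ ⟨ht₄, hreg₄, hmem₄, ⟨w12'', h12''⟩, hG₄⟩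
    simp only [State.setReg_mem] at hmem₄
    have hreg₄' : ∀ r < 20, r ≠ 14 → s₄.reg r = s₃.reg r := fun r h1 h2 => by
      rw [hreg₄ r h1]
      simp [h2]
    have hE₄ := hE₃.congr fun r hr => hreg₄' r (by omega) (by omega)
    have hT₄ := hT₃.congr (hmem₄ 3 (by simp) (by simp))
    have hA₄ := hA₃.congr (hmem₄ 4 (by simp) (by simp))
    have h6₄ := h6.congr ((hmem₄ 6 (by simp) (by simp)).trans (hmem₃ 6 (by simp) (by simp) (by simp)))
    have hz₄ := hs.zero.congr
      ((hmem₄ 8 (by simp) (by simp)).trans (hmem₃ 8 (by simp) (by simp) (by simp)))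
    refine Halts.seq (Halts.mono (subCall_spec (a := 0) hB hE₄ (by simp only [Fits]; omega)
      (by simp [eval]) (by omega) (by simp) (by simp) (by simp) hT₄ hz₄ h6₄) ?_)
    rintro t₅ s₅ ⟨ht₅, hreg₅, hmem₅, hbor₅, V, hV, heq₅⟩
    have hE₅ := hE₄.congr fun r hr => hreg₅ r (by omega)
    have hmem₅' : ∀ a, a ≠ 2 → a ≠ 3 → a ≠ 4 → a ≠ 6 → a ≠ 12 → s₅.mem a = s.mem a :=
      fun a h2 h3 h4 h6 h12 =>
        (hmem₅ a h6).trans ((hmem₄ a h2 h12).trans (hmem₃ a h3 h4 h12))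
    have hD₅ := hs.result.congr (hmem₅' 1 (by simp) (by simp) (by simp) (by simp) (by simp))
    have hz₅ := hz₄.congr (hmem₅ 8 (by simp))
    have hG₅ := hG₄.congr (hmem₅ 2 (by simp))
    have hA₅ := hA₄.congr (hmem₅ 4 (by simp))
    have h7₅ := h7.congr (hmem₅' 7 (by simp) (by simp) (by simp) (by simp) (by simp))
    rw [pow_zero, mul_one, Nat.mod_eq_of_lt hT₄.1, add_zero] at heq₅
    have hstep : Halts B (.ite (const 0) (reg 21) (subCall 1 2 8 (const 0) 1)
        (.seq (subCall 7 8 4 (const 0) 0) (subCall 1 6 7 (const 0) 0))) t₅ s₅ fun t' s' =>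
        t' ≤ t₅ + (80 * L + 60) ∧ (∀ r < 20, s'.reg r = s₅.reg r) ∧
        (∀ a, a ≠ 1 → a ≠ 7 → s'.mem a = s₅.mem a) ∧ (∃ w, Holds qF L s' 7 w) ∧
        Holds qF L s' 1 (decode α X) := by
      refine Halts.ite (by simp only [Fits]; omega) (by simp only [Fits]; omega) (fun h => ?_)
        fun h => ?_
      · simp only [eval] at h
        -- The borrow of T - 1 signals T = 0.
        have hb : s₅.reg 21 = 1 := by omega
        refine Halts.mono (subCall_spec (a := 0) hB hE₅ (by simp only [Fits]; omega)
          (by simp [eval]) (by omega) (by simp) (by simp) (by simp) hG₅ hz₅ hD₅) ?_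
        rintro t₆ s₆ ⟨ht₆, hreg₆, hmem₆, hbor₆, D', hD', heq₆⟩
        refine ⟨by simp only [cost] at *; omega, hreg₆, fun a h1 _ => hmem₆ a h1,
          ⟨_, h7₅.congr (hmem₆ 7 (by simp))⟩, ?_⟩
        rw [hb, mul_one] at heq₅
        have hV1 := hV.1
        rw [hdec, if_pos (by omega)]
        rw [pow_zero, mul_one, Nat.mod_eq_of_lt hH, add_zero] at heq₆
        have hb6 : s₆.reg 21 = 0 := by
          by_contra hne
          have : s₆.reg 21 = 1 := by omega
          rw [this, mul_one] at heq₆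
          have := hD'.1
          omega
        rw [hb6, mul_zero] at heq₆
        rwa [← show D' = gaussRec qF (N + 1) (κ + 1) - 1 by omega]
      · simp only [eval] at h
        have hb : s₅.reg 21 = 0 := by omega
        rw [hb, mul_zero, add_zero] at heq₅
        -- The sum A + V is computed as V - (0 - A) modulo q^L, so that subtraction is the only
        -- arithmetic subroutine.
        refine Halts.seq (Halts.mono (subCall_spec (a := 0) hB hE₅ (by simp only [Fits]; omega)
          (by simp [eval]) (by omega) (by simp) (by simp) (by simp) hz₅ hA₅ h7₅) ?_)
        rintro t₆ s₆ ⟨ht₆, hreg₆, hmem₆, hbor₆, W, hW, heq₆⟩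
        have hE₆ := hE₅.congr fun r hr => hreg₆ r (by omega)
        refine Halts.mono (subCall_spec (a := 0) hB hE₆ (by simp only [Fits]; omega)
          (by simp [eval]) (by omega) (by simp) (by simp) (by simp)
          (hV.congr (hmem₆ 6 (by simp))) hW (hD₅.congr (hmem₆ 1 (by simp)))) ?_
        rintro t₇ s₇ ⟨ht₇, hreg₇, hmem₇, hbor₇, D', hD', heq₇⟩
        refine ⟨by simp only [cost] at *; omega, fun r hr => (hreg₇ r hr).trans (hreg₆ r hr),
          fun a h1 h7 => (hmem₇ a h1).trans (hmem₆ a h7), ⟨_, hW.congr (hmem₇ 7 (by simp))⟩, ?_⟩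
        rw [hdec, if_neg (by omega)]
        rw [pow_zero, mul_one, Nat.zero_mod, zero_add, add_zero] at heq₆
        rw [pow_zero, mul_one, Nat.mod_eq_of_lt hV.1, add_zero] at heq₇
        have := add_of_sub_eqs hbor₆ hbor₇ (by omega) hD'.1 heq₆ heq₇
        rwa [← show D' = gaussRec qF N (κ + 1) + (qF ^ (N - κ) * D + S) - 1 by omega]
    refine Halts.seq (hstep.mono ?_)
    rintro t₆ s₆ ⟨ht₆, hreg₆, hmem₆, ⟨w7', h7'⟩, hres⟩
    have hr₆ : ∀ r < 20, r ≠ 14 → s₆.reg r = s₃.reg r := fun r h1 h2 =>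
      (hreg₆ r h1).trans ((hreg₅ r h1).trans (hreg₄' r h1 h2))
    have r10 : s₆.reg 10 = N := by rw [hr₆ 10 (by simp) (by simp), r10]
    have r11 : s₆.reg 11 = κ := by rw [hr₆ 11 (by simp) (by simp), r11]
    have r16 : s₆.reg 16 = p i := by rw [hr₆ 16 (by simp) (by simp), r16]
    have r19 : s₆.reg 19 = 0 := by rw [hr₆ 19 (by simp) (by simp), r19]
    have hmem₆' : ∀ a, a ≠ 1 → a ≠ 2 → a ≠ 3 → a ≠ 4 → a ≠ 6 → a ≠ 7 → a ≠ 12 →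
        s₆.mem a = s.mem a := fun a h1 h2 h3 h4 h6 h7 h12 =>
      (hmem₆ a h1 h7).trans (hmem₅' a h2 h3 h4 h6 h12)
    have hple := (p i).2
    refine Halts.seq (Halts.store (by simp only [Fits]; omega) (by simp only [Fits]; omega)
      (Halts.assign ?_ (Halts.assign ?_ ⟨?_, ?_⟩)))
    · simp only [Fits, eval, State.setMem_reg]
      omega
    · simp [Fits, eval, r10]
      omega
    · simp only [cost] at *
      have : N ≤ L := by omega
      omega
    · have tmp : ∀ a, a ≠ 9 → ∀ y, Holds qF L s₆ a y → Holds qF L (((s₆.setMem 9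
          (eval s₆ (reg 16)) (eval s₆ (const 1))).setReg 11 (eval (s₆.setMem 9
          (eval s₆ (reg 16)) (eval s₆ (const 1))) ((reg 11).add (const 1)))).setReg 10
          (eval ((s₆.setMem 9 (eval s₆ (reg 16)) (eval s₆ (const 1))).setReg 11 (eval (s₆.setMem 9
          (eval s₆ (reg 16)) (eval s₆ (const 1))) ((reg 11).add (const 1))))
          ((reg 10).add (const 1)))) a y := fun a ha y hy => hy.congr (by simp [ha])
      have mark : ∀ c, (s₆.setMem 9 (eval s₆ (reg 16)) (eval s₆ (const 1))).mem 9 c =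
          if c = p i then 1 else s.mem 9 c := fun c => by
        rw [State.setMem_mem_self, hmem₆' 9 (by simp) (by simp) (by simp) (by simp) (by simp)
          (by simp) (by simp)]
        simp only [eval, r16]
      exact {
        env := Env.setReg (Env.setReg (Env.setMem (hE₃.congr fun r hr =>
          hr₆ r (by omega) (by omega)) _ _ _) _ _ (by simp)) _ _ (by simp)
        reg10 := by simp [eval, r10]
        reg11 := by simp [eval, r11]
        reg19 := by simp [r19]
        result := tmp 1 (by simp) _ hres
        gauss := tmp 2 (by simp) _ (hG₅.congr (hmem₆ 2 (by simp) (by simp)))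
        tmp3 := ⟨_, tmp 3 (by simp) _ ((hT₄.congr (hmem₅ 3 (by simp))).congr
          (hmem₆ 3 (by simp) (by simp)))⟩
        tmp4 := ⟨_, tmp 4 (by simp) _ (hA₅.congr (hmem₆ 4 (by simp) (by simp)))⟩
        tmp6 := ⟨_, tmp 6 (by simp) _ (hV.congr (hmem₆ 6 (by simp) (by simp)))⟩
        tmp7 := ⟨_, tmp 7 (by simp) _ h7'⟩
        tmp12 := ⟨_, tmp 12 (by simp) _ ((h12''.congr (hmem₅ 12 (by simp))).congr
          (hmem₆ 12 (by simp) (by simp)))⟩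
        zero := tmp 8 (by simp) _ (hz₅.congr (hmem₆ 8 (by simp) (by simp)))
        input := by
          rw [State.setReg_mem, State.setReg_mem, State.setMem_mem_ne _ (by simp), hmem₆' 0
            (by simp) (by simp) (by simp) (by simp) (by simp) (by simp) (by simp), hs.input]
        trail := by
          rw [State.setReg_mem, State.setReg_mem, State.setMem_mem_ne _ (by simp), hmem₆' 10
            (by simp) (by simp) (by simp) (by simp) (by simp) (by simp) (by simp), hs.trail]
        mark := fun c => by
          rw [State.setReg_mem, State.setReg_mem, mark, mem_leadCols]
          split_ifs with hc
          · simp only [ne_eq, one_ne_zero, not_false_eq_true, true_iff]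
            exact ⟨i, (Fin.ext hc : c = p i) ▸ hpi⟩
          · have hci : ¬ IsLead X i c := fun h => hc (congrArg Fin.val (h.unique hpi))
            induction c using Fin.lastCases with
            | last =>
              rw [Fin.val_last, hs.mark_zero N le_rfl]
              simp only [ne_eq, not_true_eq_false, false_iff, not_exists]
              intro r hrl
              by_cases hri : r = i
              · exact hci (hri ▸ hrl)
              · exact hrl.1 (hr r hri)
            | cast c =>
              rw [Fin.val_castSucc, hs.mark c, hleadC]
              refine exists_congr fun r => ⟨fun h => h.2, fun h => ⟨?_, h⟩⟩
              rintro rfl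
              exact hci h
        mark_zero := fun c hc => by
          rw [State.setReg_mem, State.setReg_mem, mark, if_neg (by omega)]
          exact hs.mark_zero c (by omega)
        mark_le := fun c => by
          rw [State.setReg_mem, State.setReg_mem, mark]
          have := hs.mark_le c
          split_ifs <;> omega }
  · simp [eval, hs.trail, e10, htr] at h

end DecodeStep

end GrassGray

namespace GrassGray

open WordExpr

/-! ### The complete decoding program -/

section DecodeProg

variable {F : Type*} [Field F] [DecidableEq F] [Fintype F] {α : Fin (Fintype.card F) ≃ F}

local notation "qF" => Fintype.card F

/-- The decoding program. -/
def decodeProg : Prog :=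
  .seq lengthProg <| .seq (.store 2 (const 0) (const 1)) <| .seq trailProg <|
  .seq (.assign 10 (const 0)) <| .seq (.assign 11 (const 0)) <|
  .seq (.assign 19 (const 0)) <| .loop (reg 10) (reg 1) decodeStep

theorem exists_isTrail {F : Type*} [Field F] [DecidableEq F] {k n : ℕ}
    {M : Matrix (Fin k) (Fin n) F} {r : Fin k} {c : Fin n} (h : M r c ≠ 0) :
    ∃ c', IsTrail M r c' := by
  have hne : (Finset.univ.filter fun c => M r c ≠ 0).Nonempty := ⟨c, by simpa using h⟩
  refine ⟨_, (Finset.mem_filter.1 (Finset.max'_mem _ hne)).2, fun c' hc' => ?_⟩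
  by_contra h'
  exact absurd (Finset.le_max' _ c' (by simpa using h')) (not_le.2 hc')

theorem digit_one {q : ℕ} (hq : 2 ≤ q) (j : ℕ) : digit q 1 j = if j = 0 then 1 else 0 := by
  split_ifs with h
  · subst h
    simp [digit, Nat.mod_eq_of_lt hq]
  · have : 1 < q ^ j := Nat.one_lt_pow h hq
    simp [digit, Nat.div_eq_of_lt this]

theorem holds_zero {q L : ℕ} (hq : 2 ≤ q) {s : State} {a : ℕ} (h : ∀ i, s.mem a i = 0) :
    Holds q L s a 0 :=
  ⟨by positivity, funext fun i => by rw [h, digit_zero]⟩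

theorem holds_one {q L : ℕ} (hq : 2 ≤ q) (hL : 0 < L) {s : State} {a : ℕ}
    (h : ∀ i, s.mem a i = if i = 0 then 1 else 0) : Holds q L s a 1 :=
  ⟨Nat.one_lt_pow hL.ne' hq, funext fun i => by rw [h, digit_one hq]⟩

theorem matrixArray_apply {k n : ℕ} (X : Matrix (Fin k) (Fin n) F) (r : Fin k) (c : Fin n) :
    matrixArray α X (n * r + c) = α.symm (X r c) := by
  have hn : 0 < n := (Nat.zero_le _).trans_lt c.2
  have h1 : (n * r + c) / n = r := by
    rw [Nat.mul_add_div hn, Nat.div_eq_of_lt c.2, add_zero]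
  have h2 : (n * r + c) % n = c := by
    rw [Nat.mul_add_mod, Nat.mod_eq_of_lt c.2]
  simp only [matrixArray, h1, h2]
  rw [dif_pos ⟨r.2, c.2⟩]

theorem matrixArray_lt {k n : ℕ} (X : Matrix (Fin k) (Fin n) F) (i : ℕ) :
    matrixArray α X i < qF := by
  simp only [matrixArray]
  split_ifs
  · exact Fin.is_lt _
  · exact Fintype.card_pos

/-- Only the two properties of canonical matrices from `tau_isLead_trailInj` are needed. The cost is
n steps of O(nk), besides O(nk) for the preparation. -/
theorem decodesWithin_decodeProg {B n k L : ℕ} (hB : Bounds B qF n k (α.symm 0) (α.symm 1) L)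
    {X : Matrix (Fin k) (Fin n) F} (hX : Echelon X) (hX' : TrailInj X) :
    DecodesWithin α decodeProg B X (4000 * (n * k * n)) := by
  have hlt := hB.lt
  have hq := hB.two_le
  have hk := hB.one_le
  have hkn := hB.le
  have hdig := hB.digits
  set s₀ := initial (params α n k) [matrixArray α X] with hs₀
  have hmem₀ : ∀ a, 0 < a → ∀ i, s₀.mem a i = 0 := fun a ha i => by
    obtain ⟨a, rfl⟩ := Nat.exists_eq_succ_of_ne_zero ha.ne'
    simp [hs₀, initial]
  have h0 : s₀.mem 0 = matrixArray α X := by simp [hs₀, initial]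
  suffices h : Halts B decodeProg 0 s₀ fun t s =>
      t ≤ 4000 * (n * k * n) ∧ s.mem 1 = digit qF (decode α X) by
    obtain ⟨t, s, hr, ht, hs⟩ := h
    exact ⟨t, s, hr, by omega, hs⟩
  refine Halts.seq (Halts.mono (lengthProg_spec hB (by simp [hs₀, initial, params])
    (by simp [hs₀, initial, params]) (by simp [hs₀, initial, params])
    (by simp [hs₀, initial, params]) (by simp [hs₀, initial, params])) ?_)
  rintro t₁ s₁ ⟨ht₁, hE₁, hmem₁⟩
  refine Halts.seq (Halts.store (by simp only [Fits]; omega) (by simp only [Fits]; omega) ?_)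
  have hE₂ := hE₁.setMem 2 (eval s₁ (const 0)) (eval s₁ (const 1))
  have hmem₂ : ∀ a, a ≠ 2 →
      (s₁.setMem 2 (eval s₁ (const 0)) (eval s₁ (const 1))).mem a = s₀.mem a := fun a ha => by
    rw [State.setMem_mem_ne _ ha, hmem₁]
  have hG₂ : ∀ i, (s₁.setMem 2 (eval s₁ (const 0)) (eval s₁ (const 1))).mem 2 i =
      if i = 0 then 1 else 0 := fun i => by
    rw [State.setMem_mem_self, hmem₁, hmem₀ 2 (by simp)]
    rfl
  set s₂ := s₁.setMem 2 (eval s₁ (const 0)) (eval s₁ (const 1))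
  obtain ⟨pl, -, hpl⟩ := id hX
  have htrail : ∀ r, ∃ c, IsTrail X r c := fun r => exists_isTrail (hpl r).1
  choose pt hpt using htrail
  have entry : ∀ (r : Fin k) (c : Fin n), s₂.mem 0 (n * r + c) = α.symm (X r c) := fun r c => by
    rw [hmem₂ 0 (by simp), h0, matrixArray_apply]
  refine Halts.seq (Halts.mono (trailProg_spec (p := fun r => if h : r < k then pt ⟨r, h⟩ else 0)
    hB hE₂ (fun i => by rw [hmem₂ 0 (by simp), h0]; exact matrixArray_lt X i) (fun r hr => ?_)
    (fun r hr r' hr' h => ?_) (fun r hr => ?_) (fun r hr c hc h => ?_)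
    (by rw [hmem₂ 10 (by simp)]; exact hmem₀ 10 (by simp))) ?_)
  · simp only [dif_pos hr]
    exact (pt ⟨r, hr⟩).2
  · simp only [dif_pos hr, dif_pos hr'] at h
    have h1 := hpt ⟨r, hr⟩
    rw [Fin.ext h] at h1
    exact congrArg Fin.val (hX' _ _ _ h1 (hpt ⟨r', hr'⟩))
  · simp only [dif_pos hr]
    rw [entry ⟨r, hr⟩]
    exact fun h => (hpt ⟨r, hr⟩).1 (α.symm.injective (Fin.ext h))
  · simp only [dif_pos hr] at h
    rw [entry ⟨r, hr⟩ ⟨c, hc⟩, (hpt ⟨r, hr⟩).2 ⟨c, hc⟩ h]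
  rintro t₃ s₃ ⟨ht₃, hE₃, hmem₃, htr, htr0⟩
  refine Halts.seq (Halts.assign (by simp only [Fits]; omega) (Halts.seq (Halts.assign
    (by simp only [Fits]; omega) (Halts.seq (Halts.assign (by simp only [Fits]; omega) ?_)))))
  have hmem : ∀ a, a ≠ 2 → a ≠ 10 → s₃.mem a = s₀.mem a := fun a h2 h10 => by
    rw [hmem₃ a h10, hmem₂ a h2]
  have hzero : ∀ a, 0 < a → a ≠ 2 → a ≠ 10 → ∀ i, s₃.mem a i = 0 := fun a h0 h2 h10 i => by
    rw [hmem a h2 h10, hmem₀ a h0]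
  -- The data after `N` columns are the number of rows, the remaining matrix and its base addresses.
  -- They arise from `X` by successive deletions on the right, hence are determined from the end of
  -- the loop.
  refine Halts.loop_backward
    (β := fun N => Σ κ : ℕ, Matrix (Fin κ) (Fin N) F × (Fin κ → ℕ))
    (fun N y => y.1 ≤ k ∧ IsStored α n k (matrixArray α X) (s₃.mem 10) y.2.1 y.2.2)
    (fun N y s => DecodeState α n k L (matrixArray α X) (s₃.mem 10) y.2.1 s) n (800 * L + 800)
    ⟨k, X, fun r => n * r⟩ ⟨le_rfl, hX, hX', fun r => ?_, matrixArray_apply X, fun r c hc => ?_,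
      fun c hc => ?_⟩ ?_ ?_ ?_ ?_
  · have := Nat.mul_le_mul_left n (Nat.succ_le_of_lt r.2)
    rwa [Nat.succ_eq_add_one, mul_add, mul_one] at this
  · have := htr r r.2
    simp only [r.2, dif_pos, Fin.eta] at this
    rwa [hc.unique (hpt r)]
  · by_contra hne
    refine hc (htr0 c fun r hr h => hne ⟨⟨r, hr⟩, ?_⟩)
    simp only [dif_pos hr] at h
    rw [Fin.ext h]
    exact hpt _
  · rintro ⟨κ, Y, base⟩ ⟨-, hY⟩
    -- Without columns an echelon matrix has no rows. Its number is 0 and its coefficient is 1, the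
    -- word stored at the beginning.
    obtain rfl : κ = 0 := Nat.le_zero.1 hY.echelon.le
    have tmp : ∀ a, 0 < a → a ≠ 2 → a ≠ 10 → Holds qF L (((s₃.setReg 10 (eval s₃ (const 0))).setReg
        11 (eval (s₃.setReg 10 (eval s₃ (const 0))) (const 0))).setReg 19 (eval ((s₃.setReg 10
        (eval s₃ (const 0))).setReg 11 (eval (s₃.setReg 10 (eval s₃ (const 0))) (const 0)))
        (const 0))) a 0 := fun a h0 h2 h10 => holds_zero hq (hzero a h0 h2 h10)
    exact {
      env := ((hE₃.setReg _ _ (by simp)).setReg _ _ (by simp)).setReg _ _ (by simp)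
      reg10 := by simp [eval]
      reg11 := by simp [eval]
      reg19 := by simp [eval]
      result := by
        simp only [decode]
        exact tmp 1 (by simp) (by simp) (by simp)
      gauss := by
        rw [gaussRec_zero_right]
        exact holds_one hq (by omega) fun i => by
          rw [State.setReg_mem, State.setReg_mem, State.setReg_mem, hmem₃ 2 (by simp), hG₂]
      tmp3 := ⟨0, tmp 3 (by simp) (by simp) (by simp)⟩
      tmp4 := ⟨0, tmp 4 (by simp) (by simp) (by simp)⟩
      tmp6 := ⟨0, tmp 6 (by simp) (by simp) (by simp)⟩
      tmp7 := ⟨0, tmp 7 (by simp) (by simp) (by simp)⟩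
      tmp12 := ⟨0, tmp 12 (by simp) (by simp) (by simp)⟩
      zero := tmp 8 (by simp) (by simp) (by simp)
      input := (hmem 0 (by simp) (by simp)).trans h0
      trail := rfl
      mark := fun c => c.elim0
      mark_zero := fun c _ => hzero 9 (by simp) (by simp) (by simp) c
      mark_le := fun c => (hzero 9 (by simp) (by simp) (by simp) c).trans_le (by simp) }
  · rintro N hN ⟨κ, Y, base⟩ ⟨hκ, hY⟩
    have guard : ∀ {κ' : ℕ} {Y' : Matrix (Fin κ') (Fin N) F} {s : State},
        DecodeState α n k L (matrixArray α X) (s₃.mem 10) Y' s →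
        (reg 10).Fits B s ∧ (reg 1).Fits B s ∧ (reg 10).eval s < (reg 1).eval s := by
      intro κ' Y' s hs
      have e10 := hs.reg10
      have e1 := hs.env.reg1
      exact ⟨by simp only [Fits]; omega, by simp only [Fits]; omega, by simp only [eval]; omega⟩
    by_cases hlast : ∀ r, Y r (Fin.last N) = 0
    · refine ⟨⟨κ, dropLast Y, base⟩, ⟨hκ, hY.of_col hlast⟩, fun s hs => ?_⟩
      refine ⟨(guard hs).1, (guard hs).2.1, (guard hs).2.2, fun t => ?_⟩
      refine Halts.mono (decodeStep_col hB hY hN hκ hlast hs) ?_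
      exact fun t' s' h => h
    · obtain ⟨i, hi⟩ := not_forall.1 hlast
      obtain ⟨κ, rfl⟩ := Nat.exists_eq_succ_of_ne_zero (n := κ) (by rintro rfl; exact i.elim0)
      -- Two rows that are non-zero in the last column would end in the same column.
      have hr : ∀ r ≠ i, Y r (Fin.last N) = 0 := fun r hri => by
        by_contra hr
        exact hri (hY.trailInj _ _ _ (isTrail_last hr) (isTrail_last hi))
      refine ⟨⟨κ, dropLast (deleteRow i Y), fun r => base (i.succAbove r)⟩,
        ⟨by simp only at hκ ⊢; omega, hY.of_row hr hi⟩, fun s hs => ?_⟩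
      refine ⟨(guard hs).1, (guard hs).2.1, (guard hs).2.2, fun t => ?_⟩
      refine Halts.mono (decodeStep_row hB (matrixArray_lt X) hY hN hκ hr hi hs) ?_
      exact fun t' s' h => h
  · intro s hs
    have e10 := hs.reg10
    have e1 := hs.env.reg1
    exact ⟨by simp only [Fits]; omega, by simp only [Fits]; omega, by simp only [eval]; omega⟩
  · intro t' s' ht' hs'
    refine ⟨?_, hs'.result.2⟩
    simp only [cost] at *
    have hnk : 1 ≤ n * k := Nat.mul_pos (by omega) hk
    have h1 : n * (800 * L + 800 + (1 + 1 + 1)) ≤ n * (2500 * (n * k)) :=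
      Nat.mul_le_mul_left _ (by omega)
    have h2 : k * (60 * n + 60) ≤ 120 * (n * k) := by nlinarith
    have h3 : n * k ≤ n * k * n := Nat.le_mul_of_pos_right _ (by omega)
    have h4 : k ≤ n * k := Nat.le_mul_of_pos_left _ (by omega)
    have h5 : n * (2500 * (n * k)) = 2500 * (n * k * n) := by ring
    omega

end DecodeProg

end GrassGray

namespace GrassGray

open WordExpr

/-! ### The first part of the encoding program: the digits of the rows -/

section EncodeDown

variable {B q n k z o L : ℕ}

/-- The number in the array `x` is copied to the array `z`. -/
def moveProg (z x : ℕ) : Prog :=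
  .seq (.assign 26 (const 0)) <| .seq (.assign 27 (const 0)) <| .seq (.assign 28 (reg 5)) <|
  copyProg z x

theorem moveProg_spec {s : State} {x y X Y t : ℕ} (hB : Bounds B q n k z o L)
    (hE : Env q n k z o L s) (hyx : y ≠ x) (hx : Holds q L s x X) (hy : Holds q L s y Y) :
    Halts B (moveProg y x) t s fun t' s' =>
      t' ≤ t + (20 * L + 20) ∧ (∀ r < 20, s'.reg r = s.reg r) ∧
      (∀ b, b ≠ y → s'.mem b = s.mem b) ∧ Holds q L s' y X := by
  have hlt := hB.lt
  have hdig := hB.digits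
  have e5 := hE.reg5
  refine Halts.seq (Halts.assign (by simp only [Fits]; omega) (Halts.seq (Halts.assign
    (by simp only [Fits]; omega) (Halts.seq (Halts.assign (by simp [Fits]; omega) ?_)))))
  refine Halts.mono (copyProg_spec (i := 0) (j := 0) (m := L) (by simp [eval]) (by simp [eval])
    (by simp [eval, e5]) hyx (by omega) (by omega) fun c _ => ?_) ?_
  · have := hx.lt hB.two_le c
    simp only [State.setReg_mem, zero_add]
    omega
  · rintro t' s' ⟨ht, hreg, hmem, hc⟩
    refine ⟨by simp only [cost] at ht; omega, fun r hr => ?_, hmem, hx.1, funext fun c => ?_⟩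
    · simp [hreg r hr, show r ≠ 26 by omega, show r ≠ 27 by omega, show r ≠ 28 by omega]
    · rw [hc]
      simp only [State.setReg_mem, zero_add, Nat.zero_le, true_and, Nat.sub_zero]
      split_ifs with h
      · rw [hx.2]
      · rw [hy.2, digit_eq_zero hy.1 (by omega), digit_eq_zero hx.1 (by omega)]

/-- The Gaussian coefficient of `n` and `k` is stored in the array `2`. -/
def gaussProg : Prog :=
  .seq (.store 2 (const 0) (const 1)) <| .seq (.assign 14 (sub (reg 1) (reg 2))) <|
  .seq (.assign 15 (const 0)) <| .loop (reg 15) (reg 2) <|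
  .seq (.assign 14 (add (reg 14) (const 1))) <| .seq (.assign 15 (add (reg 15) (const 1))) <|
  mulDivProg 2 2 12

/-- The coefficient is reached along the diagonal from `gaussRec q (n - k) 0 = 1`, with the factor
(q^(n-k+i) - 1) / (q^i - 1) for i = 1, …, k. -/
theorem gaussProg_spec {s : State} {t : ℕ} (hB : Bounds B q n k z o L) (hE : Env q n k z o L s)
    (h2 : ∀ i, s.mem 2 i = 0) (h12 : ∀ i, s.mem 12 i = 0) :
    Halts B gaussProg t s fun t' s' =>
      t' ≤ t + (k * (80 * L + 50) + 20) ∧ Env q n k z o L s' ∧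
      (∀ b, b ≠ 2 → b ≠ 12 → s'.mem b = s.mem b) ∧ (∃ w, Holds q L s' 12 w) ∧
      Holds q L s' 2 (gaussRec q n k) := by
  have hlt := hB.lt
  have hdig := hB.digits
  have hq := hB.two_le
  have hkn := hB.le
  have e1 := hE.reg1
  have e2 := hE.reg2
  refine Halts.seq (Halts.store (by simp only [Fits]; omega) (by simp only [Fits]; omega)
    (Halts.seq (Halts.assign (by simp only [Fits, State.setMem_reg]; omega)
    (Halts.seq (Halts.assign (by simp only [Fits]; omega) ?_)))))
  refine Halts.loop (fun i s' => s'.reg 14 = n - k + i ∧ s'.reg 15 = i ∧ Env q n k z o L s' ∧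
    (∀ b, b ≠ 2 → b ≠ 12 → s'.mem b = s.mem b) ∧ (∃ w, Holds q L s' 12 w) ∧
    Holds q L s' 2 (gaussRec q (n - k + i) i)) k (80 * L + 40) ?_ ?_ ?_ ?_
  · refine ⟨by simp [eval, e1, e2], by simp [eval], ((hE.setMem _ _ _).setReg _ _ (by simp)).setReg
      _ _ (by simp), fun b hb _ => by simp [hb], ⟨0, holds_zero hq fun i => ?_⟩, ?_⟩
    · simp [h12]
    · rw [gaussRec_zero_right]
      exact holds_one hq (by omega) fun i => by simp [eval, h2]
  · rintro i hi s₁ ⟨r14, r15, hE₁, hmem, ⟨w, hw⟩, hG⟩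
    have f2 := hE₁.reg2
    refine ⟨by simp only [Fits]; omega, by simp only [Fits]; omega, by simp only [eval]; omega,
      fun t₁ => Halts.seq (Halts.assign (by simp only [Fits, eval]; omega) (Halts.seq
        (Halts.assign (by simp [Fits, eval, r15]; omega) ?_)))⟩
    refine Halts.mono (mulDivProg_spec' (a := n - k + i + 1) (b := i + 1)
      (g := gaussRec q (n - k + i) i) (h := gaussRec q (n - k + i + 1) (i + 1)) hB
      ((hE₁.setReg _ _ (by simp)).setReg _ _ (by simp)) (by simp [eval, r14]) (by simp [eval, r15])
      (by omega) (by omega) (by omega) (by simp) (by simp) (by exact hG) (by exact hw)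
      (by exact hG) ((gaussRec_mul_pow_sub_one (by omega) (by omega)).2 i rfl).symm
      (by rw [hdig]; exact gaussRec_lt_pow hq (by omega) (by omega))) ?_
    rintro t₂ s₂ ⟨ht₂, hreg₂, hmem₂, hw₂, hG₂⟩
    refine ⟨by simp only [cost] at *; omega, ?_, ?_, ?_, fun b h2 h12 => ?_, hw₂, hG₂⟩
    · rw [hreg₂ 14 (by simp)]
      simp [eval, r14, add_assoc]
    · rw [hreg₂ 15 (by simp)]
      simp [eval, r15]
    · exact ((hE₁.setReg _ _ (by simp)).setReg _ _ (by simp)).congr fun r hr => hreg₂ r (by omega)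
    · rw [hmem₂ b h2 h12]
      exact hmem b h2 h12
  · rintro s₁ ⟨r14, r15, hE₁, -⟩
    have f2 := hE₁.reg2
    exact ⟨by simp only [Fits]; omega, by simp only [Fits]; omega, by simp only [eval]; omega⟩
  · rintro t' s' ht ⟨r14, r15, hE₁, hmem, hw, hG⟩
    rw [Nat.sub_add_cancel hkn] at hG
    refine ⟨?_, hE₁, hmem, hw, hG⟩
    simp only [cost] at ht
    have : k * (80 * L + 40 + (1 + 1 + 1)) ≤ k * (80 * L + 50) := Nat.mul_le_mul_left _ (by omega)
    omega

/-- The steps of the recursion for `encode` are recorded: `flag N` is `1` if the step to `N` columns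
removes a row, and `rec` holds the digits of this row. -/
def IsTrace (q n : ℕ) (flag rec : ℕ → ℕ) : ℕ → ℕ → ℕ → Prop
  | 0, κ, _ => κ = 0
  | N + 1, κ, m =>
    (flag N = 0 ∧ m < gaussRec q N κ ∧ IsTrace q n flag rec N κ m) ∨
    ∃ κ', κ = κ' + 1 ∧ κ' ≤ N ∧ flag N = 1 ∧ gaussRec q N κ ≤ m ∧ m < gaussRec q (N + 1) κ ∧
      (∀ l < N - κ', rec (n * (n - 1 - N) + l) = digit q (m - gaussRec q N κ + 1) l) ∧
      IsTrace q n flag rec N κ' ((m - gaussRec q N κ + 1) / q ^ (N - κ') % gaussRec q N κ')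

/-- One step of the recursion for `encode`. -/
def encodeStep : Prog :=
  .seq (.assign 10 (sub (reg 10) (const 1))) <|
  .seq (.assign 14 (sub (add (reg 10) (const 1)) (reg 11))) <|
  .seq (.assign 15 (add (reg 10) (const 1))) <|
  .seq (mulDivProg 4 2 12) <|
  .seq (subCall 3 0 4 (const 0) 0) <|
  .seq (.ite (const 0) (reg 21) .skip <|
    .seq (.store 11 (reg 10) (const 1)) <|
    .seq (subCall 6 4 8 (const 0) 1) <|
    .seq (subCall 7 0 6 (const 0) 0) <|
    .seq (.assign 26 (reg 12)) <| .seq (.assign 27 (const 0)) <| .seq (.assign 28 (reg 14)) <|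
    .seq (copyProg 10 7) <|
    .seq (.assign 26 (const 0)) <| .seq (.assign 27 (reg 14)) <| .seq (.assign 28 (reg 5)) <|
    .seq (copyProg 0 7) <|
    .seq (.assign 14 (reg 11)) <|
    .seq (mulDivProg 4 2 12) <|
    .seq (subCall 3 0 4 (const 0) 0) <|
    .seq (.ite (const 0) (reg 21) .skip (moveProg 0 3)) <|
    .assign 11 (sub (reg 11) (const 1))) <|
  .seq (moveProg 2 4) <|
  .assign 12 (add (reg 12) (reg 1))

/-- The state of the encoding program, if the recursion has arrived at `encode α N κ m`. -/
structure EncodeState (q n k z o L : ℕ) (N κ m : ℕ) (s : State) : Prop where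
  env : Env q n k z o L s
  reg10 : s.reg 10 = N
  reg11 : s.reg 11 = κ
  reg12 : s.reg 12 = n * (n - N)
  le : κ ≤ N
  le' : κ ≤ k
  lt : m < gaussRec q N κ
  number : Holds q L s 0 m
  gauss : Holds q L s 2 (gaussRec q N κ)
  tmp3 : ∃ w, Holds q L s 3 w
  tmp4 : ∃ w, Holds q L s 4 w
  tmp6 : ∃ w, Holds q L s 6 w
  tmp7 : ∃ w, Holds q L s 7 w
  tmp12 : ∃ w, Holds q L s 12 w
  zero : Holds q L s 8 0
  flag : ∀ i < N, s.mem 11 i = 0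
  unused : ∀ a, a = 5 ∨ a = 9 → ∀ i, s.mem a i = 0

/-- With A = `gaussRec q N κ`, the borrow of m - A decides between the two cases. In the row case
the low digits of m - A + 1 are the digits of the row and the others form a quotient, which is at
most the next coefficient; its reduction therefore needs only one comparison. The trace is stated
for arbitrary `flag` and `rec` that agree with the current arrays, since later steps write other
cells. -/
theorem encodeStep_lt {N κ m t : ℕ} {s : State} (hB : Bounds B q n k z o L) (hN : N < n)
    (hs : EncodeState q n k z o L (N + 1) κ m s) :
    Halts B encodeStep t s fun t' s' => t' ≤ t + (1000 * L + 1000) ∧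
      ∃ κ' m', EncodeState q n k z o L N κ' m' s' ∧
      (∀ i, i ≠ N → s'.mem 11 i = s.mem 11 i) ∧
      (∀ i, i < n * (n - (N + 1)) → s'.mem 10 i = s.mem 10 i) ∧
      ∀ flag rec, flag N = s'.mem 11 N → (∀ i < n * (n - N), rec i = s'.mem 10 i) →
        IsTrace q n flag rec N κ' m' → IsTrace q n flag rec (N + 1) κ m := by
  have hlt := hB.lt
  have hdig := hB.digits
  have hq := hB.two_le
  have hkn := hB.le
  have hk := hB.one_le
  have hnk : n * 1 ≤ n * k := Nat.mul_le_mul_left n hk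
  have hnn : n * (n - N) ≤ n * n := Nat.mul_le_mul_left n (by omega)
  have hsub : n * (n - N) = n * (n - (N + 1)) + n := by
    rw [← Nat.mul_succ]
    congr 1
    omega
  have hle := hs.le
  have hle' := hs.le'
  have hm := hs.lt
  have e10 := hs.reg10
  have e11 := hs.reg11
  have e12 := hs.reg12
  obtain ⟨w3, h3⟩ := hs.tmp3
  obtain ⟨w4, h4⟩ := hs.tmp4
  obtain ⟨w6, h6⟩ := hs.tmp6
  obtain ⟨w7, h7⟩ := hs.tmp7
  obtain ⟨w12, h12⟩ := hs.tmp12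
  have hA : gaussRec q N κ < q ^ L := by
    rw [hdig]
    exact gaussRec_lt_pow hq hN.le hle'
  have hG := hs.gauss.1
  refine Halts.seq (Halts.assign (by simp only [Fits]; omega) ?_)
  have v10 : eval s ((reg 10).sub (const 1)) = N := by simp [eval, e10]
  rw [v10]
  refine Halts.seq (Halts.assign (by simp [Fits, eval, e11]; omega) ?_)
  have v14 : eval (s.setReg 10 N) (((reg 10).add (const 1)).sub (reg 11)) = N + 1 - κ := by
    simp [eval, e11]
  rw [v14]
  refine Halts.seq (Halts.assign (by simp [Fits, eval]; omega) ?_)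
  have v15 : eval ((s.setReg 10 N).setReg 14 (N + 1 - κ)) ((reg 10).add (const 1)) = N + 1 := by
    simp [eval]
  rw [v15]
  have hE₀ := ((hs.env.setReg 10 N (by simp)).setReg 14 (N + 1 - κ) (by simp)).setReg 15 (N + 1)
    (by simp)
  refine Halts.seq (Halts.mono (mulDivProg_spec' (a := N + 1 - κ) (b := N + 1)
    (g := gaussRec q (N + 1) κ) (h := gaussRec q N κ) hB hE₀ (by simp) (by simp) (by omega)
    (by omega) (by omega) (by simp) (by simp) (by exact hs.gauss) (by exact h12) (by exact h4)
    (gaussRec_mul_pow_sub_one (by omega) hle).1.symm hA) ?_)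
  rintro t₁ s₁ ⟨ht₁, hreg₁, hmem₁, ⟨w12', h12₁⟩, hA₁⟩
  simp only [State.setReg_mem] at hmem₁
  have hE₁ := hE₀.congr fun r hr => hreg₁ r (by omega)
  refine Halts.seq (Halts.mono (subCall_spec (a := 0) hB hE₁ (by simp only [Fits]; omega)
    (by simp [eval]) (by omega) (by simp) (by simp) (by simp)
    (hs.number.congr (hmem₁ 0 (by simp) (by simp))) hA₁
    (h3.congr (hmem₁ 3 (by simp) (by simp)))) ?_)
  rintro t₂ s₂ ⟨ht₂, hreg₂, hmem₂, hbor₂, V, hV, heq₂⟩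
  have hE₂ := hE₁.congr fun r hr => hreg₂ r (by omega)
  have hm₂ : ∀ a, a ≠ 3 → a ≠ 4 → a ≠ 12 → s₂.mem a = s.mem a := fun a h3 h4 h12 =>
    (hmem₂ a h3).trans (hmem₁ a h4 h12)
  have hA₂ := hA₁.congr (hmem₂ 4 (by simp))
  have h12₂ := h12₁.congr (hmem₂ 12 (by simp))
  have r10 : s₂.reg 10 = N := by rw [hreg₂ 10 (by simp), hreg₁ 10 (by simp)]; simp
  have r11 : s₂.reg 11 = κ := by rw [hreg₂ 11 (by simp), hreg₁ 11 (by simp)]; simp [e11]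
  have r12 : s₂.reg 12 = n * (n - (N + 1)) := by
    rw [hreg₂ 12 (by simp), hreg₁ 12 (by simp)]; simp [e12]
  have r14 : s₂.reg 14 = N + 1 - κ := by rw [hreg₂ 14 (by simp), hreg₁ 14 (by simp)]; simp
  have r15 : s₂.reg 15 = N + 1 := by rw [hreg₂ 15 (by simp), hreg₁ 15 (by simp)]; simp
  have g0 := hs.number.congr (hm₂ 0 (by simp) (by simp) (by simp))
  have g2 := hs.gauss.congr (hm₂ 2 (by simp) (by simp) (by simp))
  have g6 := h6.congr (hm₂ 6 (by simp) (by simp) (by simp))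
  have g7 := h7.congr (hm₂ 7 (by simp) (by simp) (by simp))
  have g8 := hs.zero.congr (hm₂ 8 (by simp) (by simp) (by simp))
  have g11 := hm₂ 11 (by simp) (by simp) (by simp)
  have g10 := hm₂ 10 (by simp) (by simp) (by simp)
  rw [pow_zero, mul_one, Nat.mod_eq_of_lt hs.number.1, add_zero] at heq₂
  -- the common end of both cases
  have finish : ∀ t₃ s₃ κ' m' g, t₃ ≤ t + (960 * L + 900) → Env q n k z o L s₃ →
      s₃.reg 10 = N → s₃.reg 11 = κ' → s₃.reg 12 = n * (n - (N + 1)) → κ' ≤ N → κ' ≤ k →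
      m' < gaussRec q N κ' → Holds q L s₃ 0 m' → Holds q L s₃ 2 g →
      Holds q L s₃ 4 (gaussRec q N κ') → (∃ w, Holds q L s₃ 3 w) → (∃ w, Holds q L s₃ 6 w) →
      (∃ w, Holds q L s₃ 7 w) → (∃ w, Holds q L s₃ 12 w) → Holds q L s₃ 8 0 →
      (∀ i, i ≠ N → s₃.mem 11 i = s.mem 11 i) → (∀ a, a = 5 ∨ a = 9 → s₃.mem a = s.mem a) →
      (∀ i, i < n * (n - (N + 1)) → s₃.mem 10 i = s.mem 10 i) →
      (∀ flag rec, flag N = s₃.mem 11 N → (∀ i < n * (n - N), rec i = s₃.mem 10 i) →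
        IsTrace q n flag rec N κ' m' → IsTrace q n flag rec (N + 1) κ m) →
      Halts B (.seq (moveProg 2 4) (.assign 12 (add (reg 12) (reg 1)))) t₃ s₃ fun t' s' =>
        t' ≤ t + (1000 * L + 1000) ∧
        ∃ κ' m', EncodeState q n k z o L N κ' m' s' ∧
        (∀ i, i ≠ N → s'.mem 11 i = s.mem 11 i) ∧
        (∀ i, i < n * (n - (N + 1)) → s'.mem 10 i = s.mem 10 i) ∧
        ∀ flag rec, flag N = s'.mem 11 N → (∀ i < n * (n - N), rec i = s'.mem 10 i) →
          IsTrace q n flag rec N κ' m' → IsTrace q n flag rec (N + 1) κ m := by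
    intro t₃ s₃ κ' m' g ht₃ hE₃ i10 i11 i12 hκ hκ' hm' i0 i2 i4 i3 i6 i7 i12' i8 if11 i59 i10' itr
    refine Halts.seq (Halts.mono (moveProg_spec hB hE₃ (by simp) i4 i2) ?_)
    rintro t₄ s₄ ⟨ht₄, hreg₄, hmem₄, hG₄⟩
    have hE₄ := hE₃.congr fun r hr => hreg₄ r (by omega)
    have f1 := hE₄.reg1
    have f12 : s₄.reg 12 = n * (n - (N + 1)) := (hreg₄ 12 (by simp)).trans i12
    refine Halts.assign (by simp only [Fits, eval]; omega) ⟨by simp only [cost]; omega, κ', m', ?_,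
      ?_, ?_, ?_⟩
    · have tmp : ∀ a, a ≠ 2 → ∀ y, Holds q L s₃ a y →
          Holds q L (s₄.setReg 12 (eval s₄ ((reg 12).add (reg 1)))) a y :=
        fun a h2 y hy => hy.congr (hmem₄ a h2)
      exact {
        env := hE₄.setReg _ _ (by simp)
        reg10 := by simp [hreg₄, i10]
        reg11 := by simp [hreg₄, i11]
        reg12 := by simp [eval, f12, f1, hsub]
        le := hκ
        le' := hκ'
        lt := hm'
        number := tmp 0 (by simp) _ i0
        gauss := hG₄
        tmp3 := i3.imp (tmp 3 (by simp))
        tmp4 := ⟨_, tmp 4 (by simp) _ i4⟩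
        tmp6 := i6.imp (tmp 6 (by simp))
        tmp7 := i7.imp (tmp 7 (by simp))
        tmp12 := i12'.imp (tmp 12 (by simp))
        zero := tmp 8 (by simp) _ i8
        flag := fun i hi => by
          rw [State.setReg_mem, hmem₄ 11 (by simp), if11 i (by omega)]
          exact hs.flag i (by omega)
        unused := fun a ha i => by
          rw [State.setReg_mem, hmem₄ a (by omega), i59 a ha]
          exact hs.unused a ha i }
    · rw [State.setReg_mem, hmem₄ 11 (by simp)]
      exact if11
    · rw [State.setReg_mem, hmem₄ 10 (by simp)]
      exact i10'
    · rw [State.setReg_mem, hmem₄ 10 (by simp), hmem₄ 11 (by simp)]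
      exact itr
  refine Halts.seq (Halts.ite (by simp only [Fits]; omega) (by simp only [Fits]; omega)
    (fun h => ?_) fun h => ?_)
  · simp only [eval] at h
    have hb : s₂.reg 21 = 1 := by omega
    have hmA : m < gaussRec q N κ := by
      rw [hb, mul_one] at heq₂
      have := hV.1
      omega
    have hκN : κ ≤ N := by
      by_contra hc
      rw [gaussRec_eq_zero (by omega)] at hmA
      omega
    refine Halts.skip (finish _ _ κ m _ (by simp only [cost] at *; omega) hE₂ r10 r11 r12 hκN hle'
      hmA g0 g2 hA₂ ⟨_, hV⟩ ⟨_, g6⟩ ⟨_, g7⟩ ⟨_, h12₂⟩ g8 (fun i _ => by rw [g11])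
      (fun a ha => hm₂ a (by omega) (by omega) (by omega)) (fun i _ => by rw [g10]) ?_)
    intro flag rec hf _ htr
    refine .inl ⟨?_, hmA, htr⟩
    rw [hf, g11, hs.flag N (by omega)]
  · simp only [eval] at h
    have hb : s₂.reg 21 = 0 := by omega
    rw [hb, mul_zero, add_zero] at heq₂
    have hAm : gaussRec q N κ ≤ m := by omega
    obtain ⟨κ, rfl⟩ : ∃ κ', κ = κ' + 1 := by
      refine Nat.exists_eq_succ_of_ne_zero ?_
      rintro rfl
      simp at hm hAm
      omega
    have hκN : κ ≤ N := by omega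
    have hpos : 0 < q ^ (N - κ) := by positivity
    have hsucc := gaussRec_succ_succ q N κ
    have hm' : m - gaussRec q N (κ + 1) < q ^ (N - κ) * gaussRec q N κ := by omega
    have hP : gaussRec q (N + 1) (κ + 1) < q ^ L := hG
    have hH : gaussRec q N κ < q ^ L := by
      have := Nat.mul_le_mul_right (gaussRec q N κ) (Nat.succ_le_of_lt hpos)
      rw [Nat.succ_eq_add_one, zero_add, one_mul] at this
      omega
    have hdiv : (m - gaussRec q N (κ + 1) + 1) / q ^ (N - κ) ≤ gaussRec q N κ := by
      refine Nat.div_le_of_le_mul ?_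
      omega
    -- the flag
    refine Halts.seq (Halts.store (by simp only [Fits]; omega) (by simp only [Fits]; omega) ?_)
    rw [show eval s₂ (reg 10) = N from r10, show eval s₂ (const 1) = 1 from rfl]
    have hE₃ := hE₂.setMem 11 N 1
    have hm₃ : ∀ a, a ≠ 11 → (s₂.setMem 11 N 1).mem a = s₂.mem a := fun a ha =>
      State.setMem_mem_ne _ ha
    have hf₃ : ∀ i, (s₂.setMem 11 N 1).mem 11 i = if i = N then 1 else s.mem 11 i := fun i => by
      rw [State.setMem_mem_self, g11]
    have hr₃ : (s₂.setMem 11 N 1).reg = s₂.reg := rfl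
    generalize s₂.setMem 11 N 1 = s₃ at hE₃ hm₃ hf₃ hr₃ ⊢
    -- the subtraction of the first Gaussian coefficient
    refine Halts.seq (Halts.mono (subCall_spec (a := 0) hB hE₃ (by simp only [Fits]; omega)
      (by simp [eval]) (by omega) (by simp) (by simp) (by simp) (hA₂.congr (hm₃ 4 (by simp)))
      (g8.congr (hm₃ 8 (by simp))) (g6.congr (hm₃ 6 (by simp)))) ?_)
    rintro t₄ s₄ ⟨ht₄, hreg₄, hmem₄, hbor₄, W, hW, heq₄⟩
    have hE₄ := hE₃.congr fun r hr => hreg₄ r (by omega)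
    have hm₄ : ∀ a, a ≠ 6 → a ≠ 11 → s₄.mem a = s₂.mem a := fun a h6 h11 =>
      (hmem₄ a h6).trans (hm₃ a h11)
    rw [pow_zero, mul_one, Nat.mod_eq_of_lt hA₂.1, add_zero] at heq₄
    refine Halts.seq (Halts.mono (subCall_spec (a := 0) hB hE₄ (by simp only [Fits]; omega)
      (by simp [eval]) (by omega) (by simp) (by simp) (by simp)
      (g0.congr (hm₄ 0 (by simp) (by simp))) hW (g7.congr (hm₄ 7 (by simp) (by simp)))) ?_)
    rintro t₅ s₅ ⟨ht₅, hreg₅, hmem₅, hbor₅, U, hU, heq₅⟩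
    have hE₅ := hE₄.congr fun r hr => hreg₅ r (by omega)
    rw [pow_zero, mul_one, Nat.mod_eq_of_lt hs.number.1, add_zero] at heq₅
    -- The program computes m - (A - 1). If A = 0, which happens when no column is left free, both
    -- subtractions borrow and the two wraps modulo q^L cancel.
    have hUm : U = m - gaussRec q N (κ + 1) + 1 := by
      have hU1 := hU.1
      have hW1 := hW.1
      generalize s₄.reg 21 = b₁ at *
      generalize s₅.reg 21 = b₂ at *
      generalize q ^ L = P at *
      interval_cases b₁ <;> interval_cases b₂ <;> omega
    rw [← hUm] at hdiv
    have hm₅ : ∀ a, a ≠ 6 → a ≠ 7 → a ≠ 11 → s₅.mem a = s₂.mem a := fun a h6 h7 h11 =>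
      (hmem₅ a h7).trans (hm₄ a h6 h11)
    have r₅ : ∀ r < 20, s₅.reg r = s₂.reg r := fun r hr => by rw [hreg₅ r hr, hreg₄ r hr, hr₃]
    have f₅ : s₅.mem 11 = s₃.mem 11 := by rw [hmem₅ 11 (by simp), hmem₄ 11 (by simp)]
    -- the digits of the row
    refine Halts.seq (Halts.assign (by simp only [Fits, r₅ 12 (by simp)]; omega) (Halts.seq
      (Halts.assign (by simp only [Fits]; omega) (Halts.seq
      (Halts.assign (by simp [Fits, r₅ 14 (by simp)]; omega) ?_)))))
    refine Halts.seq (Halts.mono (copyProg_spec (i := n * (n - (N + 1))) (j := 0) (m := N - κ)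
      (by simp [eval, r₅, r12]) (by simp [eval]) (by simp [eval, r₅, r14]) (by simp) (by omega)
      (by omega) fun c _ => ?_) ?_)
    · have := hU.lt hq c
      simp only [State.setReg_mem, zero_add]
      omega
    rintro t₆ s₆ ⟨ht₆, hreg₆, hmem₆, hrec₆⟩
    simp only [State.setReg_mem, zero_add] at hmem₆ hrec₆
    have r₆ : ∀ r < 20, s₆.reg r = s₂.reg r := fun r hr => by
      rw [hreg₆ r hr, ← r₅ r hr]
      simp [show r ≠ 26 by omega, show r ≠ 27 by omega, show r ≠ 28 by omega]
    have hE₆ := hE₂.congr fun r hr => r₆ r (by omega)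
    have hU₆ := hU.congr (hmem₆ 7 (by simp))
    have f5 := hE₆.reg5
    -- the number of the remaining matrix
    refine Halts.seq (Halts.assign (by simp only [Fits]; omega) (Halts.seq
      (Halts.assign (by simp [Fits, r₆ 14 (by simp)]; omega) (Halts.seq
      (Halts.assign (by simp [Fits]; omega) ?_)))))
    refine Halts.seq (Halts.mono (copyProg_spec (i := 0) (j := N - κ) (m := L)
      (by simp [eval]) (by simp [eval, r₆, r14]) (by simp [eval, f5]) (by simp) (by omega)
      (by omega) fun c _ => ?_) ?_)
    · have := hU₆.lt hq (N - κ + c)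
      simp only [State.setReg_mem]
      omega
    rintro t₇ s₇ ⟨ht₇, hreg₇, hmem₇, hnum₇⟩
    simp only [State.setReg_mem, zero_add, Nat.zero_le, true_and, Nat.sub_zero] at hmem₇ hnum₇
    have r₇ : ∀ r < 20, s₇.reg r = s₂.reg r := fun r hr => by
      rw [hreg₇ r hr, ← r₆ r hr]
      simp [show r ≠ 26 by omega, show r ≠ 27 by omega, show r ≠ 28 by omega]
    have hE₇ := hE₂.congr fun r hr => r₇ r (by omega)
    have hm₇ : ∀ a, a ≠ 0 → a ≠ 6 → a ≠ 7 → a ≠ 10 → a ≠ 11 → s₇.mem a = s₂.mem a :=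
      fun a h0 h6 h7 h10 h11 => by rw [hmem₇ a h0, hmem₆ a h10, hm₅ a h6 h7 h11]
    -- Division by the power of q is a copy from the cell N - κ on. Copying L cells brings in zeros
    -- beyond the last digit, which erase the old high digits.
    have hN₇ : Holds q L s₇ 0 (U / q ^ (N - κ)) := by
      refine ⟨hdiv.trans_lt hH, funext fun c => ?_⟩
      rw [hnum₇, digit_div_pow]
      split_ifs with hc
      · rw [hU₆.2]
      · rw [hmem₆ 0 (by simp), hm₅ 0 (by simp) (by simp) (by simp), g0.2,
          digit_eq_zero g0.1 (by omega), digit_eq_zero hU.1 (by omega)]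
    have hr11 : eval s₇ (reg 11) = κ + 1 := (r₇ 11 (by simp)).trans r11
    refine Halts.seq (Halts.assign (by simp only [Fits]; simp only [eval] at hr11; omega) ?_)
    rw [hr11]
    have hE₈ := hE₇.setReg 14 (κ + 1) (by simp)
    refine Halts.seq (Halts.mono (mulDivProg_spec' (a := κ + 1) (b := N + 1)
      (g := gaussRec q (N + 1) (κ + 1)) (h := gaussRec q N κ) hB hE₈ (by simp)
      (by simp [r₇, r15]) (by omega) (by omega) (by omega) (by simp) (by simp)
      (g2.congr (hm₇ 2 (by simp) (by simp) (by simp) (by simp) (by simp)))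
      (h12₂.congr (hm₇ 12 (by simp) (by simp) (by simp) (by simp) (by simp)))
      (hA₂.congr (hm₇ 4 (by simp) (by simp) (by simp) (by simp) (by simp)))
      ((gaussRec_mul_pow_sub_one (by omega) hle).2 κ rfl) hH) ?_)
    rintro t₉ s₉ ⟨ht₉, hreg₉, hmem₉, hw₉, hH₉⟩
    simp only [State.setReg_mem] at hmem₉
    have hE₉ := hE₈.congr fun r hr => hreg₉ r (by omega)
    refine Halts.seq (Halts.mono (subCall_spec (a := 0) hB hE₉ (by simp only [Fits]; omega)
      (by simp [eval]) (by omega) (by simp) (by simp) (by simp)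
      (hN₇.congr (hmem₉ 0 (by simp) (by simp))) hH₉ (hV.congr ((hmem₉ 3 (by simp) (by simp)).trans
        (hm₇ 3 (by simp) (by simp) (by simp) (by simp) (by simp))))) ?_)
    rintro t₁₀ s₁₀ ⟨ht₁₀, hreg₁₀, hmem₁₀, hbor₁₀, V', hV', heq₁₀⟩
    rw [pow_zero, mul_one, Nat.mod_eq_of_lt hN₇.1, add_zero] at heq₁₀
    have hE₁₀ := hE₉.congr fun r hr => hreg₁₀ r (by omega)
    have r₁₀ : ∀ r < 20, r ≠ 14 → s₁₀.reg r = s₂.reg r := fun r hr h14 => by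
      rw [hreg₁₀ r hr, hreg₉ r hr, ← r₇ r hr]
      simp [h14]
    have hm₁₀ : ∀ a, a ≠ 3 → a ≠ 4 → a ≠ 12 → s₁₀.mem a = s₇.mem a := fun a h3 h4 h12 => by
      rw [hmem₁₀ a h3, hmem₉ a h4 h12]
    have hN₁₀ : Holds q L s₁₀ 0 (U / q ^ (N - κ)) :=
      hN₇.congr (hm₁₀ 0 (by simp) (by simp) (by simp))
    have hHpos : 0 < gaussRec q N κ := gaussRec_pos (by omega) hκN
    -- the common end of both subcases
    have finish' : ∀ t₁₁ s₁₁, t₁₁ ≤ t + (960 * L + 890) → (∀ r < 20, s₁₁.reg r = s₁₀.reg r) →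
        (∀ a, a ≠ 0 → s₁₁.mem a = s₁₀.mem a) →
        Holds q L s₁₁ 0 (U / q ^ (N - κ) % gaussRec q N κ) →
        Halts B (.assign 11 (sub (reg 11) (const 1))) t₁₁ s₁₁ fun t' s' =>
        Halts B (.seq (moveProg 2 4) (.assign 12 (add (reg 12) (reg 1)))) t' s' fun t' s' =>
        t' ≤ t + (1000 * L + 1000) ∧
        ∃ κ' m', EncodeState q n k z o L N κ' m' s' ∧
        (∀ i, i ≠ N → s'.mem 11 i = s.mem 11 i) ∧
        (∀ i, i < n * (n - (N + 1)) → s'.mem 10 i = s.mem 10 i) ∧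
        ∀ flag rec, flag N = s'.mem 11 N → (∀ i < n * (n - N), rec i = s'.mem 10 i) →
          IsTrace q n flag rec N κ' m' → IsTrace q n flag rec (N + 1) (κ + 1) m := by
      intro t₁₁ s₁₁ ht hr hmem hnum
      have i11 : s₁₁.reg 11 = κ + 1 := by rw [hr 11 (by simp), r₁₀ 11 (by simp) (by simp), r11]
      have m₁₁ : ∀ a, a ≠ 0 → a ≠ 3 → a ≠ 4 → a ≠ 12 → s₁₁.mem a = s₇.mem a :=
        fun a h0 h3 h4 h12 => (hmem a h0).trans (hm₁₀ a h3 h4 h12)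
      have m₁₁' : ∀ a, a ≠ 0 → a ≠ 3 → a ≠ 4 → a ≠ 6 → a ≠ 7 → a ≠ 10 → a ≠ 11 → a ≠ 12 →
          s₁₁.mem a = s₂.mem a := fun a h0 h3 h4 h6 h7 h10 h11 h12 =>
        (m₁₁ a h0 h3 h4 h12).trans (hm₇ a h0 h6 h7 h10 h11)
      have fl : s₁₁.mem 11 = s₃.mem 11 := by
        rw [m₁₁ 11 (by simp) (by simp) (by simp) (by simp), hmem₇ 11 (by simp),
          hmem₆ 11 (by simp), f₅]
      have rc : ∀ c, s₁₁.mem 10 c = if n * (n - (N + 1)) ≤ c ∧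
          c < n * (n - (N + 1)) + (N - κ) then digit q U (c - n * (n - (N + 1)))
          else s.mem 10 c := fun c => by
        rw [m₁₁ 10 (by simp) (by simp) (by simp) (by simp), hmem₇ 10 (by simp), hrec₆, hU.2,
          hm₅ 10 (by simp) (by simp) (by simp), g10]
      refine Halts.assign (by simp only [Fits]; omega)
        (finish _ _ κ _ _ (by simp only [cost]; omega)
        ((hE₁₀.congr fun r h => hr r (by omega)).setReg _ _ (by simp)) ?_ ?_ ?_ hκN (by omega)
        (Nat.mod_lt (U / q ^ (N - κ)) hHpos) (by exact hnum)
        (g2.congr (m₁₁' 2 (by simp) (by simp) (by simp) (by simp) (by simp) (by simp) (by simp)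
          (by simp)))
        (hH₉.congr ((hmem 4 (by simp)).trans (hmem₁₀ 4 (by simp))))
        ⟨_, hV'.congr (hmem 3 (by simp))⟩
        ⟨W, hW.congr ((m₁₁ 6 (by simp) (by simp) (by simp) (by simp)).trans
          ((hmem₇ 6 (by simp)).trans ((hmem₆ 6 (by simp)).trans (hmem₅ 6 (by simp)))))⟩
        ⟨U, hU.congr ((m₁₁ 7 (by simp) (by simp) (by simp) (by simp)).trans
          ((hmem₇ 7 (by simp)).trans (hmem₆ 7 (by simp))))⟩
        (hw₉.imp fun w h => h.congr ((hmem 12 (by simp)).trans (hmem₁₀ 12 (by simp))))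
        (g8.congr (m₁₁' 8 (by simp) (by simp) (by simp) (by simp) (by simp) (by simp) (by simp)
          (by simp))) (fun i hi => ?_) (fun a ha => ?_) (fun i hi => ?_) ?_)
      · simp [hr, r₁₀, r10]
      · simp [eval, i11]
      · simp [hr, r₁₀, r12]
      · rw [State.setReg_mem, fl, hf₃, if_neg hi]
      · rw [State.setReg_mem, m₁₁' a (by omega) (by omega) (by omega) (by omega) (by omega)
          (by omega) (by omega) (by omega), hm₂ a (by omega) (by omega) (by omega)]
      · rw [State.setReg_mem, rc, if_neg (by omega)]
      · rw [State.setReg_mem]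
        intro flag rec hf hrec htr
        refine .inr ⟨κ, rfl, hκN, ?_, hAm, hm, fun l hl => ?_, ?_⟩
        · rw [hf, fl, hf₃, if_pos rfl]
        · rw [show n - 1 - N = n - (N + 1) by omega, hrec _ (by omega), rc, if_pos (by omega),
            Nat.add_sub_cancel_left, hUm]
        · rw [← hUm]
          exact htr
    refine Halts.seq (Halts.ite (by simp only [Fits]; omega) (by simp only [Fits]; omega)
      (fun h => ?_) fun h => ?_)
    · simp only [eval] at h
      have hb : s₁₀.reg 21 = 1 := by omega
      refine Halts.skip (finish' _ _ (by simp only [cost] at *; omega) (fun _ _ => rfl)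
        (fun _ _ => rfl) ?_)
      rw [Nat.mod_eq_of_lt]
      · exact hN₁₀
      · rw [hb, mul_one] at heq₁₀
        have := hV'.1
        omega
    · simp only [eval] at h
      have hb : s₁₀.reg 21 = 0 := by omega
      rw [hb, mul_zero, add_zero] at heq₁₀
      have hV0 : V' = 0 := by omega
      -- The quotient is at least and at most the coefficient, hence equal to it. The difference in
      -- the array `3` is 0, which is also the reduced number.
      have hUH : U / q ^ (N - κ) = gaussRec q N κ := by omega
      rw [hV0] at hV'
      refine Halts.mono (moveProg_spec hB hE₁₀ (by simp) hV' hN₁₀) ?_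
      rintro t₁₁ s₁₁ ⟨ht₁₁, hreg₁₁, hmem₁₁, h₁₁⟩
      refine finish' _ _ (by simp only [cost] at *; omega) hreg₁₁ hmem₁₁ ?_
      rw [hUH, Nat.mod_self]
      exact h₁₁

end EncodeDown

end GrassGray

namespace GrassGray

open WordExpr

/-! ### The complete trace of the encoding recursion -/

section EncodeTrace

variable {B q n k z o L : ℕ}

/-- The first part of the encoding program: the steps of the recursion are recorded. -/
def traceProg : Prog :=
  .seq (.assign 10 (reg 1)) <| .seq (.assign 11 (reg 2)) <| .seq (.assign 12 (const 0)) <|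
  .loop (const 0) (reg 10) encodeStep

theorem traceProg_spec {s : State} {t m : ℕ} (hB : Bounds B q n k z o L) (hE : Env q n k z o L s)
    (hm : m < gaussRec q n k) (h0 : Holds q L s 0 m) (h2 : Holds q L s 2 (gaussRec q n k))
    (h12 : ∃ w, Holds q L s 12 w) (hz : ∀ a, a ≠ 0 → a ≠ 2 → a ≠ 12 → ∀ i, s.mem a i = 0) :
    Halts B traceProg t s fun t' s' =>
      t' ≤ t + (n * (1000 * L + 1010) + 20) ∧ Env q n k z o L s' ∧ s'.reg 10 = 0 ∧
      s'.reg 12 = n * n ∧ (∀ a, a = 5 ∨ a = 9 → ∀ i, s'.mem a i = 0) ∧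
      IsTrace q n (s'.mem 11) (s'.mem 10) n k m := by
  have hlt := hB.lt
  have hkn := hB.le
  have hq := hB.two_le
  have e1 := hE.reg1
  have e2 := hE.reg2
  refine Halts.seq (Halts.assign (by simp only [Fits]; omega) (Halts.seq (Halts.assign
    (by simp [Fits]; omega) (Halts.seq (Halts.assign (by simp only [Fits]; omega) ?_)))))
  -- A trace from the present level downwards does not exist yet, so the invariant is an
  -- implication: such a trace, with the cells recorded so far, yields one for the whole recursion.
  refine Halts.loop (fun i s' => ∃ κ m', EncodeState q n k z o L (n - i) κ m' s' ∧
    ∀ flag rec, (∀ N, n - i ≤ N → N < n → flag N = s'.mem 11 N) →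
      (∀ x < n * (n - (n - i)), rec x = s'.mem 10 x) →
      IsTrace q n flag rec (n - i) κ m' → IsTrace q n flag rec n k m) n (1000 * L + 1000)
      ?_ ?_ ?_ ?_
  · refine ⟨k, m, ?_, fun flag rec _ _ h => h⟩
    exact {
      env := ((hE.setReg _ _ (by simp)).setReg _ _ (by simp)).setReg _ _ (by simp)
      reg10 := by simp [eval, e1]
      reg11 := by simp [eval, e2]
      reg12 := by simp [eval]
      le := hkn
      le' := le_rfl
      lt := hm
      number := h0
      gauss := h2
      tmp3 := ⟨0, holds_zero hq (hz 3 (by simp) (by simp) (by simp))⟩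
      tmp4 := ⟨0, holds_zero hq (hz 4 (by simp) (by simp) (by simp))⟩
      tmp6 := ⟨0, holds_zero hq (hz 6 (by simp) (by simp) (by simp))⟩
      tmp7 := ⟨0, holds_zero hq (hz 7 (by simp) (by simp) (by simp))⟩
      tmp12 := h12
      zero := holds_zero hq (hz 8 (by simp) (by simp) (by simp))
      flag := fun i _ => hz 11 (by simp) (by simp) (by simp) i
      unused := fun a ha i => hz a (by omega) (by omega) (by omega) i }
  · rintro i hi s₁ ⟨κ, m', hs, htr⟩
    obtain ⟨N, hN⟩ : ∃ N, n - i = N + 1 := ⟨n - i - 1, by omega⟩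
    have hN' : n - (i + 1) = N := by omega
    rw [hN] at hs htr
    rw [hN']
    have e10 := hs.reg10
    refine ⟨by simp only [Fits]; omega, by simp only [Fits]; omega, by simp only [eval]; omega,
      fun t₁ => ?_⟩
    refine Halts.mono (encodeStep_lt hB (by omega) hs) ?_
    rintro t₂ s₂ ⟨ht₂, κ', m'', hs₂, hflag, hrec, htr₂⟩
    refine ⟨ht₂, κ', m'', hs₂, fun flag rec hf hr h => htr flag rec (fun N' h1 h2 => ?_)
      (fun x hx => ?_) (htr₂ flag rec (hf N le_rfl (by omega)) hr h)⟩
    · rw [hf N' (by omega) h2, hflag N' (by omega)]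
    · rw [hr x (hx.trans_le (Nat.mul_le_mul_left n (by omega))), hrec x hx]
  · rintro s₁ ⟨κ, m', hs, -⟩
    have e10 := hs.reg10
    exact ⟨by simp only [Fits]; omega, by simp only [Fits]; omega, by simp only [eval]; omega⟩
  · rintro t' s' ht ⟨κ, m', hs, htr⟩
    rw [Nat.sub_self] at hs htr
    refine ⟨?_, hs.env, hs.reg10, by simpa using hs.reg12, hs.unused, htr _ _ (fun _ _ _ => rfl)
      (fun _ _ => rfl) (by have := hs.le; simp only [IsTrace]; omega)⟩
    simp only [cost] at ht
    have : n * (1000 * L + 1000 + (1 + 1 + 1)) ≤ n * (1000 * L + 1010) :=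
      Nat.mul_le_mul_left _ (by omega)
    omega

end EncodeTrace

end GrassGray

namespace GrassGray

open WordExpr

/-! ### The second part of the encoding program: the rows -/

section EncodeRows

variable {F : Type*} [Field F] [DecidableEq F] [Fintype F] {α : Fin (Fintype.card F) ≃ F}

local notation "qF" => Fintype.card F

/-- The step from the columns with index smaller than `reg 10` to the next column. -/
def rowsStep : Prog :=
  .seq (.assign 12 (sub (reg 12) (reg 1))) <|
  .seq (.ite (const 0) (load 11 (reg 10))
    (.seq (scanProg 10 12 17 5 13 18) <|
    .seq (.store 5 (add (reg 13) (reg 10)) (reg 4)) <|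
    .seq (.store 9 (reg 16) (add (reg 13) (const 1))) <|
    .assign 13 (add (reg 13) (reg 1)))
    .skip) <|
  .assign 10 (add (reg 10) (const 1))

variable (α) in
/-- The rows of the matrix `X` are stored in the array `5`. The mark of a leading column in the
array `9` is the successor of the address of the row. -/
structure RowsState (n k L : ℕ) (flag rec : ℕ → ℕ) {κ N : ℕ} (X : Matrix (Fin κ) (Fin N) F)
    (s : State) : Prop where
  env : Env qF n k (α.symm 0) (α.symm 1) L s
  reg10 : s.reg 10 = N
  reg12 : s.reg 12 = n * (n - N)
  reg13 : s.reg 13 = n * κ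
  flag : s.mem 11 = flag
  record : s.mem 10 = rec
  mark : ∀ c : Fin N, s.mem 9 c ≠ 0 ↔ c ∈ leadCols X
  mark_zero : ∀ c, N ≤ c → s.mem 9 c = 0
  mark_le : ∀ c, s.mem 9 c ≤ n * k
  base_le : ∀ r (c : Fin N), IsLead X r c → s.mem 9 c - 1 + n ≤ n * κ
  entry : ∀ r (c : Fin N), IsLead X r c → ∀ c' : Fin N,
    s.mem 5 (s.mem 9 c - 1 + c') = α.symm (X r c')
  entry_zero : ∀ r (c : Fin N), IsLead X r c → ∀ c', N ≤ c' → c' < n →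
    s.mem 5 (s.mem 9 c - 1 + c') = α.symm 0
  fresh : ∀ x, n * κ ≤ x → x < L → s.mem 5 x = α.symm 0

/-- Nothing has to be written for a zero column, since the cells to the right of the stored columns
already contain the word for 0. -/
theorem rowsStep_col {B n k L κ N t : ℕ} {flag rec : ℕ → ℕ}
    (hB : Bounds B qF n k (α.symm 0) (α.symm 1) L) {C : Matrix (Fin κ) (Fin N) F} {s : State}
    (hN : N < n) (hf : flag N = 0) (hs : RowsState α n k L flag rec C s) :
    Halts B rowsStep t s fun t' s' =>
      t' ≤ t + (80 * n + 80) ∧ RowsState α n k L flag rec (appendZero C) s' := by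
  have hlt := hB.lt
  have hnn : n * (n - N) ≤ n * n := Nat.mul_le_mul_left n (by omega)
  have hsub : n * (n - N) = n * (n - (N + 1)) + n := by
    rw [← Nat.mul_succ]
    congr 1
    omega
  have e1 := hs.env.reg1
  have e10 := hs.reg10
  have e12 := hs.reg12
  refine Halts.seq (Halts.assign (by simp only [Fits]; omega) (Halts.seq (Halts.ite
    (by simp only [Fits]; omega) ?_ (fun h => ?_) fun _ => Halts.skip (Halts.assign ?_
    ⟨by simp only [cost]; omega, ?_⟩))))
  · simp only [Fits, eval, State.setReg_mem, State.setReg_reg, hs.flag]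
    simp [e10, hf]
    omega
  · simp [eval, hs.flag, e10, hf] at h
  · simp [Fits, eval, e10]
    omega
  · have hlead : ∀ r (c : Fin (N + 1)), IsLead (appendZero C) r c →
        ∃ c' : Fin N, c = c'.castSucc ∧ IsLead C r c' := fun r c h => by
      induction c using Fin.lastCases with
      | last => exact absurd h not_isLead_appendZero_last
      | cast c => exact ⟨c, rfl, isLead_appendZero_castSucc.1 h⟩
    exact {
      env := (hs.env.setReg _ _ (by simp)).setReg _ _ (by simp)
      reg10 := by simp [eval, e10]
      reg12 := by simp [eval, e12, e1, hsub]
      reg13 := by simp [hs.reg13]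
      flag := hs.flag
      record := hs.record
      mark := fun c => by
        simp only [State.setReg_mem]
        induction c using Fin.lastCases with
        | last => simp [hs.mark_zero, not_isLead_appendZero_last]
        | cast c => simpa [isLead_appendZero_castSucc] using hs.mark c
      mark_zero := fun c hc => hs.mark_zero c (by omega)
      mark_le := hs.mark_le
      base_le := fun r c h => by
        obtain ⟨c, rfl, hr⟩ := hlead r c h
        exact hs.base_le r c hr
      entry := fun r c h c' => by
        obtain ⟨c, rfl, hr⟩ := hlead r c h
        induction c' using Fin.lastCases with
        | last =>
          rw [appendZero_last]
          exact hs.entry_zero r c hr N le_rfl hN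
        | cast c' =>
          rw [appendZero_castSucc]
          exact hs.entry r c hr c'
      entry_zero := fun r c h c' h1 h2 => by
        obtain ⟨c, rfl, hr⟩ := hlead r c h
        exact hs.entry_zero r c hr c' (by omega) h2
      fresh := hs.fresh }

/-- Rows are stored in the order of their creation and never moved; only the mark of the leading
column records where a row is. So the position `i` of the insertion does not matter here, and the
step costs O(n). -/
theorem rowsStep_row {B n k L κ N U t : ℕ} {flag rec : ℕ → ℕ}
    (hB : Bounds B qF n k (α.symm 0) (α.symm 1) L) {C : Matrix (Fin κ) (Fin N) F} {s : State}
    (hN : N < n) (hκ : κ < k) (hC : Echelon C) (i : Fin (κ + 1)) (hf : flag N = 1)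
    (hrec : ∀ l < N - κ, rec (n * (n - 1 - N) + l) = digit qF U l)
    (hs : RowsState α n k L flag rec C s) :
    Halts B rowsStep t s fun t' s' => t' ≤ t + (80 * n + 80) ∧
      RowsState α n k L flag rec
        (insertRow i (newVector α C (U % qF ^ (N - κ))) (appendZero C)) s' := by
  have hlt := hB.lt
  have hdig := hB.digits
  have hnn : n * (n - N) ≤ n * n := Nat.mul_le_mul_left n (by omega)
  have hsub : n * (n - N) = n * (n - (N + 1)) + n := by
    rw [← Nat.mul_succ]
    congr 1
    omega
  have hκk : n * (κ + 1) ≤ n * k := Nat.mul_le_mul_left n hκ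
  rw [Nat.mul_succ] at hκk
  have e1 := hs.env.reg1
  have e10 := hs.reg10
  have e12 := hs.reg12
  have e13 := hs.reg13
  have hw : eval s ((reg 12).sub (reg 1)) = n * (n - (N + 1)) := by
    simp only [eval, e12, e1]
    omega
  have hfree : ∀ c ∉ leadCols C, freeRank C c < N - κ := fun c hc => by
    have h1 := freeRank_succ C c
    rw [if_neg hc] at h1
    have h2 := freeRank_mono C (Nat.succ_le_of_lt c.2)
    rw [freeRank_self, hC.card_compl_leadCols, Nat.succ_eq_add_one] at h2
    omega
  set v := newVector α C (U % qF ^ (N - κ)) with hv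
  -- The record has the digits of the unreduced number `U`; those used have index below N - κ, where
  -- reduction modulo the power of q changes nothing.
  have hvc : ∀ c ∉ leadCols C,
      rec (n * (n - (N + 1)) + freeRank C c) = α.symm (v c.castSucc) := fun c hc => by
    rw [show n - (N + 1) = n - 1 - N by omega, hrec _ (hfree c hc), hv, newVector_castSucc,
      if_neg hc, Equiv.symm_apply_apply]
    exact (digit_mod_pow (hfree c hc)).symm
  have hvl : ∀ c ∈ leadCols C, v c.castSucc = 0 := fun c hc => by
    rw [hv, newVector_castSucc, if_pos hc]
  have hvlast : v (Fin.last N) = 1 := newVector_last α C _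
  obtain ⟨p, hp, hp', hpl⟩ : ∃ c, v c ≠ 0 ∧ (∀ c' < c, v c' = 0) ∧ c ∉ leadCols (appendZero C) :=
    exists_isLead_newVector α C _
  have hpN := p.2
  refine Halts.seq (Halts.assign (by simp only [Fits]; omega) ?_)
  rw [hw]
  have hE₁ := hs.env.setReg 12 (n * (n - (N + 1))) (by simp)
  refine Halts.seq (Halts.ite (by simp only [Fits]; omega) ?_ (fun _ => ?_) fun h => ?_)
  · simp only [Fits, eval, State.setReg_mem, State.setReg_reg, hs.flag]
    simp [e10, hf]
    omega
  · refine Halts.seq (Halts.mono (scanProg_spec (C := C) (lead := p)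
      (f := fun c => n * (n - (N + 1)) + freeRank C c) (g := fun c => n * κ + c) hB hE₁
      (by simp [e10]) hN.le hs.mark (fun c => ?_) (by simp) (by simp) (by simp) (by simp)
      (by simp) (by simp) ?_ ?_ (by simp) (by simp [e13]) ?_ (by omega) ?_ ?_) ?_)
    · have := hs.mark_le c
      simp only [State.setReg_mem]
      omega
    · simp
      omega
    · simp [e13]
      omega
    · intro c hc
      rw [State.setReg_mem, hs.record, hvc c hc]
      exact Fin.is_lt _
    · intro c hc hcp
      rw [State.setReg_mem, hs.record, hvc c hc, hp' _ (by simpa [Fin.lt_def] using hcp)]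
    · intro c hc
      have hcp : c.castSucc = p := Fin.ext hc
      have hcl : c ∉ leadCols C := fun h => hp (by rw [← hcp, hvl c h])
      refine ⟨hcl, ?_⟩
      rw [State.setReg_mem, hs.record, hvc c hcl, hcp]
      exact fun h => hp (α.symm.injective (Fin.ext h))
    rintro t₁ s₁ ⟨ht₁, hreg₁, -, hmem₁, h16₁, hrow₁, hrow₁'⟩
    simp only [State.setReg_mem] at hmem₁ hrow₁ hrow₁'
    have hE₂ := hE₁.congr fun r hr => hreg₁ r (by omega)
    have f1 := hE₂.reg1
    have f4 := hE₂.reg4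
    have hoq := hB.one_lt
    have f10 : s₁.reg 10 = N := by rw [hreg₁ 10 (by simp)]; simp [e10]
    have f12 : s₁.reg 12 = n * (n - (N + 1)) := by rw [hreg₁ 12 (by simp)]; simp
    have f13 : s₁.reg 13 = n * κ := by rw [hreg₁ 13 (by simp)]; simp [e13]
    refine Halts.seq (Halts.store (by simp only [Fits, eval]; omega) (by simp only [Fits]; omega)
      (Halts.seq (Halts.store (by simp only [Fits, State.setMem_reg]; omega)
      (by simp only [Fits, eval, State.setMem_reg]; omega) (Halts.assign
      (by simp only [Fits, eval, State.setMem_reg]; omega) (Halts.assign ?_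
      ⟨by simp only [cost] at *; omega, ?_⟩)))))
    · simp [Fits, eval, f10]
      omega
    have v1 : eval s₁ ((reg 13).add (reg 10)) = n * κ + N := by simp [eval, f13, f10]
    have v2 : eval s₁ (reg 4) = (α.symm 1 : ℕ) := f4
    rw [v1, v2]
    have w1 : eval (s₁.setMem 5 (n * κ + N) (α.symm 1)) (reg 16) = p := h16₁
    have w2 : eval (s₁.setMem 5 (n * κ + N) (α.symm 1)) ((reg 13).add (const 1)) = n * κ + 1 := by
      simp [eval, f13]
    rw [w1, w2]
    set s₂ := (s₁.setMem 5 (n * κ + N) (α.symm 1)).setMem 9 p (n * κ + 1) with hs₂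
    have r₂ : s₂.reg = s₁.reg := rfl
    have m9 : ∀ c, s₂.mem 9 c = if c = p then n * κ + 1 else s.mem 9 c := fun c => by
      rw [hs₂, State.setMem_mem_self, State.setMem_mem_ne _ (by simp), hmem₁ 9 (by simp)]
    have m5 : ∀ c, s₂.mem 5 c = if c = n * κ + N then (α.symm 1 : ℕ) else s₁.mem 5 c := fun c => by
      rw [hs₂, State.setMem_mem_ne _ (by simp), State.setMem_mem_self]
    have mo : ∀ a, a ≠ 5 → a ≠ 9 → s₂.mem a = s.mem a := fun a h5 h9 => by
      rw [hs₂, State.setMem_mem_ne _ h9, State.setMem_mem_ne _ h5, hmem₁ a h5]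
    have m5' : ∀ c, c < n * κ ∨ n * κ + N < c → s₂.mem 5 c = s.mem 5 c := fun c hc => by
      rw [m5, if_neg (by omega), hrow₁' c fun c' _ => by have := c'.2; omega]
    have m5v : ∀ c : Fin (N + 1), s₂.mem 5 (n * κ + c) = α.symm (v c) := fun c => by
      rw [m5]
      induction c using Fin.lastCases with
      | last => rw [Fin.val_last, if_pos rfl, hvlast]
      | cast c =>
        have := c.2
        rw [Fin.val_castSucc, if_neg (by omega)]
        by_cases hc : c ∈ leadCols C
        -- The scan skips the leading columns, so the fresh word for 0 remains there, in accordance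
        -- with the zeros of `v`.
        · rw [hrow₁' _ fun c' hc' h => ?_, hs.fresh _ (by omega) (by omega), hvl c hc]
          have : c = c' := Fin.ext (by omega)
          exact hc' (this ▸ hc)
        · rw [hrow₁ c hc, hs.record, hvc c hc]
    have hlead : ∀ r (c : Fin (N + 1)), IsLead (insertRow i v (appendZero C)) r c →
        (r = i ∧ c = p) ∨ ∃ (r' : Fin κ) (c' : Fin N), r = i.succAbove r' ∧ c = c'.castSucc ∧
          IsLead C r' c' := fun r c h => by
      induction r using Fin.succAboveCases i with
      | x =>
        left
        refine ⟨rfl, h.unique ⟨?_, fun c' hc' => ?_⟩⟩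
        · rwa [insertRow_self]
        · rw [insertRow_self, hp' c' hc']
      | p r =>
        right
        have h' : IsLead (appendZero C) r c := by simpa only [IsLead, insertRow_succAbove] using h
        induction c using Fin.lastCases with
        | last => exact absurd h' not_isLead_appendZero_last
        | cast c => exact ⟨r, c, rfl, rfl, isLead_appendZero_castSucc.1 h'⟩
    have hleadp : IsLead (insertRow i v (appendZero C)) i p := by
      refine ⟨by rwa [insertRow_self], fun c' hc' => by rw [insertRow_self, hp' c' hc']⟩
    have hleadC : ∀ r c, IsLead C r c → (c : ℕ) ≠ p ∧
        IsLead (insertRow i v (appendZero C)) (i.succAbove r) c.castSucc := fun r c h => by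
      have h' := isLead_appendZero_castSucc.2 h
      refine ⟨fun hcp => hpl (mem_leadCols.2 ⟨r, ?_⟩), by
        simpa only [IsLead, insertRow_succAbove] using h'⟩
      rwa [show p = c.castSucc from Fin.ext hcp.symm]
    have hs9 : ∀ r c, IsLead C r c → s₂.mem 9 c = s.mem 9 c := fun r c h => by
      rw [m9, if_neg (hleadC r c h).1]
    have base := hs.base_le
    have hκ1 : n * (κ + 1) = n * κ + n := Nat.mul_succ n κ
    exact {
      env := ((((hE₂.setMem _ _ _).setMem _ _ _).setReg _ _ (by simp)).setReg _ _ (by simp))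
      reg10 := by simp [eval, r₂, f10]
      reg12 := by simp [r₂, f12]
      reg13 := by simp [eval, r₂, f13, f1, hκ1]
      flag := (mo 11 (by simp) (by simp)).trans hs.flag
      record := (mo 10 (by simp) (by simp)).trans hs.record
      mark := fun c => by
        simp only [State.setReg_mem]
        rw [m9, mem_leadCols]
        split_ifs with hc
        · simp only [ne_eq, Nat.add_eq_zero_iff, one_ne_zero, and_false, not_false_eq_true, true_iff]
          exact ⟨i, by rwa [Fin.ext hc]⟩
        · constructor
          · intro h
            induction c using Fin.lastCases with
            | last => exact absurd (hs.mark_zero N le_rfl) h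
            | cast c =>
              obtain ⟨r, hr⟩ := mem_leadCols.1 ((hs.mark c).1 h)
              exact ⟨_, (hleadC r c hr).2⟩
          · rintro ⟨r, hr⟩
            rcases hlead r c hr with ⟨-, rfl⟩ | ⟨r, c, -, rfl, hr'⟩
            · exact absurd rfl hc
            · exact (hs.mark c).2 (mem_leadCols.2 ⟨r, hr'⟩)
      mark_zero := fun c hc => by
        simp only [State.setReg_mem]
        rw [m9, if_neg (by omega), hs.mark_zero c (by omega)]
      mark_le := fun c => by
        simp only [State.setReg_mem]
        rw [m9]
        have := hs.mark_le c
        split_ifs <;> omega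
      base_le := fun r c h => by
        simp only [State.setReg_mem]
        rcases hlead r c h with ⟨-, rfl⟩ | ⟨r, c, -, rfl, hr⟩
        · rw [m9, if_pos rfl]
          omega
        · have := base r c hr
          rw [Fin.val_castSucc, hs9 r c hr]
          omega
      entry := fun r c h c' => by
        simp only [State.setReg_mem]
        rcases hlead r c h with ⟨rfl, rfl⟩ | ⟨r, c, rfl, rfl, hr⟩
        · rw [m9, if_pos rfl, insertRow_self, Nat.add_sub_cancel]
          exact m5v c'
        · have := base r c hr
          have := c'.2
          rw [Fin.val_castSucc, hs9 r c hr, m5' _ (by omega), insertRow_succAbove]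
          induction c' using Fin.lastCases with
          | last =>
            rw [appendZero_last]
            exact hs.entry_zero r c hr N le_rfl hN
          | cast c' =>
            rw [appendZero_castSucc]
            exact hs.entry r c hr c'
      entry_zero := fun r c h c' h1 h2 => by
        simp only [State.setReg_mem]
        rcases hlead r c h with ⟨rfl, rfl⟩ | ⟨r, c, rfl, rfl, hr⟩
        · rw [m9, if_pos rfl, Nat.add_sub_cancel, m5' _ (by omega)]
          exact hs.fresh _ (by omega) (by omega)
        · have := base r c hr
          rw [Fin.val_castSucc, hs9 r c hr, m5' _ (by omega)]
          exact hs.entry_zero r c hr c' (by omega) h2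
      fresh := fun x h1 h2 => by
        simp only [State.setReg_mem]
        rw [m5' _ (by omega)]
        exact hs.fresh x (by omega) h2 }
  · simp [eval, hs.flag, e10, hf] at h

end EncodeRows

end GrassGray

namespace GrassGray

open WordExpr

/-! ### The complete encoding program -/

section EncodeProg

variable {F : Type*} [Field F] [DecidableEq F] [Fintype F] {α : Fin (Fintype.card F) ≃ F}

local notation "qF" => Fintype.card F

/-- The first cells of the array `5` are filled with the word for `0`. -/
def fillProg : Prog :=
  .seq (.assign 6 (const 0)) <| .loop (reg 6) (reg 5) <|
  .seq (.store 5 (reg 6) (reg 3)) <| .assign 6 (add (reg 6) (const 1))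

/-- The word for the zero of the field depends on the ordering of the elements and need not be the
machine word 0, so the cells must be filled explicitly. -/
theorem fillProg_spec {B q n k z o L t : ℕ} {s : State} (hB : Bounds B q n k z o L)
    (hE : Env q n k z o L s) :
    Halts B fillProg t s fun t' s' =>
      t' ≤ t + (20 * L + 10) ∧ (∀ r, r ≠ 6 → s'.reg r = s.reg r) ∧
      (∀ b, b ≠ 5 → s'.mem b = s.mem b) ∧ ∀ x < L, s'.mem 5 x = z := by
  have hlt := hB.lt
  have hdig := hB.digits
  have hzq := hB.zero_lt
  refine Halts.seq (Halts.assign (by simp only [Fits]; omega) ?_)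
  refine Halts.loop (fun i s' => s'.reg 6 = i ∧ (∀ r, r ≠ 6 → s'.reg r = s.reg r) ∧
    (∀ b, b ≠ 5 → s'.mem b = s.mem b) ∧ ∀ x < i, s'.mem 5 x = z) L 10 ?_ ?_ ?_ ?_
  · exact ⟨by simp [eval], fun r hr => by simp [hr], fun _ _ => rfl, by simp⟩
  · rintro i hi s₁ ⟨h6, hreg, hmem, hz⟩
    have h3 : s₁.reg 3 = z := (hreg 3 (by simp)).trans hE.reg3
    have h5 : s₁.reg 5 = L := (hreg 5 (by simp)).trans hE.reg5
    refine ⟨by simp only [Fits]; omega, by simp only [Fits]; omega, by simp only [eval]; omega,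
      fun t₁ => Halts.seq (Halts.store (by simp only [Fits]; omega) (by simp only [Fits]; omega)
      (Halts.assign (by simp only [Fits, eval, State.setMem_reg]; omega)
      ⟨by simp only [cost]; omega, by simp [eval, h6], fun r hr => by simp [hr, hreg r hr],
        fun b hb => ?_, fun x hx => ?_⟩))⟩
    · rw [State.setReg_mem, State.setMem_mem_ne _ hb, hmem b hb]
    · rw [State.setReg_mem, State.setMem_mem_self]
      simp only [eval, h6, h3]
      split_ifs with h
      · rfl
      · exact hz x (by omega)
  · rintro s₁ ⟨h6, hreg, -⟩
    have h5 : s₁.reg 5 = L := (hreg 5 (by simp)).trans hE.reg5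
    exact ⟨by simp only [Fits]; omega, by simp only [Fits]; omega, by simp only [eval]; omega⟩
  · rintro t' s' ht ⟨-, hreg, hmem, hz⟩
    exact ⟨by simp only [cost] at ht; omega, hreg, hmem, hz⟩

/-- The second part of the encoding program: the rows are computed. -/
def rowsProg : Prog :=
  .seq fillProg <| .seq (.assign 13 (const 0)) <| .loop (reg 10) (reg 1) rowsStep

/-- The trace is read from its end: the matrices are built from few columns to many, but which ones
occur is determined by `m` from the top. Hence the backward form of the loop rule. -/
theorem rowsProg_spec {B n k L m t : ℕ} {s : State}
    (hB : Bounds B qF n k (α.symm 0) (α.symm 1) L)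
    (hE : Env qF n k (α.symm 0) (α.symm 1) L s) (h10 : s.reg 10 = 0) (h12 : s.reg 12 = n * n)
    (h9 : ∀ i, s.mem 9 i = 0) (htr : IsTrace qF n (s.mem 11) (s.mem 10) n k m) :
    Halts B rowsProg t s fun t' s' => t' ≤ t + (20 * L + n * (80 * n + 90) + 20) ∧
      RowsState α n k L (s.mem 11) (s.mem 10) (encode α n k m) s' := by
  have hlt := hB.lt
  have hkn := hB.le
  refine Halts.seq (Halts.mono (fillProg_spec hB hE) ?_)
  rintro t₁ s₁ ⟨ht₁, hreg₁, hmem₁, hz₁⟩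
  have hE₁ := hE.congr fun r hr => hreg₁ r (by omega)
  refine Halts.seq (Halts.assign (by simp only [Fits]; omega) ?_)
  refine Halts.loop_backward (β := fun _ => ℕ × ℕ)
    (fun N y => y.1 ≤ k ∧ y.1 ≤ N ∧ IsTrace qF n (s.mem 11) (s.mem 10) N y.1 y.2)
    (fun N y s' => RowsState α n k L (s.mem 11) (s.mem 10) (encode α N y.1 y.2) s') n
    (80 * n + 80) (k, m) ⟨le_rfl, hkn, htr⟩ ?_ ?_ ?_ ?_
  · rintro ⟨κ, m'⟩ ⟨-, -, rfl⟩
    exact {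
      env := hE₁.setReg _ _ (by simp)
      reg10 := by simp [hreg₁, h10]
      reg12 := by simp [hreg₁, h12]
      reg13 := by simp [eval]
      flag := hmem₁ 11 (by simp)
      record := hmem₁ 10 (by simp)
      mark := fun c => c.elim0
      mark_zero := fun c _ => by rw [State.setReg_mem, hmem₁ 9 (by simp), h9]
      mark_le := fun c => by rw [State.setReg_mem, hmem₁ 9 (by simp), h9]; omega
      base_le := fun r => r.elim0
      entry := fun r => r.elim0
      entry_zero := fun r => r.elim0
      fresh := fun x _ hx => hz₁ x hx }
  · rintro N hN ⟨κ, m'⟩ ⟨hκ, hκN, htr'⟩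
    have guard : ∀ {κ'} {C : Matrix (Fin κ') (Fin N) F} {s' : State},
        RowsState α n k L (s.mem 11) (s.mem 10) C s' →
        (reg 10).Fits B s' ∧ (reg 1).Fits B s' ∧ eval s' (reg 10) < eval s' (reg 1) := by
      intro κ' C s' hs
      have e1 := hs.env.reg1
      have e10 := hs.reg10
      exact ⟨by simp only [Fits]; omega, by simp only [Fits]; omega, by simp only [eval]; omega⟩
    rcases htr' with ⟨hf, hm, htr'⟩ | ⟨κ, rfl, hκN', hf, hge, hlt', hrec, htr'⟩
    · have hκN' : κ ≤ N := by
        by_contra hc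
        rw [gaussRec_eq_zero (by omega)] at hm
        omega
      refine ⟨(κ, m'), ⟨hκ, hκN', htr'⟩, fun s₂ hs₂ => ?_⟩
      obtain ⟨g1, g2, g3⟩ := guard hs₂
      refine ⟨g1, g2, g3, fun t₂ => ?_⟩
      simp only [encode_of_lt α hκN hm]
      exact rowsStep_col hB hN hf hs₂
    · refine ⟨(κ, _), ⟨(Nat.le_succ κ).trans hκ, hκN', htr'⟩, fun s₂ hs₂ => ?_⟩
      obtain ⟨g1, g2, g3⟩ := guard hs₂
      refine ⟨g1, g2, g3, fun t₂ => ?_⟩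
      simp only [encode_of_ge α hκN' hge hlt']
      exact rowsStep_row hB hN hκ (echelon_encode α hκN' _) _ hf hrec hs₂
  · intro s₂ hs₂
    have e1 := hs₂.env.reg1
    have e10 := hs₂.reg10
    exact ⟨by simp only [Fits]; omega, by simp only [Fits]; omega, by simp only [eval]; omega⟩
  · rintro t' s' ht hs'
    refine ⟨?_, hs'⟩
    simp only [cost] at ht
    have : n * (80 * n + 80 + (1 + 1 + 1)) ≤ n * (80 * n + 90) :=
      Nat.mul_le_mul_left _ (by omega)
    omega

/-- The last part of the encoding program: the rows are copied to the array `1` in the order of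
their leading columns. -/
def gatherProg : Prog :=
  .seq (.assign 14 (const 0)) <| .seq (.assign 10 (const 0)) <| .loop (reg 10) (reg 1) <|
  .seq (.ite (const 0) (load 9 (reg 10))
    (.seq (.assign 26 (reg 14)) <| .seq (.assign 27 (sub (load 9 (reg 10)) (const 1))) <|
    .seq (.assign 28 (reg 1)) <| .seq (copyProg 1 5) <| .assign 14 (add (reg 14) (reg 1)))
    .skip) <|
  .assign 10 (add (reg 10) (const 1))

/-- In echelon form the j-th leading column from the left belongs to row j, so copying the marked
rows during one scan of the columns produces the right order. -/
theorem gatherProg_spec {B n k L t : ℕ} {s : State} {flag rec : ℕ → ℕ}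
    {X : Matrix (Fin k) (Fin n) F} (hB : Bounds B qF n k (α.symm 0) (α.symm 1) L)
    (hX : Echelon X) (hs : RowsState α n k L flag rec X s) :
    Halts B gatherProg t s fun t' s' => t' ≤ t + (n * (20 * n + 50) + 20) ∧
      ∀ (r : Fin k) (c : Fin n), s'.mem 1 (r * n + c) = α.symm (X r c) := by
  have hlt := hB.lt
  obtain ⟨p, hp, hpl⟩ := id hX
  refine Halts.seq (Halts.assign (by simp only [Fits]; omega)
    (Halts.seq (Halts.assign (by simp only [Fits]; omega) ?_)))
  refine Halts.loop (fun i s' => ∃ j ≤ k, s'.reg 10 = i ∧ s'.reg 14 = n * j ∧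
    Env qF n k (α.symm 0) (α.symm 1) L s' ∧ (∀ b, b ≠ 1 → s'.mem b = s.mem b) ∧
    (∀ r, (p r : ℕ) < i ↔ (r : ℕ) < j) ∧
    ∀ (r : Fin k) (c : Fin n), (r : ℕ) < j → s'.mem 1 (n * r + c) = α.symm (X r c)) n
    (20 * n + 40) ?_ ?_ ?_ ?_
  · exact ⟨0, Nat.zero_le k, by simp [eval], by simp [eval],
      (hs.env.setReg _ _ (by simp)).setReg _ _ (by simp), fun _ _ => rfl, by simp, by simp⟩
  · rintro i hi s₁ ⟨j, hj, h10, h14, hE, hmem, hpj, hcopy⟩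
    have e1 := hE.reg1
    have h9 : s₁.mem 9 i = s.mem 9 i := by rw [hmem 9 (by simp)]
    have hml := hs.mark_le i
    have hnj : n * j ≤ n * k := Nat.mul_le_mul_left n hj
    refine ⟨by simp only [Fits]; omega, by simp only [Fits]; omega, by simp only [eval]; omega,
      fun t₁ => Halts.seq (Halts.ite (by simp only [Fits]; omega)
      (by simp only [Fits, eval, h10, h9]; omega) (fun h => ?_) fun h => ?_)⟩
    · simp only [eval, h10, h9] at h
      obtain ⟨r, hr⟩ := mem_leadCols.1 ((hs.mark ⟨i, hi⟩).1 h.ne')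
      have hri : (p r : ℕ) = i := congrArg Fin.val ((hpl r).unique hr)
      -- Row `r` has not been copied yet. If it were beyond `j`, row `j` would lead to the left of
      -- the current column and would have been counted already.
      have hrj : (r : ℕ) = j := by
        have h1 := (hpj r).not.1 (by omega)
        by_contra hne
        have h2 : (⟨j, by omega⟩ : Fin k) < r := Fin.lt_def.2 (by simp only; omega)
        have h3 := (hpj ⟨j, by omega⟩).1 (by have := Fin.lt_def.1 (hp h2); omega)
        simp at h3
      have hbase := hs.base_le r _ hr
      have hentry := hs.entry r _ hr
      simp only at hbase hentry
      have hjk : n * (j + 1) ≤ n * k := Nat.mul_le_mul_left n (by omega)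
      rw [Nat.mul_succ] at hjk
      refine Halts.seq (Halts.assign (by simp only [Fits]; omega) (Halts.seq (Halts.assign ?_
        (Halts.seq (Halts.assign (by simp [Fits, e1]; omega) ?_)))))
      · simp [Fits, eval, h10, h9]
        omega
      refine Halts.seq (Halts.mono (copyProg_spec (i := n * j) (j := s.mem 9 i - 1) (m := n)
        (by simp [eval, h14]) (by simp [eval, h10, h9]) (by simp [eval, e1]) (by simp) (by omega)
        (by omega) fun c hc => ?_) ?_)
      · have := hentry ⟨c, hc⟩
        simp only [State.setReg_mem, hmem 5 (by simp)]
        simp only at this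
        rw [this]
        exact (Fin.is_lt _).trans_le (by omega)
      rintro t₂ s₂ ⟨ht₂, hreg₂, hmem₂, hcopy₂⟩
      simp only [State.setReg_mem] at hmem₂ hcopy₂
      have r₂ : ∀ r < 20, s₂.reg r = s₁.reg r := fun r hr => by
        rw [hreg₂ r hr]
        simp [show r ≠ 26 by omega, show r ≠ 27 by omega, show r ≠ 28 by omega]
      have f1 := r₂ 1 (by simp)
      have f10 := r₂ 10 (by simp)
      have f14 := r₂ 14 (by simp)
      refine Halts.assign (by simp only [Fits, eval]; omega) (Halts.assign ?_
        ⟨by simp only [cost] at *; omega, j + 1, by omega, by simp [eval, f10, h10], ?_,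
        ((hE.congr fun r hr => r₂ r (by omega)).setReg _ _ (by simp)).setReg _ _ (by simp),
        fun b hb => ?_, fun r' => ?_, fun r' c hr' => ?_⟩)
      · simp [Fits, eval, f10, h10]
        omega
      · simp [eval, f14, h14, f1, e1, Nat.mul_succ]
      · rw [State.setReg_mem, State.setReg_mem, hmem₂ b hb, hmem b hb]
      · have h1 := hpj r'
        constructor
        · intro h2
          rcases Nat.lt_succ_iff_lt_or_eq.1 h2 with h3 | h3
          · have := h1.1 h3
            omega
          · rw [hp.injective (Fin.ext (h3.trans hri.symm)), hrj]
            omega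
        · intro h2
          rcases Nat.lt_succ_iff_lt_or_eq.1 h2 with h3 | h3
          · have := h1.2 h3
            omega
          · rw [Fin.ext (h3.trans hrj.symm), hri]
            omega
      · rw [State.setReg_mem, State.setReg_mem, hcopy₂]
        have hc := c.2
        rcases Nat.lt_succ_iff_lt_or_eq.1 hr' with h3 | h3
        · have : n * (r' + 1) ≤ n * j := Nat.mul_le_mul_left n h3
          rw [Nat.mul_succ] at this
          rw [if_neg (by omega), hcopy r' c h3]
        · obtain rfl : r' = r := Fin.ext (h3.trans hrj.symm)
          rw [h3, if_pos (by omega), Nat.add_sub_cancel_left, hmem 5 (by simp)]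
          exact hentry c
    · simp only [eval, h10, h9] at h
      have hne : ∀ r, (p r : ℕ) ≠ i := fun r hr =>
        (hs.mark ⟨i, hi⟩).2 (mem_leadCols.2 ⟨r, by rw [← Fin.ext (b := ⟨i, hi⟩) hr]; exact hpl r⟩)
          (by simp only; omega)
      refine Halts.skip (Halts.assign (by simp only [Fits, eval]; omega)
        ⟨by simp only [cost]; omega, j, hj, by simp [eval, h10], by simp [h14],
        hE.setReg _ _ (by simp), hmem, fun r => ?_, hcopy⟩)
      rw [← hpj r]
      have := hne r
      omega
  · rintro s₁ ⟨j, -, h10, -, hE, -⟩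
    have e1 := hE.reg1
    exact ⟨by simp only [Fits]; omega, by simp only [Fits]; omega, by simp only [eval]; omega⟩
  · rintro t' s' ht ⟨j, hj, -, -, -, -, hpj, hcopy⟩
    refine ⟨?_, fun r c => ?_⟩
    · simp only [cost] at ht
      have : n * (20 * n + 40 + (1 + 1 + 1)) ≤ n * (20 * n + 50) :=
        Nat.mul_le_mul_left _ (by omega)
      omega
    · rw [mul_comm (r : ℕ)]
      exact hcopy r c ((hpj r).1 (p r).2)

/-- The encoding program. -/
def encodeProg : Prog :=
  .seq lengthProg <| .seq gaussProg <| .seq traceProg <| .seq rowsProg gatherProg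

/-- The recursion and the first coefficient cost O(n · nk) in total. The two passes over the rows
cost O(n²), which is at most O(nk · n) because 1 ≤ k. -/
theorem encodesWithin_encodeProg {B n k m L : ℕ} (hB : Bounds B qF n k (α.symm 0) (α.symm 1) L)
    (hm : m < gaussRec qF n k) :
    EncodesWithin α encodeProg B n k m (4000 * (n * k * n)) := by
  have hq := hB.two_le
  have hk := hB.one_le
  have hkn := hB.le
  have hdig := hB.digits
  set s₀ := initial (params α n k) [digit qF m] with hs₀
  have hmem₀ : ∀ a, 0 < a → ∀ i, s₀.mem a i = 0 := fun a ha i => by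
    obtain ⟨a, rfl⟩ := Nat.exists_eq_succ_of_ne_zero ha.ne'
    simp [hs₀, initial]
  have h0 : s₀.mem 0 = digit qF m := by simp [hs₀, initial]
  suffices h : Halts B encodeProg 0 s₀ fun t s =>
      t ≤ 4000 * (n * k * n) ∧
      ∀ (r : Fin k) (c : Fin n), s.mem 1 (r * n + c) = α.symm (encode α n k m r c) by
    obtain ⟨t, s, hr, ht, hs⟩ := h
    exact ⟨t, s, hr, by omega, hs⟩
  have hmL : m < qF ^ L := hm.trans (by rw [hdig]; exact gaussRec_lt_pow hq le_rfl le_rfl)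
  refine Halts.seq (Halts.mono (lengthProg_spec hB (by simp [hs₀, initial, params])
    (by simp [hs₀, initial, params]) (by simp [hs₀, initial, params])
    (by simp [hs₀, initial, params]) (by simp [hs₀, initial, params])) ?_)
  rintro t₁ s₁ ⟨ht₁, hE₁, hmem₁⟩
  refine Halts.seq (Halts.mono (gaussProg_spec hB hE₁ (by rw [hmem₁]; exact hmem₀ 2 (by simp))
    (by rw [hmem₁]; exact hmem₀ 12 (by simp))) ?_)
  rintro t₂ s₂ ⟨ht₂, hE₂, hmem₂, h12, h2⟩
  refine Halts.seq (Halts.mono (traceProg_spec (m := m) hB hE₂ hm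
    ⟨hmL, by rw [hmem₂ 0 (by simp) (by simp), hmem₁, h0]⟩ h2 h12 fun a h0 h2 h12 i => by
      rw [hmem₂ a h2 h12, hmem₁]; exact hmem₀ a (by omega) i) ?_)
  rintro t₃ s₃ ⟨ht₃, hE₃, h10, h12, hz, htr⟩
  refine Halts.seq (Halts.mono (rowsProg_spec hB hE₃ h10 h12 (hz 9 (by simp)) htr) ?_)
  rintro t₄ s₄ ⟨ht₄, hs₄⟩
  refine Halts.mono (gatherProg_spec hB (echelon_encode α hkn m) hs₄) ?_
  rintro t₅ s₅ ⟨ht₅, hout⟩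
  refine ⟨?_, hout⟩
  subst hdig
  have a1 : n * n ≤ n * k * n := by nlinarith
  have a2 : n ≤ n * n := by nlinarith
  have a3 : k * (n * k) ≤ n * k * n := by nlinarith [Nat.mul_le_mul_left (n * k) hkn]
  have a4 : n * k ≤ n * k * n := by nlinarith [Nat.mul_le_mul_left (n * k) (hk.trans hkn)]
  have e1 : k * (80 * (n * k + 1) + 50) = 80 * (k * (n * k)) + 130 * k := by ring
  have e2 : n * (1000 * (n * k + 1) + 1010) = 1000 * (n * k * n) + 2010 * n := by ring
  have e3 : n * (80 * n + 90) = 80 * (n * n) + 90 * n := by ring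
  have e4 : n * (20 * n + 50) = 20 * (n * n) + 50 * n := by ring
  omega

end EncodeProg

end GrassGray

namespace GrassGray

/-! ### The bounds for the words and for the time -/

/-- Multiplying 1 + q + ⋯ + q^(m-1) by 1 forces the machine to write m non-zero digits into an array
that is initially zero. -/
theorem IsMulCost.le {q : ℕ} {M : ℕ → ℕ} (hq : 2 ≤ q) (h : IsMulCost q M) {m : ℕ} (hm : m ≠ 0) :
    m ≤ M m := by
  obtain ⟨p, c, h⟩ := h
  obtain ⟨t, s, hr, ht, hs⟩ := h m (∑ t ∈ Finset.range m, 1 * q ^ t) 1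
    (sum_mul_pow_lt (fun _ => 1) m fun _ _ => hq) (Nat.one_lt_pow hm hq)
  obtain ⟨hfin, hcard⟩ := hr.ncard_changed_le 2
  refine le_trans ?_ (hcard.trans ht)
  have hsub : (Finset.range m : Set ℕ) ⊆
      {i | s.mem 2 i ≠ (initial [q, m] [digit q (∑ t ∈ Finset.range m, 1 * q ^ t),
        digit q 1]).mem 2 i} := by
    intro i hi
    have hi' : i < m := by simpa using hi
    simp only [Set.mem_ofPred_eq, hs, mul_one]
    rw [digit_sum (fun _ => 1) m (fun _ _ => hq) i hi']
    simp [initial]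
  have := Set.ncard_le_ncard hsub hfin
  rwa [Set.ncard_coe_finset, Finset.card_range] at this

/-- The words hold addresses up to about n², twice a digit, and small constants. As q + n ≥ 3, the
fourth power exceeds nine times the square, which leaves enough room. -/
theorem bounds_pow {q n k z o : ℕ} (hq : 2 ≤ q) (hz : z < q) (ho : o < q) (hk : 1 ≤ k)
    (hkn : k ≤ n) : Bounds ((q + n) ^ 4) q n k z o (n * k + 1) where
  two_le := hq
  lt := by
    have h1 : n * k ≤ n * n := Nat.mul_le_mul_left n hkn
    obtain ⟨a, rfl⟩ := Nat.exists_eq_add_of_le hq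
    obtain ⟨b, rfl⟩ := Nat.exists_eq_add_of_le (hk.trans hkn)
    have h2 : 9 * (2 + a + (1 + b)) ^ 2 ≤ (2 + a + (1 + b)) ^ 4 := by
      rw [show (2 + a + (1 + b)) ^ 4 = (2 + a + (1 + b)) ^ 2 * (2 + a + (1 + b)) ^ 2 by ring]
      exact Nat.mul_le_mul_right _ (by nlinarith)
    nlinarith [Nat.zero_le (a * b), Nat.zero_le (a * a), Nat.zero_le (b * b)]
  zero_lt := hz
  one_lt := ho
  digits := rfl
  one_le := hk
  le := hkn

end GrassGray

/-! ### The theorem -/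

theorem mainTheorem9 :
    ∃ (enc dec : GrassGray.Prog) (c K : ℕ),
      ∀ (F : Type*) [Field F] [Fintype F] [DecidableEq F] (α : Fin (Fintype.card F) ≃ F)
        (n k : ℕ), 1 ≤ k → k ≤ n →
        -- the decoding function is the reverse of the encoding function
        (∀ m < GrassGray.gauss (Fintype.card F) n k,
          GrassGray.decode α (GrassGray.encode α n k m) = m) ∧
        -- both are computed in `O(M[nk] n)` steps
        ∀ M : ℕ → ℕ, GrassGray.IsMulCost (Fintype.card F) M →
          (∀ m < GrassGray.gauss (Fintype.card F) n k,
            GrassGray.EncodesWithin α enc ((Fintype.card F + n) ^ c) n k m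
              (K * (M (n * k) * n))) ∧
          (∀ (W : Submodule F (Fin n → F)) (X : Matrix (Fin k) (Fin n) F),
            Module.finrank F W = k → GrassGray.IsCanonical W X →
            GrassGray.DecodesWithin α dec ((Fintype.card F + n) ^ c) X
              (K * (M (n * k) * n))) := by
  refine ⟨GrassGray.encodeProg, GrassGray.decodeProg, 4, 4000, ?_⟩
  intro F _ _ _ α n k hk hkn
  have hq : 2 ≤ Fintype.card F := Fintype.one_lt_card
  have hB := GrassGray.bounds_pow hq (α.symm 0).2 (α.symm 1).2 hk hkn
  rw [GrassGray.gauss_eq_gaussRec hq hkn]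
  refine ⟨fun m hm => GrassGray.decode_encode α hkn hm, fun M hM => ?_⟩
  -- The explicit bound of the programs is compared with the multiplication cost through `n * k ≤ M
  -- (n * k)`.
  have hT : 4000 * (n * k * n) ≤ 4000 * (M (n * k) * n) :=
    Nat.mul_le_mul_left _ (Nat.mul_le_mul_right _
      (hM.le hq (Nat.mul_pos (hk.trans hkn) hk).ne'))
  refine ⟨fun m hm => ?_, fun W X _ hX => ?_⟩
  · obtain ⟨t, s, hr, ht, hs⟩ := GrassGray.encodesWithin_encodeProg hB hm
    exact ⟨t, s, hr, ht.trans hT, hs⟩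
  · obtain ⟨t, s, hr, ht, hs⟩ := GrassGray.decodesWithin_decodeProg hB hX.echelon hX.trailInj
    exact ⟨t, s, hr, ht.trans hT, hs⟩
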